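/- Let $X^\pm$ be $C^2$ vector fields on $\mathbb{R}^2$, $X^\pm=(X^\pm_1,X^\pm_2)$, and let $Z$ be the Filippov system equal to $X^+$ for $y>0$ and to $X^-$ for $y<0$, with switching line $\Sigma=\{y=0\}$. Assume that the origin is a generic visible fold-regular point: $X^+_2(0,0)=0$, $X^+_1(0,0)>0$, $\partial_xX^+_2(0,0)\neq 0$, $X^+_2(x,0)<0$ for $x<0$, $X^+_2(x,0)>0$ for $x>0$, and $X^-_2(0,0)>0$. Let $\varphi:\mathbb{R}\to\mathbb{R}$ be Lipschitz, equal to $-1$ on $(-\infty,-1]$, equal to $1$ on $[1,\infty)$ and strictly increasing on $[-1,1]$ (this includes the piecewise linear transition function and those of class $C^{p-1}$, $p\ge 2$), and put $$Z_\varepsilon(x,y)=\frac{X^++X^-}{2}(x,y)+\varphi\Big(\frac{y}{\varepsilon}\Big)\frac{X^+-X^-}{2}(x,y),\qquad \varepsilon>0 .$$ The interior (exterior) of a closed curve is the union of the bounded (unbounded) components of its complement. Suppose that $X^+$ has a center $p\in\{y>0\}$ surrounded by periodic orbits some of which intersect $\Sigma$; that is, there is an open set $A\ni p$ meeting $\Sigma$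 such that $X^+(p)=0$ and every point of $A\setminus\{p\}$ lies on a non-constant periodic orbit of $X^+$ that surrounds $p$ and is contained, together with its interior, in $A$. Then there are points $(x_\varepsilon,\varepsilon)$, with $x_\varepsilon\to0$ as $\varepsilon\to0^+$, such that: 1. For every $R>0$ and all small enough $\varepsilon>0$, $(x_\varepsilon,\varepsilon)$ is the only point of the line $y=\varepsilon$ with $|x|\le R$ at which $X^+$ is tangent to this line, i.e. $X^+_2(x,\varepsilon)=0$. 2. For all small enough $\varepsilon>0$ the orbit $\Gamma_\varepsilon$ of $X^+$ through $(x_\varepsilon,\varepsilon)$ is periodic, it is also a periodic orbit of $Z_\varepsilon$, and its interior is foliated by periodic orbits of $Z_\varepsilon$: it contains $p$, $Z_\varepsilon(p)=0$, and every other point of it lies on a non-constant periodic orbit of $Z_\varepsilon$ that is contained in the interior of $\Gamma_\varepsilon$ and surrounds $p$. 3. $\Gamma_\varepsilon$ attracts all exterior orbits near it and in the regularization strip, in the following sense. Let $M,N\ge0$ be such that $X^-_2(x,0)>0$ for $-M\le x\le N$; $(X^+_1X^-_2-X^-_1X^+_2)(x,0)>0$ for $-M\le x\le0$ (so the sliding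 motion on $[-M,0)$ is to the right); and, for $0\le x\le N$, the forward $X^+$-orbit of $(x,0)$ stays in $\{y\ge0\}$ until it arrives at a point $(s,0)$ with $-M\le s\le0$. (These conditions hold for $M=N=0$.) Then there is an open set $U\supset[-M,N]\times\{0\}$, independent of $\varepsilon$, such that for all small enough $\varepsilon>0$: $\Gamma_\varepsilon\subset U$, and for every point $q\in U$ in the exterior of $\Gamma_\varepsilon$ the forward $Z_\varepsilon$-orbit of $q$ exists for all times $t\ge0$ and its distance to $\Gamma_\varepsilon$ tends to $0$ as $t\to\infty$. So $\Gamma_\varepsilon$ is a semistable periodic orbit of $Z_\varepsilon$. -/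

import Mathlib

open Filter Topology Set

/-- `γ` is a non-constant periodic solution, defined for all times, of the planar autonomous
system `q' = X q`.  Its orbit is `Set.range γ`. -/
def IsPeriodicSol (X : ℝ × ℝ → ℝ × ℝ) (γ : ℝ → ℝ × ℝ) : Prop :=
  (∀ t, HasDerivAt γ (X (γ t)) t) ∧ (∃ T : ℝ, 0 < T ∧ Function.Periodic γ T) ∧
    ∃ t, γ t ≠ γ 0

/-- The interior of a closed curve `Γ`: the points off `Γ` whose connected component in the
complement of `Γ` is bounded. -/
def curveInterior (Γ : Set (ℝ × ℝ)) : Set (ℝ × ℝ) :=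
  {q | q ∉ Γ ∧ Bornology.IsBounded (connectedComponentIn Γᶜ q)}

/-- The exterior of a closed curve `Γ`: the points off `Γ` whose connected component in the
complement of `Γ` is unbounded. -/
def curveExterior (Γ : Set (ℝ × ℝ)) : Set (ℝ × ℝ) :=
  {q | q ∉ Γ ∧ ¬ Bornology.IsBounded (connectedComponentIn Γᶜ q)}

/-- `p` is a center of `X`, and the open set `A` is filled, except for the equilibrium `p`, by
periodic orbits of `X` that surround `p`.  (The largest such `A` is the period annulus together
with `p`.) -/
structure IsCenter (X : ℝ × ℝ → ℝ × ℝ) (p : ℝ × ℝ) (A : Set (ℝ × ℝ)) : Prop where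
  isOpen : IsOpen A
  mem : p ∈ A
  equilibrium : X p = 0
  periodic : ∀ q ∈ A, q ≠ p → ∃ γ : ℝ → ℝ × ℝ, IsPeriodicSol X γ ∧ q ∈ range γ ∧
    range γ ⊆ A ∧ p ∈ curveInterior (range γ) ∧ curveInterior (range γ) ⊆ A

/-- The vector fields `Xp` (for `y > 0`) and `Xm` (for `y < 0`) form a planar Filippov system with
switching line `y = 0` and a generic visible fold-regular point at the origin. -/
structure IsVisibleFold (Xp Xm : ℝ × ℝ → ℝ × ℝ) : Prop where
  contDiff_plus : ContDiff ℝ 2 Xp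
  contDiff_minus : ContDiff ℝ 2 Xm
  tangent : (Xp (0, 0)).2 = 0
  rightward : 0 < (Xp (0, 0)).1
  generic : deriv (fun x : ℝ => (Xp (x, 0)).2) 0 ≠ 0
  down : ∀ x : ℝ, x < 0 → (Xp (x, 0)).2 < 0
  up : ∀ x : ℝ, 0 < x → 0 < (Xp (x, 0)).2
  minus_up : 0 < (Xm (0, 0)).2

/-- Transition functions of the regularization: Lipschitz, equal to `-1` on `v ≤ -1` and to `1` on
`v ≥ 1`, and strictly increasing in between.  This covers both the piecewise linear transition
function and the increasing ones of class `C ^ (p - 1)`, `p ≥ 2`. -/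
structure IsTransition (φ : ℝ → ℝ) : Prop where
  lipschitz : ∃ K : NNReal, LipschitzWith K φ
  left : ∀ v : ℝ, v ≤ -1 → φ v = -1
  right : ∀ v : ℝ, 1 ≤ v → φ v = 1
  strictMono : StrictMonoOn φ (Icc (-1) 1)

/-- The Sotomayor-Teixeira regularization
`Z_ε = (X⁺ + X⁻) / 2 + φ (y / ε) (X⁺ - X⁻) / 2`. -/
noncomputable def regularized (Xp Xm : ℝ × ℝ → ℝ × ℝ) (φ : ℝ → ℝ) (ε : ℝ) (q : ℝ × ℝ) : ℝ × ℝ :=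
  (1 / 2 : ℝ) • (Xp q + Xm q) + (φ (q.2 / ε) / 2) • (Xp q - Xm q)

/-- The forward orbit of `q` under `Z` exists for all positive times and tends to `Γ`. -/
def IsAttracted (Z : ℝ × ℝ → ℝ × ℝ) (q : ℝ × ℝ) (Γ : Set (ℝ × ℝ)) : Prop :=
  ∃ γ : ℝ → ℝ × ℝ, γ 0 = q ∧ (∀ t ∈ Ici (0 : ℝ), HasDerivWithinAt γ (Z (γ t)) (Ici 0) t) ∧
    Tendsto (fun t => Metric.infDist (γ t) Γ) atTop (𝓝 0)

/-- At `(x, 0)` the lower field points up, and the determinant `X⁺₁ X⁻₂ - X⁻₁ X⁺₂` is positive.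
For `x < 0` this says that `(x, 0)` is a sliding point at which the Filippov sliding field
`(X⁺₁ X⁻₂ - X⁻₁ X⁺₂) / (X⁻₂ - X⁺₂)` moves to the right, towards the fold. -/
def SlidesRight (Xp Xm : ℝ × ℝ → ℝ × ℝ) (x : ℝ) : Prop :=
  0 < (Xm (x, 0)).2 ∧
    0 < (Xp (x, 0)).1 * (Xm (x, 0)).2 - (Xm (x, 0)).1 * (Xp (x, 0)).2

/-- The forward orbit of `(x, 0)` under `X` stays in `y ≥ 0` until it arrives at a point `(s, 0)`
with `-M ≤ s ≤ 0`. -/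
def ReturnsTo (X : ℝ × ℝ → ℝ × ℝ) (x M : ℝ) : Prop :=
  ∃ (τ : ℝ) (γ : ℝ → ℝ × ℝ), 0 ≤ τ ∧ γ 0 = (x, 0) ∧
    (∀ t ∈ Icc 0 τ, HasDerivWithinAt γ (X (γ t)) (Icc 0 τ) t ∧ 0 ≤ (γ t).2) ∧
    (γ τ).2 = 0 ∧ -M ≤ (γ τ).1 ∧ (γ τ).1 ≤ 0

/-! Let the height of a point of the period annulus be the least `y` on the orbit (leaf) of `X⁺`
through it. Height is constant along `X⁺` and acts as a continuous Lyapunov function for `Z_ε`, so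
no return map is needed. The lowest point of a leaf is a horizontal tangency of `X⁺`, and each level
`m` near 0 carries only one in the region used, `(ξ m, m)`. Hence small heights label leaves
injectively, and `Γ_ε` is the leaf of height `ε`. It and its interior lie in `y ≥ ε`, where `Z_ε =
X⁺`, so the orbits of the center persist there.

Exterior points of the annulus have height below `ε`. Height is conserved where `y ≥ ε`. A point of
small height with small `y` is close to the fold (`exists_height_gap`); there the determinant of
`X⁺` and `Z_ε` is `(1 - φ)/2` times the positive determinant of `X⁺` and `X⁻` (`cross_regularized`),
so `Z_ε` crosses the leaves upwards and height increases, strictly if `y < ε`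
(`exists_height_monotone`). By uniqueness of solutions `Γ_ε` is not reached in finite time, so
heights along an orbit converge to some `l ≤ ε`. If `l < ε`, the orbit of a limit point would have
constant height `l`, yet it would have to dip below `y = ε`, where height grows. So `l = ε`, and
compactness turns this into convergence to `Γ_ε` (`exists_attracted`).

From a neighbourhood of `[-M, N]` it remains to reach the fold. Over the sliding segment there is a
function whose derivatives along `X⁺` and `X⁻` on the switching line are the same positive
determinant; it therefore grows along `Z_ε` for every `φ` and small `ε`
(`exists_reaches_of_slidesRight`). From the crossing segment an orbit climbs through the strip and
then shadows an `X⁺`-orbit back (`exists_reaches_of_returnsTo`).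

Continuity of the height (`continuousOn_height`) combines continuous dependence on initial values
with the nesting of leaves. The nesting comes from connectedness alone, without the Jordan curve
theorem. -/

/-! ### Solutions of locally Lipschitz planar fields. -/

/-- `v` solves `v' = Z v` on the time set `s`. -/
def IsSolOn (Z : ℝ × ℝ → ℝ × ℝ) (v : ℝ → ℝ × ℝ) (s : Set ℝ) : Prop :=
  ∀ t ∈ s, HasDerivWithinAt v (Z (v t)) s t

theorem IsSolOn.continuousOn {Z : ℝ × ℝ → ℝ × ℝ} {v : ℝ → ℝ × ℝ} {s : Set ℝ}
    (h : IsSolOn Z v s) : ContinuousOn v s := fun t ht => (h t ht).continuousWithinAt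

theorem IsSolOn.mono {Z : ℝ × ℝ → ℝ × ℝ} {v : ℝ → ℝ × ℝ} {s s' : Set ℝ}
    (h : IsSolOn Z v s) (hs : s' ⊆ s) : IsSolOn Z v s' := fun t ht => (h t (hs ht)).mono hs

theorem IsSolOn.congr_field {Z Z' : ℝ × ℝ → ℝ × ℝ} {v : ℝ → ℝ × ℝ} {s : Set ℝ}
    (h : IsSolOn Z v s) (hs : ∀ t ∈ s, Z (v t) = Z' (v t)) : IsSolOn Z' v s :=
  fun t ht => hs t ht ▸ h t ht

theorem IsSolOn.shift {Z : ℝ × ℝ → ℝ × ℝ} {v : ℝ → ℝ × ℝ} {s s' : Set ℝ}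
    (h : IsSolOn Z v s) (c : ℝ) (hs : MapsTo (fun t => t + c) s' s) :
    IsSolOn Z (fun t => v (t + c)) s' := by
  intro t ht
  have h1 := h (t + c) (hs ht)
  have h2 : HasDerivWithinAt (fun t : ℝ => t + c) 1 s' t :=
    ((hasDerivAt_id t).add_const c).hasDerivWithinAt
  have h3 := h1.scomp t h2 hs
  rw [one_smul] at h3
  exact h3

/-- In the sup norm the ball is a square, and clamping both coordinates is a 1-Lipschitz retraction
onto it; precompose `Z` with this clamp. -/
theorem LocallyLipschitz.exists_lipschitz_bounded {Z : ℝ × ℝ → ℝ × ℝ} (hZ : LocallyLipschitz Z)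
    (R : ℝ) (hR : 0 ≤ R) : ∃ (Z' : ℝ × ℝ → ℝ × ℝ) (K C : NNReal), LipschitzWith K Z' ∧
      (∀ q, ‖Z' q‖ ≤ C) ∧ ∀ q ∈ Metric.closedBall (0 : ℝ × ℝ) R, Z' q = Z q := by
  have hc : IsCompact (Metric.closedBall (0 : ℝ × ℝ) R) := isCompact_closedBall 0 R
  obtain ⟨K, hK⟩ := (hZ.locallyLipschitzOn (s := Metric.closedBall (0 : ℝ × ℝ) R)
    ).exists_lipschitzOnWith_of_compact hc
  obtain ⟨C, hC⟩ := hc.exists_bound_of_continuousOn hZ.continuous.continuousOn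
  set cl : ℝ × ℝ → ℝ × ℝ := fun q => (max (-R) (min q.1 R), max (-R) (min q.2 R)) with hcl
  have hcl1 : LipschitzWith 1 cl := by
    have h1 := ((LipschitzWith.prod_fst (α := ℝ) (β := ℝ)).min_const R).const_max (-R)
    have h2 := ((LipschitzWith.prod_snd (α := ℝ) (β := ℝ)).min_const R).const_max (-R)
    simpa using h1.prodMk h2
  have hclm : ∀ q, cl q ∈ Metric.closedBall (0 : ℝ × ℝ) R := by
    intro q
    rw [mem_closedBall_zero_iff, Prod.norm_def, max_le_iff, Real.norm_eq_abs, Real.norm_eq_abs,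
      abs_le, abs_le]
    refine ⟨⟨le_max_left _ _, ?_⟩, ⟨le_max_left _ _, ?_⟩⟩
    · exact max_le (by linarith) (min_le_right _ _)
    · exact max_le (by linarith) (min_le_right _ _)
  refine ⟨Z ∘ cl, K, C.toNNReal, ?_, ?_, ?_⟩
  · have := hK.comp (hcl1.lipschitzOnWith (s := univ)) (fun q _ => hclm q)
    simpa using lipschitzOnWith_univ.1 this
  · intro q
    exact (hC _ (hclm q)).trans (Real.le_coe_toNNReal C)
  · intro q hq
    rw [mem_closedBall_zero_iff, Prod.norm_def, max_le_iff, Real.norm_eq_abs, Real.norm_eq_abs,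
      abs_le, abs_le] at hq
    simp [hcl, hq.1.1, hq.1.2, hq.2.1, hq.2.2]

/-- With speed at most `C`, Picard–Lindelöf applies on every interval `[-(n+1), n+1]` with a ball of
radius `C (n+1)`; uniqueness glues the solutions. -/
theorem exists_global_solution {E : Type*} [NormedAddCommGroup E] [NormedSpace ℝ E]
    [CompleteSpace E] {Z : E → E} {K C : NNReal} (hK : LipschitzWith K Z)
    (hC : ∀ q, ‖Z q‖ ≤ C) (q : E) : ∃ v : ℝ → E, v 0 = q ∧ ∀ t, HasDerivAt v (Z (v t)) t := by
  have key : ∀ n : ℕ, ∃ v : ℝ → E, v 0 = q ∧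
      ∀ t ∈ Icc (-(n + 1 : ℝ)) (n + 1), HasDerivWithinAt v (Z (v t)) (Icc (-(n + 1 : ℝ)) (n + 1)) t := by
    intro n
    have h0 : (0 : ℝ) ∈ Icc (-(n + 1 : ℝ)) (n + 1) := by
      constructor <;> linarith [(Nat.cast_nonneg n : (0 : ℝ) ≤ n)]
    have hp : IsPicardLindelof (fun _ => Z) ⟨0, h0⟩ q (C * (n + 1)) 0 C K :=
      { lipschitzOnWith := fun t _ => hK.lipschitzOnWith
        continuousOn := fun x _ => continuousOn_const
        norm_le := fun t _ x _ => hC x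
        mul_max_le := by simp }
    exact hp.exists_eq_forall_mem_Icc_hasDerivWithinAt₀
  choose v hv0 hv using key
  have hd : ∀ n : ℕ, ∀ t ∈ Ioo (-(n + 1 : ℝ)) (n + 1), HasDerivAt (v n) (Z (v n t)) t :=
    fun n t ht => (hv n t (Ioo_subset_Icc_self ht)).hasDerivAt (Icc_mem_nhds ht.1 ht.2)
  have heq : ∀ n m : ℕ, n ≤ m → EqOn (v n) (v m) (Ioo (-(n + 1 : ℝ)) (n + 1)) := by
    intro n m hnm
    have h1 : (n : ℝ) ≤ m := by exact_mod_cast hnm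
    have h0 : (0 : ℝ) ≤ n := Nat.cast_nonneg n
    refine ODE_solution_unique_of_mem_Ioo (v := fun _ => Z) (s := fun _ => univ) (K := K)
      (t₀ := 0) (fun t _ => hK.lipschitzOnWith) ⟨by linarith, by linarith⟩
      (fun t ht => ⟨hd n t ht, trivial⟩) (fun t ht => ⟨hd m t ⟨by linarith [ht.1], by linarith [ht.2]⟩, trivial⟩) ?_
    rw [hv0, hv0]
  refine ⟨fun t => v ⌈|t|⌉₊ t, by simp [hv0], fun t => ?_⟩
  have hmem : ∀ s : ℝ, s ∈ Ioo (-((⌈|s|⌉₊ : ℝ) + 1)) (⌈|s|⌉₊ + 1) := by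
    intro s
    have := Nat.le_ceil |s|
    have := abs_le.1 this
    exact ⟨by linarith [this.1], by linarith [this.2]⟩
  refine (hd _ t (hmem t)).congr_of_eventuallyEq ?_
  filter_upwards [isOpen_Ioo.mem_nhds (hmem t)] with s hs
  rcases le_total ⌈|t|⌉₊ ⌈|s|⌉₊ with h | h
  · exact (heq _ _ h hs).symm
  · exact heq _ _ h (hmem s)

/-- A curve defined for all times that solves the equation while it is in the ball replaces maximal
intervals of existence. -/
theorem LocallyLipschitz.exists_curve {Z : ℝ × ℝ → ℝ × ℝ} (hZ : LocallyLipschitz Z) (R : ℝ)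
    (q : ℝ × ℝ) : ∃ v : ℝ → ℝ × ℝ, v 0 = q ∧ Continuous v ∧
      ∀ t, v t ∈ Metric.closedBall (0 : ℝ × ℝ) R → HasDerivAt v (Z (v t)) t := by
  obtain ⟨Z', K, C, hK, hC, hZZ⟩ := hZ.exists_lipschitz_bounded (max R 0) (le_max_right _ _)
  obtain ⟨v, hv0, hv⟩ := exists_global_solution hK hC q
  refine ⟨v, hv0, continuous_iff_continuousAt.2 fun t => (hv t).continuousAt, fun t ht => ?_⟩
  rw [← hZZ _ (Metric.closedBall_subset_closedBall (le_max_left _ _) ht)]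
  exact hv t

theorem IsSolOn.eqOn_right {Z : ℝ × ℝ → ℝ × ℝ} (hZ : LocallyLipschitz Z) {v w : ℝ → ℝ × ℝ}
    {a b : ℝ} (hv : IsSolOn Z v (Icc a b)) (hw : IsSolOn Z w (Icc a b)) (h : v a = w a) :
    EqOn v w (Icc a b) := by
  have hc : IsCompact (v '' Icc a b ∪ w '' Icc a b) :=
    (isCompact_Icc.image_of_continuousOn hv.continuousOn).union
      (isCompact_Icc.image_of_continuousOn hw.continuousOn)
  obtain ⟨K, hK⟩ := (hZ.locallyLipschitzOn (s := v '' Icc a b ∪ w '' Icc a b)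
    ).exists_lipschitzOnWith_of_compact hc
  exact ODE_solution_unique_of_mem_Icc_right (v := fun _ => Z)
    (s := fun _ => v '' Icc a b ∪ w '' Icc a b) (fun t _ => hK) hv.continuousOn
    (fun t ht => (hv t (Ico_subset_Icc_self ht)).mono_of_mem_nhdsWithin (Icc_mem_nhdsGE_of_mem ht))
    (fun t ht => Or.inl ⟨t, Ico_subset_Icc_self ht, rfl⟩) hw.continuousOn
    (fun t ht => (hw t (Ico_subset_Icc_self ht)).mono_of_mem_nhdsWithin (Icc_mem_nhdsGE_of_mem ht))
    (fun t ht => Or.inr ⟨t, Ico_subset_Icc_self ht, rfl⟩) h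

theorem IsSolOn.eqOn_left {Z : ℝ × ℝ → ℝ × ℝ} (hZ : LocallyLipschitz Z) {v w : ℝ → ℝ × ℝ}
    {a b : ℝ} (hv : IsSolOn Z v (Icc a b)) (hw : IsSolOn Z w (Icc a b)) (h : v b = w b) :
    EqOn v w (Icc a b) := by
  have hc : IsCompact (v '' Icc a b ∪ w '' Icc a b) :=
    (isCompact_Icc.image_of_continuousOn hv.continuousOn).union
      (isCompact_Icc.image_of_continuousOn hw.continuousOn)
  obtain ⟨K, hK⟩ := (hZ.locallyLipschitzOn (s := v '' Icc a b ∪ w '' Icc a b)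
    ).exists_lipschitzOnWith_of_compact hc
  exact ODE_solution_unique_of_mem_Icc_left (v := fun _ => Z)
    (s := fun _ => v '' Icc a b ∪ w '' Icc a b) (fun t _ => hK) hv.continuousOn
    (fun t ht => (hv t (Ioc_subset_Icc_self ht)).mono_of_mem_nhdsWithin (Icc_mem_nhdsLE_of_mem ht))
    (fun t ht => Or.inl ⟨t, Ioc_subset_Icc_self ht, rfl⟩) hw.continuousOn
    (fun t ht => (hw t (Ioc_subset_Icc_self ht)).mono_of_mem_nhdsWithin (Icc_mem_nhdsLE_of_mem ht))
    (fun t ht => Or.inr ⟨t, Ioc_subset_Icc_self ht, rfl⟩) h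

theorem IsSolOn.eqOn_of_eq {Z : ℝ × ℝ → ℝ × ℝ} (hZ : LocallyLipschitz Z) {v w : ℝ → ℝ × ℝ}
    {a b c : ℝ} (hv : IsSolOn Z v (Icc a b)) (hw : IsSolOn Z w (Icc a b)) (hc : c ∈ Icc a b)
    (h : v c = w c) : EqOn v w (Icc a b) := by
  intro t ht
  rcases le_total t c with htc | htc
  · exact IsSolOn.eqOn_left hZ (hv.mono (Icc_subset_Icc_right hc.2))
      (hw.mono (Icc_subset_Icc_right hc.2)) h ⟨ht.1, htc⟩
  · exact IsSolOn.eqOn_right hZ (hv.mono (Icc_subset_Icc_left hc.1))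
      (hw.mono (Icc_subset_Icc_left hc.1)) h ⟨htc, ht.2⟩

theorem IsSolOn.exists_nearby {Z : ℝ × ℝ → ℝ × ℝ} (hZ : LocallyLipschitz Z) {v : ℝ → ℝ × ℝ}
    {T : ℝ} (hv : IsSolOn Z v (Icc 0 T)) {δ : ℝ} (hδ : 0 < δ) :
    ∀ᶠ q in 𝓝 (v 0), ∃ w : ℝ → ℝ × ℝ, w 0 = q ∧ IsSolOn Z w (Icc 0 T) ∧
      ∀ t ∈ Icc 0 T, dist (w t) (v t) < δ := by
  obtain ⟨R, hR⟩ := (isCompact_Icc.image_of_continuousOn hv.continuousOn).isBounded.subset_closedBall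
    (0 : ℝ × ℝ)
  set R' := max (R + δ) 0
  obtain ⟨Z', K, C, hK, hC, hZZ⟩ := hZ.exists_lipschitz_bounded R' (le_max_right _ _)
  -- Grönwall multiplies the initial distance by at most `exp (K T)`. The nearby solution thus stays
  -- in the ball of radius `R + δ`, where the truncated field is `Z`.
  have hev : ∀ᶠ q in 𝓝 (v 0), dist q (v 0) < δ * (Real.exp (K * T))⁻¹ :=
    Metric.ball_mem_nhds _ (by positivity)
  filter_upwards [hev] with q hq
  obtain ⟨w, hw0, hw⟩ := exists_global_solution hK hC q
  have hvR : ∀ t ∈ Icc 0 T, ‖v t‖ ≤ R := fun t ht => by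
    simpa using hR ⟨t, ht, rfl⟩
  have hv' : IsSolOn Z' v (Icc 0 T) := hv.congr_field fun t ht => by
    rw [hZZ _ _]
    rw [mem_closedBall_zero_iff]
    exact ((hvR t ht).trans (by linarith)).trans (le_max_left _ _)
  have hclose : ∀ t ∈ Icc 0 T, dist (w t) (v t) < δ := by
    intro t ht
    have hT : 0 ≤ T := ht.1.trans ht.2
    have h1 := dist_le_of_trajectories_ODE (v := fun _ => Z') (K := K) (f := w) (g := v) (a := 0)
      (b := T) (δ := dist q (v 0)) (fun _ => hK)
      (fun t _ => (hw t).continuousAt.continuousWithinAt)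
      (fun t _ => (hw t).hasDerivWithinAt) hv'.continuousOn
      (fun t ht => (hv' t (Ico_subset_Icc_self ht)).mono_of_mem_nhdsWithin
        (Icc_mem_nhdsGE_of_mem ht)) (by rw [hw0]) t ht
    have h2 : Real.exp (K * (t - 0)) ≤ Real.exp (K * T) := by
      rw [Real.exp_le_exp, sub_zero]
      exact mul_le_mul_of_nonneg_left ht.2 K.2
    have h3 : dist q (v 0) * Real.exp (K * T) < δ := by
      have := mul_lt_mul_of_pos_right hq (Real.exp_pos (K * T))
      rwa [inv_mul_cancel_right₀ (Real.exp_pos _).ne'] at this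
    exact h1.trans_lt (lt_of_le_of_lt (mul_le_mul_of_nonneg_left h2 dist_nonneg) h3)
  refine ⟨w, hw0, fun t ht => ?_, hclose⟩
  rw [← hZZ]
  · exact (hw t).hasDerivWithinAt
  · rw [mem_closedBall_zero_iff]
    have h1 := hclose t ht
    have h2 := hvR t ht
    have h3 : ‖w t‖ ≤ ‖v t‖ + dist (w t) (v t) := by
      rw [dist_eq_norm]
      simpa using norm_add_le (v t) (w t - v t)
    exact (by linarith : ‖w t‖ ≤ R + δ).trans (le_max_left _ _)

/-- The form in which trapping is proved later: a curve stays in a closed set as soon as, at each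
time up to which it has stayed, it also stays a little longer. -/
theorem exists_exit_time {v : ℝ → ℝ × ℝ} (hv : Continuous v) {S : Set (ℝ × ℝ)} (hS : IsClosed S)
    (h0 : v 0 ∈ S) (hex : ∃ t, 0 ≤ t ∧ v t ∉ S) :
    ∃ T, 0 ≤ T ∧ (∀ t ∈ Icc 0 T, v t ∈ S) ∧ ∃ᶠ t in 𝓝[>] T, v t ∉ S := by
  by_contra! hcon
  obtain ⟨b, hb, hbS⟩ := hex
  have := IsClosed.Icc_subset_of_forall_mem_nhdsWithin (a := (0 : ℝ)) (b := b)
    (s := {t | ∀ r ∈ Icc 0 t, v r ∈ S}) ?_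
    (fun r hr => by rwa [le_antisymm hr.2 hr.1]) ?_
  · exact hbS (this ⟨hb, le_rfl⟩ b ⟨hb, le_rfl⟩)
  · rw [show {t | ∀ r ∈ Icc 0 t, v r ∈ S} ∩ Icc 0 b = {t | ∀ r ∈ Ico 0 t, v r ∈ S} ∩ Icc 0 b from ?_]
    · refine IsClosed.inter ?_ isClosed_Icc
      have : {t : ℝ | ∀ r ∈ Ico 0 t, v r ∈ S} = ⋂ r ∈ {r : ℝ | 0 ≤ r ∧ v r ∉ S}, Iic r := by
        ext t
        simp only [mem_ofPred_eq, mem_iInter, mem_Iic, mem_Ico]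
        constructor
        · rintro h r ⟨hr, hrS⟩
          by_contra! hlt
          exact hrS (h r ⟨hr, hlt⟩)
        · rintro h r ⟨hr, hrt⟩
          by_contra hrS
          exact absurd (h r ⟨hr, hrS⟩) (not_le.2 hrt)
      rw [this]
      exact isClosed_biInter fun _ _ => isClosed_Iic
    · ext t
      simp only [mem_inter_iff, mem_ofPred_eq, and_congr_left_iff]
      rintro ⟨ht0, -⟩
      refine ⟨fun h r hr => h r (Ico_subset_Icc_self hr), fun h r hr => ?_⟩
      rcases hr.2.lt_or_eq with hlt | rfl
      · exact h r ⟨hr.1, hlt⟩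
      rcases ht0.eq_or_lt with rfl | hpos
      · exact h0
      have : r ∈ closure (Ico 0 r) := by
        rw [closure_Ico hpos.ne]
        exact ⟨hpos.le, le_rfl⟩
      have h2 : closure (Ico 0 r) ⊆ v ⁻¹' S :=
        closure_minimal (fun r' hr' => h r' hr') (hS.preimage hv)
      exact h2 this
  · rintro t ⟨ht, ht0, -⟩
    have := hcon t ht0 ht
    obtain ⟨u, hu, hus⟩ := mem_nhdsGT_iff_exists_Ioo_subset.1 this
    refine mem_nhdsGT_iff_exists_Ioo_subset.2 ⟨u, hu, fun r hr r' hr' => ?_⟩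
    rcases le_or_gt r' t with h | h
    · exact ht r' ⟨hr'.1, h⟩
    · exact hus ⟨h, hr'.2.trans_lt hr.2⟩

theorem not_bddAbove_of_deriv_ge {f f' : ℝ → ℝ} {c B : ℝ} (hc : 0 < c)
    (hf : ∀ t, 0 ≤ t → HasDerivAt f (f' t) t) (hf' : ∀ t, 0 ≤ t → c ≤ f' t)
    (hB : ∀ t, 0 ≤ t → f t ≤ B) : False := by
  have hmono : MonotoneOn (fun t => f t - c * t) (Ici 0) := by
    refine monotoneOn_of_hasDerivWithinAt_nonneg (f' := fun t => f' t - c) (convex_Ici 0) ?_ ?_ ?_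
    · exact fun t ht => ((hf t ht).sub ((hasDerivAt_id t).const_mul c)).continuousAt.continuousWithinAt
    · intro t ht
      rw [interior_Ici] at ht ⊢
      have := ((hf t ht.le).sub ((hasDerivAt_id t).const_mul c)).hasDerivWithinAt (s := Ioi 0)
      rw [mul_one] at this
      exact this
    · intro t ht
      rw [interior_Ici] at ht
      linarith [hf' t ht.le]
  have ht : (0 : ℝ) ≤ (|B - f 0| + 1) / c := by positivity
  have h := hmono (mem_Ici.2 le_rfl) ht ht
  have h2 := hB _ ht
  simp only [mul_zero, sub_zero] at h
  rw [mul_div_cancel₀ _ hc.ne'] at h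
  linarith [le_abs_self (B - f 0)]

/-! ### Topology of nested leaves around a center. -/

/-- `A` is the union of `{p}` and of pairwise disjoint compact connected sets `O q` around `p`. -/
structure IsNestedFoliation (p : ℝ × ℝ) (A : Set (ℝ × ℝ)) (O : ℝ × ℝ → Set (ℝ × ℝ)) : Prop where
  isOpen : IsOpen A
  mem : p ∈ A
  self_mem : ∀ q ∈ A, q ≠ p → q ∈ O q
  isCompact : ∀ q ∈ A, q ≠ p → IsCompact (O q)
  isPreconnected : ∀ q ∈ A, q ≠ p → IsPreconnected (O q)
  subset : ∀ q ∈ A, q ≠ p → O q ⊆ A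
  center_notMem : ∀ q ∈ A, q ≠ p → p ∉ O q
  eq_of_mem : ∀ q ∈ A, q ≠ p → ∀ w ∈ O q, O w = O q
  bounded_inside : ∀ q ∈ A, q ≠ p → Bornology.IsBounded (connectedComponentIn (O q)ᶜ p)
  inside_subset : ∀ q ∈ A, q ≠ p → connectedComponentIn (O q)ᶜ p ⊆ A

/-- The plane is connected and unbounded. This fact does the work of the Jordan curve theorem in the
nesting arguments below. -/
theorem not_isClosed_of_isOpen_bounded {U : Set (ℝ × ℝ)} (ho : IsOpen U) (hne : U.Nonempty)
    (hb : Bornology.IsBounded U) : ¬ IsClosed U := by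
  intro hc
  have h := (isClopen_iff.1 ⟨hc, ho⟩).resolve_left hne.ne_empty
  rw [h] at hb
  exact NormedSpace.unbounded_univ ℝ (ℝ × ℝ) hb

namespace IsNestedFoliation

variable {p : ℝ × ℝ} {A : Set (ℝ × ℝ)} {O : ℝ × ℝ → Set (ℝ × ℝ)} {q w : ℝ × ℝ}

/-- The component of the complement of the leaf through `q` that contains the centre. -/
local notation "C(" q ")" => connectedComponentIn (O q)ᶜ p

theorem isOpen_inside (h : IsNestedFoliation p A O) (hq : q ∈ A) (hqp : q ≠ p) : IsOpen C(q) :=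
  (h.isCompact q hq hqp).isClosed.isOpen_compl.connectedComponentIn

theorem center_mem_inside (h : IsNestedFoliation p A O) (hq : q ∈ A) (hqp : q ≠ p) : p ∈ C(q) :=
  mem_connectedComponentIn (h.center_notMem q hq hqp)

theorem closure_inside_subset (h : IsNestedFoliation p A O) (hq : q ∈ A) (hqp : q ≠ p) :
    closure C(q) ⊆ C(q) ∪ O q := by
  intro z hz
  by_contra! hcon
  rw [mem_union, not_or] at hcon
  have ho : IsOpen (connectedComponentIn (O q)ᶜ z) :=
    (h.isCompact q hq hqp).isClosed.isOpen_compl.connectedComponentIn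
  obtain ⟨x, hx, hx'⟩ := mem_closure_iff.1 hz _ ho (mem_connectedComponentIn hcon.2)
  have e1 := connectedComponentIn_eq hx
  have e2 := connectedComponentIn_eq hx'
  exact hcon.1 (e2.trans e1.symm ▸ mem_connectedComponentIn hcon.2)

theorem isCompact_hull (h : IsNestedFoliation p A O) (hq : q ∈ A) (hqp : q ≠ p) :
    IsCompact (C(q) ∪ O q) := by
  have hc : IsClosed (C(q) ∪ O q) := by
    refine isClosed_of_closure_subset ?_
    rw [closure_union, (h.isCompact q hq hqp).isClosed.closure_eq]
    exact union_subset (h.closure_inside_subset hq hqp) subset_union_right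
  exact Metric.isCompact_of_isClosed_isBounded hc
    ((h.bounded_inside q hq hqp).union (h.isCompact q hq hqp).isBounded)

theorem hull_subset (h : IsNestedFoliation p A O) (hq : q ∈ A) (hqp : q ≠ p) :
    C(q) ∪ O q ⊆ A := union_subset (h.inside_subset q hq hqp) (h.subset q hq hqp)

/-- The inside is not closed, so it has a limit point on the leaf, and this point joins the two
connected pieces. -/
theorem isPreconnected_hull (h : IsNestedFoliation p A O) (hq : q ∈ A) (hqp : q ≠ p) :
    IsPreconnected (C(q) ∪ O q) := by
  have hn : ¬ closure C(q) ⊆ C(q) := fun hs =>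
    not_isClosed_of_isOpen_bounded (h.isOpen_inside hq hqp) ⟨p, h.center_mem_inside hq hqp⟩
      (h.bounded_inside q hq hqp) (isClosed_of_closure_subset hs)
  obtain ⟨z, hz, hzn⟩ := not_subset.1 hn
  have hzO : z ∈ O q := (h.closure_inside_subset hq hqp hz).resolve_left hzn
  have h1 : IsPreconnected (C(q) ∪ {z}) :=
    isPreconnected_connectedComponentIn.subset_closure subset_union_left
      (union_subset subset_closure (singleton_subset_iff.2 hz))
  have h2 := h1.union z (Or.inr rfl) hzO (h.isPreconnected q hq hqp)
  convert h2 using 1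
  ext x
  simp only [mem_union, mem_singleton_iff]
  constructor
  · rintro (hx | hx) <;> simp [hx]
  · rintro ((hx | rfl) | hx)
    · exact Or.inl hx
    · exact Or.inr hzO
    · exact Or.inr hx

theorem leaf_eq_of_inter (h : IsNestedFoliation p A O) (hq : q ∈ A) (hqp : q ≠ p) (hw : w ∈ A)
    (hwp : w ≠ p) {z : ℝ × ℝ} (hzq : z ∈ O q) (hzw : z ∈ O w) : O w = O q :=
  (h.eq_of_mem w hw hwp z hzw).symm.trans (h.eq_of_mem q hq hqp z hzq)

theorem leaf_subset_inside (h : IsNestedFoliation p A O) (hq : q ∈ A) (hqp : q ≠ p) (hw : w ∈ A)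
    (hwp : w ≠ p) {z : ℝ × ℝ} (hzw : z ∈ O w) (hzq : z ∈ C(q)) : O w ⊆ C(q) := by
  have hsub : O w ⊆ (O q)ᶜ := by
    intro x hx hxq
    have := h.leaf_eq_of_inter hq hqp hw hwp hxq hx
    exact connectedComponentIn_subset _ _ hzq (this ▸ hzw)
  rw [connectedComponentIn_eq hzq]
  exact (h.isPreconnected w hw hwp).subset_connectedComponentIn hzw hsub

theorem leaf_subset_inside_of_mem (h : IsNestedFoliation p A O) (hq : q ∈ A) (hqp : q ≠ p)
    (hw : w ∈ C(q)) (hwp : w ≠ p) : O w ⊆ C(q) :=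
  have hwA := h.inside_subset q hq hqp hw
  h.leaf_subset_inside hq hqp hwA hwp (h.self_mem w hwA hwp) hw

theorem leaf_subset_hull (h : IsNestedFoliation p A O) (hq : q ∈ A) (hqp : q ≠ p)
    (hw : w ∈ C(q) ∪ O q) (hwp : w ≠ p) : O w ⊆ C(q) ∪ O q := by
  rcases hw with hw | hw
  · exact (h.leaf_subset_inside_of_mem hq hqp hw hwp).trans subset_union_left
  · rw [h.eq_of_mem q hq hqp w hw]
    exact subset_union_right

/-- Otherwise each inside avoids the other leaf, so the two insides coincide. Their boundary then
lies on two disjoint leaves, hence is empty, and the inside is clopen and bounded. -/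
theorem inside_total (h : IsNestedFoliation p A O) (hq : q ∈ A) (hqp : q ≠ p) (hw : w ∈ A)
    (hwp : w ≠ p) (hne : O w ≠ O q) : O w ⊆ C(q) ∨ O q ⊆ C(w) := by
  by_contra! hcon
  have h1 : C(q) ⊆ C(w) := isPreconnected_connectedComponentIn.subset_connectedComponentIn
    (h.center_mem_inside hq hqp)
    fun x hx hxw => hcon.1 (h.leaf_subset_inside hq hqp hw hwp hxw hx)
  have h2 : C(w) ⊆ C(q) := isPreconnected_connectedComponentIn.subset_connectedComponentIn
    (h.center_mem_inside hw hwp)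
    fun x hx hxq => hcon.2 (h.leaf_subset_inside hw hwp hq hqp hxq hx)
  have he := h1.antisymm h2
  refine not_isClosed_of_isOpen_bounded (h.isOpen_inside hq hqp) ⟨p, h.center_mem_inside hq hqp⟩
    (h.bounded_inside q hq hqp) (isClosed_of_closure_subset fun x hx => ?_)
  rcases h.closure_inside_subset hq hqp hx with hx1 | hx1
  · exact hx1
  rcases h.closure_inside_subset hw hwp (he ▸ hx) with hx2 | hx2
  · exact he ▸ hx2
  · exact absurd (h.leaf_eq_of_inter hq hqp hw hwp hx1 hx2) hne

/-- If each leaf were inside the other, the union of the two insides would contain its own boundary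
and be clopen and bounded. -/
theorem not_leaf_subset_inside (h : IsNestedFoliation p A O) (hq : q ∈ A) (hqp : q ≠ p)
    (hw : w ∈ A) (hwp : w ≠ p) (hwq : O w ⊆ C(q)) : ¬ O q ⊆ C(w) := by
  intro hqw
  refine not_isClosed_of_isOpen_bounded ((h.isOpen_inside hq hqp).union (h.isOpen_inside hw hwp))
    ⟨p, Or.inl (h.center_mem_inside hq hqp)⟩
    ((h.bounded_inside q hq hqp).union (h.bounded_inside w hw hwp))
    (isClosed_of_closure_subset ?_)
  rw [closure_union]
  refine union_subset ((h.closure_inside_subset hq hqp).trans (union_subset subset_union_left ?_))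
    ((h.closure_inside_subset hw hwp).trans (union_subset subset_union_right ?_))
  · exact hqw.trans subset_union_right
  · exact hwq.trans subset_union_left

theorem hull_subset_inside (h : IsNestedFoliation p A O) (hq : q ∈ A) (hqp : q ≠ p)
    (hw : w ∈ A) (hwp : w ≠ p) (hwq : O w ⊆ C(q)) : C(w) ∪ O w ⊆ C(q) := by
  refine union_subset (isPreconnected_connectedComponentIn.subset_connectedComponentIn
    (h.center_mem_inside hw hwp) fun x hx hxq => ?_) hwq
  exact h.not_leaf_subset_inside hq hqp hw hwp hwq (h.leaf_subset_inside hw hwp hq hqp hxq hx)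

theorem exists_inside_ne (h : IsNestedFoliation p A O) (hq : q ∈ A) (hqp : q ≠ p) :
    ∃ u ∈ C(q), u ≠ p := by
  by_contra! hcon
  have he : C(q) = {p} := Subset.antisymm hcon (singleton_subset_iff.2 (h.center_mem_inside hq hqp))
  exact not_isClosed_of_isOpen_bounded (h.isOpen_inside hq hqp) ⟨p, h.center_mem_inside hq hqp⟩
      (h.bounded_inside q hq hqp) (he ▸ isClosed_singleton)

theorem exists_between (h : IsNestedFoliation p A O) (hq : q ∈ A) (hqp : q ≠ p)
    (hw : w ∈ A) (hwp : w ≠ p) (hwq : O w ⊆ C(q)) :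
    ∃ u ∈ C(q), u ≠ p ∧ O w ⊆ C(u) := by
  have hn : ¬ C(q) ⊆ C(w) ∪ O w := fun hs => by
    have he := hs.antisymm (h.hull_subset_inside hq hqp hw hwp hwq)
    exact not_isClosed_of_isOpen_bounded (h.isOpen_inside hq hqp) ⟨p, h.center_mem_inside hq hqp⟩
      (h.bounded_inside q hq hqp) (he ▸ (h.isCompact_hull hw hwp).isClosed)
  obtain ⟨u, hu, hun⟩ := not_subset.1 hn
  have hup : u ≠ p := fun e => hun (Or.inl (e ▸ h.center_mem_inside hw hwp))
  have huA := h.inside_subset q hq hqp hu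
  refine ⟨u, hu, hup, (h.inside_total huA hup hw hwp fun e => ?_).resolve_right fun hs => ?_⟩
  · exact hun (Or.inr (e ▸ h.self_mem u huA hup))
  · exact hun (Or.inl (hs (h.self_mem u huA hup)))

/-- Distinct leaves are separated by a third one. -/
theorem exists_separating (h : IsNestedFoliation p A O) (hq : q ∈ A) (hw : w ∈ A)
    (hne : q ≠ w) (hwq : q ≠ p → w ∉ O q) :
    ∃ u ∈ A, u ≠ p ∧ ((q ∈ C(u) ∧ w ∉ C(u) ∪ O u) ∨ (w ∈ C(u) ∧ q ∉ C(u) ∪ O u)) := by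
  by_cases hqp : q = p
  · subst hqp
    obtain ⟨u, hu, huq⟩ := h.exists_inside_ne hw hne.symm
    have huA := h.inside_subset w hw hne.symm hu
    refine ⟨u, huA, huq, Or.inl ⟨h.center_mem_inside huA huq, fun hwu => ?_⟩⟩
    have := h.hull_subset_inside hw hne.symm huA huq
      (h.leaf_subset_inside_of_mem hw hne.symm hu huq) hwu
    exact connectedComponentIn_subset _ _ this (h.self_mem w hw hne.symm)
  by_cases hwp : w = p
  · subst hwp
    obtain ⟨u, hu, huq⟩ := h.exists_inside_ne hq hqp
    have huA := h.inside_subset q hq hqp hu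
    refine ⟨u, huA, huq, Or.inr ⟨h.center_mem_inside huA huq, fun hwu => ?_⟩⟩
    have := h.hull_subset_inside hq hqp huA huq
      (h.leaf_subset_inside_of_mem hq hqp hu huq) hwu
    exact connectedComponentIn_subset _ _ this (h.self_mem q hq hqp)
  have hO : O w ≠ O q := fun e => hwq hqp (e ▸ h.self_mem w hw hwp)
  rcases h.inside_total hq hqp hw hwp hO with hs | hs
  · obtain ⟨u, hu, hup, hwu⟩ := h.exists_between hq hqp hw hwp hs
    have huA := h.inside_subset q hq hqp hu
    refine ⟨u, huA, hup, Or.inr ⟨hwu (h.self_mem w hw hwp), fun hqu => ?_⟩⟩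
    have := h.hull_subset_inside hq hqp huA hup
      (h.leaf_subset_inside_of_mem hq hqp hu hup) hqu
    exact connectedComponentIn_subset _ _ this (h.self_mem q hq hqp)
  · obtain ⟨u, hu, hup, hwu⟩ := h.exists_between hw hwp hq hqp hs
    have huA := h.inside_subset w hw hwp hu
    refine ⟨u, huA, hup, Or.inl ⟨hwu (h.self_mem q hq hqp), fun hqu => ?_⟩⟩
    have := h.hull_subset_inside hw hwp huA hup
      (h.leaf_subset_inside_of_mem hw hwp hu hup) hqu
    exact connectedComponentIn_subset _ _ this (h.self_mem w hw hwp)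

/-- The relation of lying on a common leaf is closed. -/
theorem exists_nhds_disjoint (h : IsNestedFoliation p A O) (hq : q ∈ A) (hw : w ∈ A)
    (hne : q ≠ w) (hwq : q ≠ p → w ∉ O q) :
    ∃ U ∈ 𝓝 q, ∃ V ∈ 𝓝 w, ∀ z ∈ U, z ∈ A → z ≠ p → ∀ x ∈ V, x ∉ O z := by
  -- The inside of the separating leaf and the complement of its closed disc are the two
  -- neighbourhoods: no leaf meets both.
  obtain ⟨u, huA, hup, hu | hu⟩ := h.exists_separating hq hw hne hwq
  · refine ⟨C(u), (h.isOpen_inside huA hup).mem_nhds hu.1, (C(u) ∪ O u)ᶜ,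
      (h.isCompact_hull huA hup).isClosed.isOpen_compl.mem_nhds hu.2, ?_⟩
    intro z hz hzA hzp x hx hxz
    exact hx (Or.inl (h.leaf_subset_inside_of_mem huA hup hz hzp hxz))
  · refine ⟨(C(u) ∪ O u)ᶜ, (h.isCompact_hull huA hup).isClosed.isOpen_compl.mem_nhds hu.2,
      C(u), (h.isOpen_inside huA hup).mem_nhds hu.1, ?_⟩
    intro z hz hzA hzp x hx hxz
    exact hz (Or.inl (h.leaf_subset_inside huA hup hzA hzp hxz hx (h.self_mem z hzA hzp)))

end IsNestedFoliation

/-! ### Periodic orbits around a center and their least height. -/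

theorem isSolOn_of_hasDerivAt {Z : ℝ × ℝ → ℝ × ℝ} {v : ℝ → ℝ × ℝ}
    (h : ∀ t, HasDerivAt v (Z (v t)) t) (s : Set ℝ) : IsSolOn Z v s :=
  fun t _ => (h t).hasDerivWithinAt

theorem solution_unique {Z : ℝ × ℝ → ℝ × ℝ} (hZ : LocallyLipschitz Z) {v w : ℝ → ℝ × ℝ}
    (hv : ∀ t, HasDerivAt v (Z (v t)) t) (hw : ∀ t, HasDerivAt w (Z (w t)) t) (h : v 0 = w 0) :
    v = w := by
  funext t
  exact IsSolOn.eqOn_of_eq hZ (isSolOn_of_hasDerivAt hv (Icc (-|t|) |t|))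
    (isSolOn_of_hasDerivAt hw _) ⟨by simp, by simp⟩ h ⟨neg_abs_le t, le_abs_self t⟩

theorem IsPeriodicSol.continuous {X : ℝ × ℝ → ℝ × ℝ} {γ : ℝ → ℝ × ℝ} (h : IsPeriodicSol X γ) :
    Continuous γ := continuous_iff_continuousAt.2 fun t => (h.1 t).continuousAt

theorem IsPeriodicSol.shift {X : ℝ × ℝ → ℝ × ℝ} {γ : ℝ → ℝ × ℝ} (h : IsPeriodicSol X γ) (c : ℝ) :
    IsPeriodicSol X (fun t => γ (t + c)) ∧ range (fun t => γ (t + c)) = range γ := by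
  refine ⟨⟨fun t => (h.1 (t + c)).comp_add_const t c, ?_, ?_⟩, ?_⟩
  · obtain ⟨T, hT, hp⟩ := h.2.1
    refine ⟨T, hT, fun t => ?_⟩
    have := hp (t + c)
    rwa [show t + c + T = t + T + c by ring] at this
  · by_contra! hcon
    obtain ⟨t, ht⟩ := h.2.2
    apply ht
    have h1 := hcon (t - c)
    have h2 := hcon (-c)
    simp only [sub_add_cancel, neg_add_cancel, zero_add] at h1 h2
    rw [h1, h2]
  · exact (Equiv.addRight c).surjective.range_comp γ

theorem IsPeriodicSol.range_eq {X : ℝ × ℝ → ℝ × ℝ} (hX : LocallyLipschitz X) {γ η : ℝ → ℝ × ℝ}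
    (hγ : IsPeriodicSol X γ) (hη : IsPeriodicSol X η) {w : ℝ × ℝ} (h1 : w ∈ range γ)
    (h2 : w ∈ range η) : range γ = range η := by
  obtain ⟨s, rfl⟩ := h1
  obtain ⟨t, ht⟩ := h2
  rw [← (hγ.shift s).2, ← (hη.shift t).2]
  congr 1
  exact solution_unique hX (hγ.shift s).1.1 (hη.shift t).1.1 (by simp [ht])

theorem IsPeriodicSol.isCompact_range {X : ℝ × ℝ → ℝ × ℝ} {γ : ℝ → ℝ × ℝ}
    (h : IsPeriodicSol X γ) : IsCompact (range γ) := by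
  obtain ⟨T, hT, hp⟩ := h.2.1
  exact hp.compact_of_continuous hT.ne' h.continuous

theorem IsPeriodicSol.exists_nonneg {X : ℝ × ℝ → ℝ × ℝ} {γ : ℝ → ℝ × ℝ}
    (h : IsPeriodicSol X γ) {w : ℝ × ℝ} (hw : w ∈ range γ) : ∃ t, 0 ≤ t ∧ γ t = w := by
  obtain ⟨T, hT, hp⟩ := h.2.1
  rw [← hp.image_Ioc hT 0] at hw
  obtain ⟨t, ht, rfl⟩ := hw
  exact ⟨t, ht.1.le, rfl⟩

/-- The periodic orbit of `X` through `q`; the centre `p` is a leaf by itself. -/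
def leaf (X : ℝ × ℝ → ℝ × ℝ) (p q : ℝ × ℝ) : Set (ℝ × ℝ) :=
  {w | (q = p ∧ w = p) ∨ (q ≠ p ∧ ∃ γ, IsPeriodicSol X γ ∧ q ∈ range γ ∧ w ∈ range γ)}

theorem leaf_center (X : ℝ × ℝ → ℝ × ℝ) (p : ℝ × ℝ) : leaf X p p = {p} := by
  ext w
  simp [leaf]

theorem leaf_eq_range {X : ℝ × ℝ → ℝ × ℝ} (hX : LocallyLipschitz X) {p q : ℝ × ℝ} (hqp : q ≠ p)
    {γ : ℝ → ℝ × ℝ} (hγ : IsPeriodicSol X γ) (hq : q ∈ range γ) : leaf X p q = range γ := by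
  ext w
  constructor
  · rintro (⟨h, -⟩ | ⟨-, η, hη, hqη, hw⟩)
    · exact absurd h hqp
    · rwa [hγ.range_eq hX hη hq hqη]
  · exact fun hw => Or.inr ⟨hqp, γ, hγ, hq, hw⟩

namespace IsCenter

variable {X : ℝ × ℝ → ℝ × ℝ} {p q w : ℝ × ℝ} {A : Set (ℝ × ℝ)}

theorem exists_periodic (h : IsCenter X p A) (hX : LocallyLipschitz X) (hq : q ∈ A) (hqp : q ≠ p) :
    ∃ γ, IsPeriodicSol X γ ∧ γ 0 = q ∧ leaf X p q = range γ ∧ range γ ⊆ A ∧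
      p ∈ curveInterior (range γ) ∧ curveInterior (range γ) ⊆ A := by
  obtain ⟨γ, hγ, hqγ, hA, hp, hi⟩ := h.periodic q hq hqp
  obtain ⟨t, rfl⟩ := hqγ
  refine ⟨fun s => γ (s + t), (hγ.shift t).1, by simp, ?_⟩
  rw [(hγ.shift t).2]
  exact ⟨leaf_eq_range hX hqp hγ ⟨t, rfl⟩, hA, hp, hi⟩

theorem isNestedFoliation (h : IsCenter X p A) (hX : LocallyLipschitz X) :
    IsNestedFoliation p A (leaf X p) := by
  refine ⟨h.isOpen, h.mem, ?_, ?_, ?_, ?_, ?_, ?_, ?_, ?_⟩ <;> intro q hq hqp <;>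
    obtain ⟨γ, hγ, h0, hl, hA, hp, hi⟩ := h.exists_periodic hX hq hqp <;> rw [hl]
  · exact ⟨0, h0⟩
  · exact hγ.isCompact_range
  · exact isPreconnected_range hγ.continuous
  · exact hA
  · exact hp.1
  · intro w hw
    refine leaf_eq_range hX ?_ hγ hw
    rintro rfl
    exact hp.1 hw
  · exact hp.2
  · intro z hz
    refine hi ⟨connectedComponentIn_subset _ _ hz, ?_⟩
    rw [← connectedComponentIn_eq hz]
    exact hp.2

theorem isCompact_leaf (h : IsCenter X p A) (hX : LocallyLipschitz X) (hq : q ∈ A) :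
    IsCompact (leaf X p q) := by
  by_cases hqp : q = p
  · rw [hqp, leaf_center]
    exact isCompact_singleton
  · exact (h.isNestedFoliation hX).isCompact q hq hqp

theorem self_mem_leaf (h : IsCenter X p A) (hX : LocallyLipschitz X) (hq : q ∈ A) :
    q ∈ leaf X p q := by
  by_cases hqp : q = p
  · rw [hqp, leaf_center]
    rfl
  · exact (h.isNestedFoliation hX).self_mem q hq hqp

theorem leaf_eq_of_mem (h : IsCenter X p A) (hX : LocallyLipschitz X) (hq : q ∈ A)
    (hw : w ∈ leaf X p q) : leaf X p w = leaf X p q := by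
  by_cases hqp : q = p
  · rw [hqp, leaf_center] at hw
    rw [hqp, hw]
  · exact (h.isNestedFoliation hX).eq_of_mem q hq hqp w hw

end IsCenter

/-- The closed disc bounded by the leaf through `q`. -/
def leafHull (X : ℝ × ℝ → ℝ × ℝ) (p q : ℝ × ℝ) : Set (ℝ × ℝ) :=
  connectedComponentIn (leaf X p q)ᶜ p ∪ leaf X p q

/-- The least height `y` on the leaf through `q`. -/
noncomputable def height (X : ℝ × ℝ → ℝ × ℝ) (p q : ℝ × ℝ) : ℝ := sInf (Prod.snd '' leaf X p q)

namespace IsCenter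

variable {X : ℝ × ℝ → ℝ × ℝ} {p q w : ℝ × ℝ} {A : Set (ℝ × ℝ)}

theorem exists_height_eq (h : IsCenter X p A) (hX : LocallyLipschitz X) (hq : q ∈ A) :
    ∃ w ∈ leaf X p q, w.2 = height X p q := by
  have hc : IsCompact (Prod.snd '' leaf X p q) := (h.isCompact_leaf hX hq).image continuous_snd
  exact hc.sInf_mem ⟨_, mem_image_of_mem _ (h.self_mem_leaf hX hq)⟩

theorem height_le (h : IsCenter X p A) (hX : LocallyLipschitz X) (hq : q ∈ A)
    (hw : w ∈ leaf X p q) : height X p q ≤ w.2 := by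
  have hc : IsCompact (Prod.snd '' leaf X p q) := (h.isCompact_leaf hX hq).image continuous_snd
  exact csInf_le hc.bddBelow ⟨w, hw, rfl⟩

theorem height_le_self (h : IsCenter X p A) (hX : LocallyLipschitz X) (hq : q ∈ A) :
    height X p q ≤ q.2 := h.height_le hX hq (h.self_mem_leaf hX hq)

theorem height_eq_of_mem (h : IsCenter X p A) (hX : LocallyLipschitz X) (hq : q ∈ A)
    (hw : w ∈ leaf X p q) : height X p w = height X p q := by
  rw [height, height, h.leaf_eq_of_mem hX hq hw]

theorem height_center : height X p p = p.2 := by simp [height, leaf_center]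

/-- Upper semicontinuity: a nearby orbit follows the orbit of `q` up to its lowest point, so it gets
nearly as low. -/
theorem eventually_height_lt (h : IsCenter X p A) (hX : LocallyLipschitz X) (hq : q ∈ A) {a : ℝ}
    (ha : height X p q < a) : ∀ᶠ z in 𝓝 q, height X p z < a := by
  have hA := h.isOpen.mem_nhds hq
  by_cases hqp : q = p
  · rw [hqp, height_center, ← hqp] at ha
    filter_upwards [hA, (continuous_snd.tendsto q).eventually_lt_const ha] with z hzA hz
    exact (h.height_le_self hX hzA).trans_lt hz
  obtain ⟨w, hw, hwq⟩ := h.exists_height_eq hX hq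
  obtain ⟨γ, hγ, h0, hl, -⟩ := h.exists_periodic hX hq hqp
  rw [hl] at hw
  obtain ⟨T, hT, rfl⟩ := hγ.exists_nonneg hw
  have hn := IsSolOn.exists_nearby hX (isSolOn_of_hasDerivAt hγ.1 (Icc 0 T))
    (sub_pos.2 ha)
  rw [h0] at hn
  filter_upwards [hA, isOpen_ne.mem_nhds hqp, hn] with z hzA hzp hz
  obtain ⟨v, hv0, hv, hvT⟩ := hz
  obtain ⟨η, hη, hη0, hlη, -⟩ := h.exists_periodic hX hzA hzp
  have he := IsSolOn.eqOn_right hX hv (isSolOn_of_hasDerivAt hη.1 _) (by rw [hv0, hη0])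
    (right_mem_Icc.2 hT)
  have h1 := h.height_le hX hzA (w := η T) (by rw [hlη]; exact ⟨T, rfl⟩)
  have h2 := hvT T (right_mem_Icc.2 hT)
  rw [he, Prod.dist_eq, max_lt_iff, Real.dist_eq, Real.dist_eq] at h2
  have h3 := (abs_lt.1 h2.2).2
  linarith

theorem leaf_subset_hull (h : IsCenter X p A) (hX : LocallyLipschitz X) (hq : q ∈ A) (hqp : q ≠ p)
    (hw : w ∈ leafHull X p q) : leaf X p w ⊆ leafHull X p q := by
  by_cases hwp : w = p
  · rw [hwp] at hw ⊢
    rw [leaf_center]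
    exact singleton_subset_iff.2 hw
  · exact (h.isNestedFoliation hX).leaf_subset_hull hq hqp hw hwp

theorem hull_subset (h : IsCenter X p A) (hX : LocallyLipschitz X) (hq : q ∈ A) (hqp : q ≠ p) :
    leafHull X p q ⊆ A := (h.isNestedFoliation hX).hull_subset hq hqp

theorem isCompact_hull (h : IsCenter X p A) (hX : LocallyLipschitz X) (hq : q ∈ A) (hqp : q ≠ p) :
    IsCompact (leafHull X p q) := (h.isNestedFoliation hX).isCompact_hull hq hqp

theorem center_mem_hull (h : IsCenter X p A) (hX : LocallyLipschitz X) (hq : q ∈ A) (hqp : q ≠ p) :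
    p ∈ leafHull X p q := Or.inl ((h.isNestedFoliation hX).center_mem_inside hq hqp)

/-- Lower semicontinuity. Continuous dependence would need a bound on the periods; instead, the part
of the disc below level `a` is compact and misses the leaf of `q`, and lying on a common leaf is a
closed relation, so nearby leaves miss it too. -/
theorem eventually_lt_height (h : IsCenter X p A) (hX : LocallyLipschitz X) {q₁ : ℝ × ℝ}
    (hq₁ : q₁ ∈ A) (hqp₁ : q₁ ≠ p) (hq : q ∈ leafHull X p q₁) {a : ℝ}
    (ha : a < height X p q) : ∀ᶠ z in 𝓝[leafHull X p q₁] q, a < height X p z := by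
  have hqA := h.hull_subset hX hq₁ hqp₁ hq
  have hF := h.isNestedFoliation hX
  have hc : IsCompact (leafHull X p q₁ ∩ {w | w.2 ≤ a}) :=
    (h.isCompact_hull hX hq₁ hqp₁).inter_right (isClosed_le continuous_snd continuous_const)
  have hev : ∀ᶠ z in 𝓝 q, ∀ w ∈ leafHull X p q₁ ∩ {w | w.2 ≤ a}, z ∈ A → w ∉ leaf X p z := by
    refine hc.eventually_forall_of_forall_eventually fun w hw => ?_
    have hwA := h.hull_subset hX hq₁ hqp₁ hw.1
    have hwl : w ∉ leaf X p q := fun hm => by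
      have h1 := h.height_le hX hqA hm
      have h2 : w.2 ≤ a := hw.2
      linarith
    have hne : q ≠ w := fun e => hwl (e ▸ h.self_mem_leaf hX hqA)
    obtain ⟨U, hU, V, hV, hUV⟩ := hF.exists_nhds_disjoint hqA hwA hne fun _ => hwl
    rw [nhds_prod_eq]
    by_cases hqp : q = p
    · filter_upwards [prod_mem_prod hU (inter_mem hV (isOpen_ne.mem_nhds (hqp ▸ hne.symm)))]
        with ⟨z, x⟩ hzx hzA
      by_cases hzp : z = p
      · rw [hzp, leaf_center]
        exact hzx.2.2
      · exact hUV z hzx.1 hzA hzp x hzx.2.1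
    · filter_upwards [prod_mem_prod (inter_mem hU (isOpen_ne.mem_nhds hqp)) hV]
        with ⟨z, x⟩ hzx hzA
      exact hUV z hzx.1.1 hzA hzx.1.2 x hzx.2
  filter_upwards [mem_nhdsWithin_of_mem_nhds hev, self_mem_nhdsWithin] with z hz hzK
  have hzA := h.hull_subset hX hq₁ hqp₁ hzK
  obtain ⟨w, hw, hwz⟩ := h.exists_height_eq hX hzA
  by_contra! hcon
  exact hz w ⟨h.leaf_subset_hull hX hq₁ hqp₁ hzK hw, hwz.trans_le hcon⟩ hzA hw

theorem continuousOn_height (h : IsCenter X p A) (hX : LocallyLipschitz X) (hq : q ∈ A)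
    (hqp : q ≠ p) : ContinuousOn (height X p) (leafHull X p q) := by
  intro z hz
  refine tendsto_order.2 ⟨fun a ha => h.eventually_lt_height hX hq hqp hz ha, fun a ha => ?_⟩
  exact mem_nhdsWithin_of_mem_nhds (h.eventually_height_lt hX (h.hull_subset hX hq hqp hz) ha)

theorem snd_field_eq_zero (h : IsCenter X p A) (hX : LocallyLipschitz X) (hq : q ∈ A)
    (hw : w ∈ leaf X p q) (hwq : w.2 = height X p q) : (X w).2 = 0 := by
  by_cases hqp : q = p
  · rw [hqp, leaf_center] at hw
    rw [hw, h.equilibrium]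
    rfl
  obtain ⟨γ, hγ, h0, hl, -⟩ := h.exists_periodic hX hq hqp
  have hw' := hw
  rw [hl] at hw'
  obtain ⟨t, rfl⟩ := hw'
  have hd : HasDerivAt (fun t => (γ t).2) (X (γ t)).2 t := (hγ.1 t).snd
  refine IsLocalMin.hasDerivAt_eq_zero (Eventually.of_forall fun s => ?_) hd
  rw [hwq]
  exact h.height_le hX hq (by rw [hl]; exact ⟨s, rfl⟩)

/-- If the level `m` contains a single tangency `(x, m)` of `X` with the horizontal, then the leaf
through this tangency is the only one of least height `m`. -/
theorem leaf_of_height_eq (h : IsCenter X p A) (hX : LocallyLipschitz X) (hq : q ∈ A)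
    (hqp : q ≠ p) {x m : ℝ}
    (huniq : ∀ w ∈ leafHull X p q, w.2 = m → (X w).2 = 0 → w = (x, m)) (hw : w ∈ leafHull X p q)
    (hwm : height X p w = m) : leaf X p w = leaf X p (x, m) := by
  have hwA := h.hull_subset hX hq hqp hw
  obtain ⟨z, hz, hzw⟩ := h.exists_height_eq hX hwA
  have := huniq z (h.leaf_subset_hull hX hq hqp hw hz) (hzw.trans hwm)
    (h.snd_field_eq_zero hX hwA hz hzw)
  rw [← this, h.leaf_eq_of_mem hX hwA hz]

/-- The height takes the value `m` on the connected disc by the intermediate value theorem, since it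
equals `p.2` at the center. The lowest point of such a leaf is a tangency at level `m`, so it is
`(x, m)`. -/
theorem tangency_mem_hull (h : IsCenter X p A) (hX : LocallyLipschitz X) (hq : q ∈ A)
    (hqp : q ≠ p) {x m : ℝ}
    (huniq : ∀ w ∈ leafHull X p q, w.2 = m → (X w).2 = 0 → w = (x, m))
    (hm : height X p q ≤ m) (hmp : m ≤ p.2) :
    (x, m) ∈ leafHull X p q ∧ height X p (x, m) = m := by
  have hpre : IsPreconnected (leafHull X p q) := (h.isNestedFoliation hX).isPreconnected_hull hq hqp
  obtain ⟨w, hw, hwm⟩ := hpre.intermediate_value (Or.inr (h.self_mem_leaf hX hq))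
    (h.center_mem_hull hX hq hqp) (h.continuousOn_height hX hq hqp)
    ⟨hm, by rwa [height_center]⟩
  have hwA := h.hull_subset hX hq hqp hw
  obtain ⟨z, hz, hzw⟩ := h.exists_height_eq hX hwA
  have hzK := h.leaf_subset_hull hX hq hqp hw hz
  have := huniq z hzK (hzw.trans hwm) (h.snd_field_eq_zero hX hwA hz hzw)
  rw [← this]
  exact ⟨hzK, (h.height_eq_of_mem hX hwA hz).trans hwm⟩

end IsCenter

/-! ### The regularized field. -/

theorem LocallyLipschitz.smul_prod {f : ℝ × ℝ → ℝ} {g : ℝ × ℝ → ℝ × ℝ} (hf : LocallyLipschitz f)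
    (hg : LocallyLipschitz g) : LocallyLipschitz (fun q => f q • g q) := by
  intro x
  obtain ⟨K₁, t₁, ht₁, h₁⟩ := hf x
  obtain ⟨K₂, t₂, ht₂, h₂⟩ := hg x
  have hfb : ∀ᶠ q in 𝓝 x, ‖f q‖ < ‖f x‖ + 1 :=
    (hf.continuous.norm.tendsto x).eventually_lt_const (lt_add_one _)
  have hgb : ∀ᶠ q in 𝓝 x, ‖g q‖ < ‖g x‖ + 1 :=
    (hg.continuous.norm.tendsto x).eventually_lt_const (lt_add_one _)
  refine ⟨(‖f x‖₊ + 1) * K₂ + K₁ * (‖g x‖₊ + 1), _,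
    inter_mem (inter_mem ht₁ ht₂) (inter_mem hfb hgb), ?_⟩
  refine LipschitzOnWith.of_dist_le_mul fun a ha b hb => ?_
  have e1 := h₁.dist_le_mul a ha.1.1 b hb.1.1
  have e2 := h₂.dist_le_mul a ha.1.2 b hb.1.2
  have e3 : ‖f a‖ < ‖f x‖ + 1 := ha.2.1
  have e4 : ‖g b‖ < ‖g x‖ + 1 := hb.2.2
  rw [dist_eq_norm] at e1 e2 ⊢
  have e5 : f a • g a - f b • g b = f a • (g a - g b) + (f a - f b) • g b := by
    rw [smul_sub, sub_smul]; abel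
  rw [e5]
  refine (norm_add_le _ _).trans ?_
  rw [norm_smul, norm_smul]
  push_cast
  have h1 : ‖f a‖ * ‖g a - g b‖ ≤ (‖f x‖ + 1) * (K₂ * dist a b) :=
    mul_le_mul e3.le e2 (norm_nonneg _) (by positivity)
  have h2 : ‖f a - f b‖ * ‖g b‖ ≤ (K₁ * dist a b) * (‖g x‖ + 1) :=
    mul_le_mul e1 e4.le (norm_nonneg _) (by positivity)
  linarith

namespace IsTransition

variable {φ : ℝ → ℝ}

theorem mem_Icc (h : IsTransition φ) (v : ℝ) : φ v ∈ Icc (-1 : ℝ) 1 := by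
  rcases le_total v (-1) with h1 | h1
  · rw [h.left v h1]; norm_num
  rcases le_total 1 v with h2 | h2
  · rw [h.right v h2]; norm_num
  have hm := h.strictMono.monotoneOn
  refine ⟨?_, ?_⟩
  · rw [← h.left (-1) le_rfl]
    exact hm (by norm_num) ⟨h1, h2⟩ h1
  · rw [← h.right 1 le_rfl]
    exact hm ⟨h1, h2⟩ (by norm_num) h2

theorem lt_one (h : IsTransition φ) {v : ℝ} (hv : v < 1) : φ v < 1 := by
  rcases le_total v (-1) with h1 | h1
  · rw [h.left v h1]; norm_num
  · have := h.strictMono ⟨h1, hv.le⟩ (right_mem_Icc.2 (by norm_num)) hv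
    rwa [h.right 1 le_rfl] at this

end IsTransition

section Regularized

variable {Xp Xm : ℝ × ℝ → ℝ × ℝ} {φ : ℝ → ℝ} {ε : ℝ} {q : ℝ × ℝ}

theorem locallyLipschitz_regularized (hp : LocallyLipschitz Xp) (hm : LocallyLipschitz Xm)
    (hφ : IsTransition φ) (ε : ℝ) : LocallyLipschitz (regularized Xp Xm φ ε) := by
  obtain ⟨K, hK⟩ := hφ.lipschitz
  have h0 : LocallyLipschitz (fun q : ℝ × ℝ => q.2 / ε) :=
    ContDiff.locallyLipschitz (𝕂 := ℝ) (by fun_prop)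
  have h2 : LocallyLipschitz (fun u : ℝ => u / 2) :=
    ContDiff.locallyLipschitz (𝕂 := ℝ) (by fun_prop)
  have h1 : LocallyLipschitz (fun q : ℝ × ℝ => φ (q.2 / ε) / 2) :=
    h2.comp (hK.locallyLipschitz.comp h0)
  have hc : LocallyLipschitz (fun _ : ℝ × ℝ => (1 / 2 : ℝ)) := LocallyLipschitz.const _
  have := (hc.smul_prod (hp.add hm)).add (h1.smul_prod (hp.sub hm))
  exact this

theorem regularized_eq (Xp Xm : ℝ × ℝ → ℝ × ℝ) (φ : ℝ → ℝ) (ε : ℝ) (q : ℝ × ℝ) :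
    regularized Xp Xm φ ε q =
      ((1 + φ (q.2 / ε)) / 2) • Xp q + ((1 - φ (q.2 / ε)) / 2) • Xm q := by
  unfold regularized
  module

theorem regularized_of_ge (hφ : IsTransition φ) (hε : 0 < ε) (hq : ε ≤ q.2) :
    regularized Xp Xm φ ε q = Xp q := by
  rw [regularized_eq, hφ.right _ ((one_le_div hε).2 hq)]
  simp

theorem regularized_of_le (hφ : IsTransition φ) (hε : 0 < ε) (hq : q.2 ≤ -ε) :
    regularized Xp Xm φ ε q = Xm q := by
  rw [regularized_eq, hφ.left _ ((div_le_iff₀ hε).2 (by linarith))]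
  simp

/-- A linear functional that is at least `c` on both fields is at least `c` on the regularization. -/
theorem le_regularized (hφ : IsTransition φ) {a b c : ℝ} (h1 : c ≤ a * (Xp q).1 + b * (Xp q).2)
    (h2 : c ≤ a * (Xm q).1 + b * (Xm q).2) :
    c ≤ a * (regularized Xp Xm φ ε q).1 + b * (regularized Xp Xm φ ε q).2 := by
  have hv := hφ.mem_Icc (q.2 / ε)
  set s := φ (q.2 / ε) with hs
  rw [regularized_eq, ← hs]
  simp only [Prod.fst_add, Prod.snd_add, Prod.smul_fst, Prod.smul_snd, smul_eq_mul]
  have e1 := mul_le_mul_of_nonneg_left h1 (show 0 ≤ (1 + s) / 2 by linarith [hv.1])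
  have e2 := mul_le_mul_of_nonneg_left h2 (show 0 ≤ (1 - s) / 2 by linarith [hv.2])
  nlinarith

theorem norm_regularized_le (hφ : IsTransition φ) {c : ℝ} (h1 : ‖Xp q‖ ≤ c) (h2 : ‖Xm q‖ ≤ c) :
    ‖regularized Xp Xm φ ε q‖ ≤ c := by
  have hv := hφ.mem_Icc (q.2 / ε)
  rw [regularized_eq]
  refine (norm_add_le _ _).trans ?_
  rw [norm_smul, norm_smul, Real.norm_of_nonneg (by linarith [hv.1]),
    Real.norm_of_nonneg (by linarith [hv.2])]
  have e1 := mul_le_mul_of_nonneg_left h1 (show 0 ≤ (1 + φ (q.2 / ε)) / 2 by linarith [hv.1])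
  have e2 := mul_le_mul_of_nonneg_left h2 (show 0 ≤ (1 - φ (q.2 / ε)) / 2 by linarith [hv.2])
  linarith

/-- The `X⁺` part of `Z_ε` drops out, so the direction in which `Z_ε` crosses the orbits of `X⁺` is
decided by `X⁻`, with a weight that is positive exactly below `y = ε` when `ε > 0`. -/
theorem cross_regularized (Xp Xm : ℝ × ℝ → ℝ × ℝ) (φ : ℝ → ℝ) (ε : ℝ) (q : ℝ × ℝ) :
    (Xp q).1 * (regularized Xp Xm φ ε q).2 - (Xp q).2 * (regularized Xp Xm φ ε q).1 =
      (1 - φ (q.2 / ε)) / 2 * ((Xp q).1 * (Xm q).2 - (Xm q).1 * (Xp q).2) := by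
  rw [regularized_eq]
  simp only [Prod.fst_add, Prod.snd_add, Prod.smul_fst, Prod.smul_snd, smul_eq_mul]
  ring

end Regularized

/-! ### Horizontal tangencies near the visible fold. -/

theorem exists_closedBall_of_eventually {P : ℝ × ℝ → Prop} (h : ∀ᶠ q in 𝓝 (0 : ℝ × ℝ), P q) :
    ∃ r > 0, ∀ q ∈ Metric.closedBall (0 : ℝ × ℝ) r, P q := by
  obtain ⟨r, hr, hs⟩ := Metric.nhds_basis_closedBall.mem_iff.1 h
  exact ⟨r, hr, hs⟩

theorem mem_closedBall_zero_prod {q : ℝ × ℝ} {r : ℝ} :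
    q ∈ Metric.closedBall (0 : ℝ × ℝ) r ↔ |q.1| ≤ r ∧ |q.2| ≤ r := by
  rw [mem_closedBall_zero_iff, Prod.norm_def, max_le_iff, Real.norm_eq_abs, Real.norm_eq_abs]

namespace IsVisibleFold

variable {Xp Xm : ℝ × ℝ → ℝ × ℝ}

theorem locallyLipschitz_plus (h : IsVisibleFold Xp Xm) : LocallyLipschitz Xp :=
  (h.contDiff_plus.of_le (by norm_num)).locallyLipschitz

theorem locallyLipschitz_minus (h : IsVisibleFold Xp Xm) : LocallyLipschitz Xm :=
  (h.contDiff_minus.of_le (by norm_num)).locallyLipschitz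

theorem contDiff_plus_snd (h : IsVisibleFold Xp Xm) : ContDiff ℝ 1 (fun q => (Xp q).2) :=
  contDiff_snd.comp (h.contDiff_plus.of_le (by norm_num))

theorem hasDerivAt_plus_snd (h : IsVisibleFold Xp Xm) (x y : ℝ) :
    HasDerivAt (fun x => (Xp (x, y)).2) (fderiv ℝ (fun q => (Xp q).2) (x, y) (1, 0)) x := by
  have h1 : HasFDerivAt (fun q => (Xp q).2) (fderiv ℝ (fun q => (Xp q).2) (x, y)) (x, y) :=
    (h.contDiff_plus_snd.differentiable (by norm_num) _).hasFDerivAt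
  have h2 : HasDerivAt (fun x : ℝ => (x, y)) ((1 : ℝ), (0 : ℝ)) x :=
    (hasDerivAt_id x).prodMk (hasDerivAt_const x y)
  exact HasFDerivAt.comp_hasDerivAt (f := fun x : ℝ => (x, y)) x h1 h2

theorem continuous_fderiv_plus_snd (h : IsVisibleFold Xp Xm) :
    Continuous (fun q => fderiv ℝ (fun q => (Xp q).2) q) :=
  h.contDiff_plus_snd.continuous_fderiv (by norm_num)

/-- Right difference quotients at 0 are positive, so the derivative is nonnegative; genericity
excludes zero. -/
theorem fderiv_plus_snd_pos (h : IsVisibleFold Xp Xm) :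
    0 < fderiv ℝ (fun q => (Xp q).2) (0, 0) (1, 0) := by
  have hd := h.hasDerivAt_plus_snd 0 0
  have hne := h.generic
  rw [hd.deriv] at hne
  refine lt_of_le_of_ne ?_ hne.symm
  have ht := hd.hasDerivWithinAt (s := Ioi 0)
  rw [hasDerivWithinAt_iff_tendsto_slope' self_notMem_Ioi] at ht
  refine ge_of_tendsto ht ?_
  filter_upwards [self_mem_nhdsWithin] with x hx
  have hx0 : 0 < x := hx
  rw [slope_def_field, h.tangent, sub_zero, sub_zero]
  exact (div_pos (h.up x hx0) hx0).le

/-- The tangencies of `X⁺` with the horizontal lines near the switching line form a curve. -/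
theorem exists_tangency (h : IsVisibleFold Xp Xm) : ∃ ξ : ℝ → ℝ, Tendsto ξ (𝓝 0) (𝓝 0) ∧
    ∀ R : ℝ, ∀ᶠ m in 𝓝 (0 : ℝ), ∀ x ∈ Icc (-R) R, (Xp (x, m)).2 = 0 ↔ x = ξ m := by
  classical
  set f : ℝ × ℝ → ℝ := fun q => (Xp q).2 with hf
  have hfc : Continuous f := h.contDiff_plus_snd.continuous
  have hg : Continuous fun q => fderiv ℝ f q (1, 0) :=
    h.continuous_fderiv_plus_snd.clm_apply continuous_const
  obtain ⟨r, hr, hpos⟩ := exists_closedBall_of_eventually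
    ((hg.tendsto (0 : ℝ × ℝ)).eventually_const_lt h.fderiv_plus_snd_pos)
  have hmono : ∀ y ∈ Icc (-r) r, StrictMonoOn (fun x => f (x, y)) (Icc (-r) r) := by
    intro y hy
    refine strictMonoOn_of_deriv_pos (convex_Icc _ _) (by fun_prop) fun x hx => ?_
    rw [interior_Icc] at hx
    rw [(h.hasDerivAt_plus_snd x y).deriv]
    exact hpos (x, y) (mem_closedBall_zero_prod.2
      ⟨abs_le.2 ⟨hx.1.le, hx.2.le⟩, abs_le.2 hy⟩)
  -- The root is unique by strict monotonicity, and it exists for small `y` by a sign change over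
  -- `[-s, s]`; the default 0 is only used for other `y`.
  set ξ : ℝ → ℝ := fun y => if hy : ∃ x ∈ Icc (-r) r, f (x, y) = 0 then hy.choose else 0 with hξ
  have hev : ∀ s ∈ Ioc 0 r, ∀ᶠ y in 𝓝 (0 : ℝ), ξ y ∈ Ioo (-s) s ∧ f (ξ y, y) = 0 ∧
      ∀ x ∈ Icc (-r) r, f (x, y) = 0 → x = ξ y := by
    intro s hs
    have e1 : ∀ᶠ y in 𝓝 (0 : ℝ), f (-s, y) < 0 := by
      have : Continuous fun y => f (-s, y) := by fun_prop
      exact (this.tendsto 0).eventually_lt_const (h.down (-s) (by linarith [hs.1]))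
    have e2 : ∀ᶠ y in 𝓝 (0 : ℝ), 0 < f (s, y) := by
      have : Continuous fun y => f (s, y) := by fun_prop
      exact (this.tendsto 0).eventually_const_lt (h.up s hs.1)
    filter_upwards [e1, e2, Icc_mem_nhds (neg_lt_zero.2 hr) hr] with y h1 h2 h3
    have hs0 := hs.1
    have hsr := hs.2
    have hcont : ContinuousOn (fun x => f (x, y)) (Icc (-s) s) := by fun_prop
    obtain ⟨x, hx, hx0⟩ := intermediate_value_Ioo (by linarith) hcont ⟨h1, h2⟩
    have hxr : x ∈ Icc (-r) r := ⟨by linarith [hx.1], by linarith [hx.2]⟩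
    have hex : ∃ x ∈ Icc (-r) r, f (x, y) = 0 := ⟨x, hxr, hx0⟩
    have hξy : ξ y = hex.choose := dif_pos hex
    have hu : ∀ x' ∈ Icc (-r) r, f (x', y) = 0 → x' = ξ y := by
      intro x' hx' hx'0
      rw [hξy]
      exact (hmono y h3).injOn hx' hex.choose_spec.1 (by
        simp only [hx'0, hex.choose_spec.2])
    refine ⟨?_, ?_, hu⟩
    · rw [← hu x hxr hx0]
      exact hx
    · rw [hξy]
      exact hex.choose_spec.2
  refine ⟨ξ, ?_, fun R => ?_⟩
  · rw [Metric.tendsto_nhds]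
    intro s hs
    filter_upwards [hev (min s r) ⟨lt_min hs hr, min_le_right _ _⟩] with y hy
    rw [Real.dist_eq, sub_zero, abs_lt]
    exact ⟨by linarith [hy.1.1, min_le_left s r], by linarith [hy.1.2, min_le_left s r]⟩
  -- Away from the fold `X⁺₂` has no zero on the switching line, and by compactness none on nearby
  -- horizontal lines.
  · have hc : IsCompact (Icc (-R) R ∩ {x | r ≤ |x|}) :=
      isCompact_Icc.inter_right (isClosed_le continuous_const continuous_abs)
    have hne : ∀ᶠ y in 𝓝 (0 : ℝ), ∀ x ∈ Icc (-R) R ∩ {x | r ≤ |x|}, f (x, y) ≠ 0 := by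
      refine hc.eventually_forall_of_forall_eventually fun x hx => ?_
      have hx0 : f (x, 0) ≠ 0 := by
        have hx2 : r ≤ |x| := hx.2
        rcases lt_trichotomy x 0 with hlt | rfl | hgt
        · exact (h.down x hlt).ne
        · simp at hx2; linarith
        · exact (h.up x hgt).ne'
      have : Continuous fun z : ℝ × ℝ => f (z.2, z.1) := by fun_prop
      exact this.continuousAt.eventually_ne hx0
    filter_upwards [hev r ⟨hr, le_rfl⟩, hne] with y hy hy2 x hx
    constructor
    · intro hx0
      refine hy.2.2 x ?_ hx0
      by_contra hcon
      refine hy2 x ⟨hx, ?_⟩ hx0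
      by_contra! hlt
      exact hcon (abs_le.1 (not_le.1 hlt).le)
    · rintro rfl
      exact hy.2.1

end IsVisibleFold

/-! ### Comparison of curves with graphs. -/

theorem mem_closedBall_of_norm_deriv_le {v v' : ℝ → ℝ × ℝ} {ρ C T : ℝ} (hC : 0 ≤ C) (hρ : 0 ≤ ρ)
    (hv : Continuous v)
    (hd : ∀ t, v t ∈ Metric.closedBall (v 0) ρ → HasDerivAt v (v' t) t ∧ ‖v' t‖ ≤ C)
    (hCT : C * T < ρ) : ∀ t ∈ Icc 0 T, v t ∈ Metric.closedBall (v 0) ρ := by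
  by_contra! hcon
  obtain ⟨t₁, ht₁, hex⟩ := hcon
  obtain ⟨T', hT'0, hT', hfr⟩ := exists_exit_time hv Metric.isClosed_closedBall
    (Metric.mem_closedBall_self hρ) ⟨t₁, ht₁.1, hex⟩
  have hlt : T' < t₁ := by
    by_contra! hle
    exact hex (hT' t₁ ⟨ht₁.1, hle⟩)
  have hn := norm_image_sub_le_of_norm_deriv_le_segment' (f := v) (f' := v') (C := C) (a := 0)
    (b := T') (fun t ht => (hd t (hT' t ht)).1.hasDerivWithinAt)
    (fun t ht => (hd t (hT' t (Ico_subset_Icc_self ht))).2) T' (right_mem_Icc.2 hT'0)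
  have hmem : v T' ∈ Metric.ball (v 0) ρ := by
    rw [mem_ball_iff_norm]
    have : C * (T' - 0) ≤ C * T := mul_le_mul_of_nonneg_left (by linarith [ht₁.2]) hC
    linarith
  refine hfr ?_
  have : ∀ᶠ t in 𝓝[>] T', v t ∈ Metric.ball (v 0) ρ :=
    mem_nhdsWithin_of_mem_nhds ((hv.tendsto T').eventually (Metric.isOpen_ball.mem_nhds hmem))
  filter_upwards [this] with t ht
  exact not_not.2 (Metric.ball_subset_closedBall ht)

/-- Multiplying a field by a positive scalar function only changes the time along its orbits. -/
theorem IsPeriodicSol.exists_rescaled {X : ℝ × ℝ → ℝ × ℝ} (hX : LocallyLipschitz X)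
    {γ : ℝ → ℝ × ℝ} (hγ : IsPeriodicSol X γ) {l : ℝ × ℝ → ℝ} (hl : LocallyLipschitz l) :
    ∃ c : ℝ → ℝ × ℝ, c 0 = γ 0 ∧ range c ⊆ range γ ∧ ∀ t, HasDerivAt c (l (c t) • X (c t)) t := by
  have hc := hγ.isCompact_range
  obtain ⟨K, hK⟩ := (hl.locallyLipschitzOn (s := range γ)).exists_lipschitzOnWith_of_compact hc
  obtain ⟨B, hB⟩ := hc.exists_bound_of_continuousOn hl.continuous.continuousOn
  obtain ⟨D, hD⟩ := hc.exists_bound_of_continuousOn hX.continuous.continuousOn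
  have hγL : LipschitzWith D.toNNReal γ := by
    refine lipschitzWith_of_nnnorm_deriv_le (fun t => (hγ.1 t).differentiableAt) fun t => ?_
    rw [(hγ.1 t).deriv, ← NNReal.coe_le_coe, coe_nnnorm]
    exact (hD _ ⟨t, rfl⟩).trans (Real.le_coe_toNNReal D)
  have hf : LipschitzWith (K * D.toNNReal) (l ∘ γ) :=
    lipschitzOnWith_univ.1 (hK.comp hγL.lipschitzOnWith fun t _ => ⟨t, rfl⟩)
  -- The new time solves the scalar equation `τ' = l (γ τ)`, whose right-hand side is bounded and
  -- Lipschitz because the orbit is compact.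
  obtain ⟨τ, hτ0, hτ⟩ := exists_global_solution (C := B.toNNReal) hf
    (fun t => (hB _ ⟨t, rfl⟩).trans (Real.le_coe_toNNReal B)) 0
  refine ⟨γ ∘ τ, by simp [hτ0], range_comp_subset_range _ _, fun t => ?_⟩
  exact (hγ.1 (τ t)).scomp t (hτ t)

theorem locallyLipschitz_inv_max {f : ℝ × ℝ → ℝ} (hf : LocallyLipschitz f) {c : ℝ} (hc : 0 < c) :
    LocallyLipschitz fun q => (max (f q) c)⁻¹ := by
  intro x
  obtain ⟨K, t, ht, h⟩ := (hf.max_const c) x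
  refine ⟨K * (c⁻¹ * c⁻¹).toNNReal, t, ht, LipschitzOnWith.of_dist_le_mul fun a ha b hb => ?_⟩
  have e := h.dist_le_mul a ha b hb
  have ha' : c ≤ max (f a) c := le_max_right _ _
  have hb' : c ≤ max (f b) c := le_max_right _ _
  set A := max (f a) c
  set B := max (f b) c
  have hA : 0 < A := hc.trans_le ha'
  have hB : 0 < B := hc.trans_le hb'
  rw [Real.dist_eq, inv_sub_inv hA.ne' hB.ne', abs_div, abs_of_pos (mul_pos hA hB), abs_sub_comm]
  rw [Real.dist_eq] at e
  push_cast
  rw [Real.coe_toNNReal _ (by positivity), div_eq_mul_inv, mul_inv]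
  have h1 : A⁻¹ * B⁻¹ ≤ c⁻¹ * c⁻¹ := by gcongr
  calc |A - B| * (A⁻¹ * B⁻¹) ≤ (K * dist a b) * (c⁻¹ * c⁻¹) :=
        mul_le_mul e h1 (by positivity) (by positivity)
    _ = _ := by ring

/-- Wherever `-d` touches the barrier `η * exp ((|K| + 1) (x - a))`, its slope is at most `K |d|`,
less than that of the barrier; let `η → 0`. -/
theorem nonneg_of_deriv_ge_neg_mul_abs {d d' : ℝ → ℝ} {a b K : ℝ} (hd : ContinuousOn d (Icc a b))
    (hd' : ∀ x ∈ Ico a b, HasDerivWithinAt d (d' x) (Ici x) x) (ha : 0 ≤ d a)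
    (hK : ∀ x ∈ Ico a b, -(K * |d x|) ≤ d' x) : ∀ x ∈ Icc a b, 0 ≤ d x := by
  intro x hx
  have key : ∀ η > 0, -d x ≤ η * Real.exp ((|K| + 1) * (x - a)) := by
    intro η hη
    refine image_le_of_deriv_right_lt_deriv_boundary' (f := fun x => -d x) (f' := fun x => -d' x)
      (B := fun x => η * Real.exp ((|K| + 1) * (x - a)))
      (B' := fun x => η * (Real.exp ((|K| + 1) * (x - a)) * (|K| + 1)))
      hd.neg (fun x hx => (hd' x hx).neg) (by simp; linarith) (by fun_prop) ?_ ?_ hx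
    · intro y _
      have h1 : HasDerivAt (fun x : ℝ => (|K| + 1) * (x - a)) (|K| + 1) y := by
        simpa using ((hasDerivAt_id y).sub_const a).const_mul (|K| + 1)
      exact (h1.exp.const_mul η).hasDerivWithinAt
    · intro y hy he
      have hpos : 0 < η * Real.exp ((|K| + 1) * (y - a)) := by positivity
      have h1 := hK y hy
      have h2 : |d y| = η * Real.exp ((|K| + 1) * (y - a)) := by
        rw [← he, ← abs_neg, abs_of_pos (by linarith)]
      rw [h2] at h1
      nlinarith [le_abs_self K]
  have hlim : Tendsto (fun η : ℝ => η * Real.exp ((|K| + 1) * (x - a))) (𝓝[>] 0) (𝓝 0) := by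
    have : Tendsto (fun η : ℝ => η * Real.exp ((|K| + 1) * (x - a))) (𝓝 0)
        (𝓝 (0 * Real.exp ((|K| + 1) * (x - a)))) := tendsto_id.mul_const _
    rw [zero_mul] at this
    exact this.mono_left nhdsWithin_le_nhds
  have := ge_of_tendsto hlim (by filter_upwards [self_mem_nhdsWithin] with η hη using key η hη)
  linarith

/-- `c` is the graph of a solution of `y' = Y₂ / Y₁` over `[-ρ, ρ]`, inside the square `‖q‖ ≤ r`. -/
structure IsGraph (Y : ℝ × ℝ → ℝ × ℝ) (ρ r : ℝ) (c : ℝ → ℝ × ℝ) : Prop where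
  hasDerivAt : ∀ x, HasDerivAt c (Y (c x)) x
  fst_eq : ∀ x ∈ Icc (-ρ) ρ, (c x).1 = x
  mem : ∀ x ∈ Icc (-ρ) ρ, c x ∈ Metric.closedBall (0 : ℝ × ℝ) r

namespace IsGraph

variable {Y : ℝ × ℝ → ℝ × ℝ} {ρ r : ℝ} {c c₁ : ℝ → ℝ × ℝ}

/-- Graphs that change order meet over some abscissa, and then coincide by uniqueness. -/
theorem lt_of_lt (hY : LocallyLipschitz Y) (hc : IsGraph Y ρ r c) (hc₁ : IsGraph Y ρ r c₁) {x z : ℝ}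
    (hx : x ∈ Icc (-ρ) ρ) (hz : z ∈ Icc (-ρ) ρ) (h : (c x).2 < (c₁ x).2) : (c z).2 < (c₁ z).2 := by
  by_contra! hle
  have hcc : ∀ c, IsGraph Y ρ r c → Continuous c := fun c hc =>
    continuous_iff_continuousAt.2 fun t => (hc.hasDerivAt t).continuousAt
  have hcont : Continuous fun x => (c₁ x).2 - (c x).2 :=
    (continuous_snd.comp (hcc _ hc₁)).sub (continuous_snd.comp (hcc _ hc))
  have hsub : uIcc x z ⊆ Icc (-ρ) ρ := (ordConnected_Icc).uIcc_subset hx hz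
  obtain ⟨u, hu, hu0⟩ : (0 : ℝ) ∈ (fun x => (c₁ x).2 - (c x).2) '' uIcc x z :=
    intermediate_value_uIcc hcont.continuousOn (by
      rw [mem_uIcc]
      right
      constructor <;> linarith)
  have huI := hsub hu
  have he : c u = c₁ u := Prod.ext ((hc.fst_eq u huI).trans (hc₁.fst_eq u huI).symm) (by
    simp only at hu0
    linarith)
  have := IsSolOn.eqOn_of_eq hY (isSolOn_of_hasDerivAt hc.hasDerivAt (Icc (-ρ) ρ))
    (isSolOn_of_hasDerivAt hc₁.hasDerivAt _) huI he hx
  rw [this] at h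
  exact lt_irrefl _ h

theorem le_of_le (hY : LocallyLipschitz Y) (hc : IsGraph Y ρ r c) (hc₁ : IsGraph Y ρ r c₁) {x z : ℝ}
    (hx : x ∈ Icc (-ρ) ρ) (hz : z ∈ Icc (-ρ) ρ) (h : (c x).2 ≤ (c₁ x).2) : (c z).2 ≤ (c₁ z).2 := by
  by_contra! hlt
  exact absurd (lt_of_lt hY hc₁ hc hz hx hlt) (not_lt.2 h)

/-- A curve that crosses the graphs upwards stays above the graph on which it starts. -/
theorem le_of_cross_nonneg (hY : LocallyLipschitz Y) (hc : IsGraph Y ρ r c)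
    {Z : ℝ × ℝ → ℝ × ℝ} (hZ : Continuous Z)
    (hcross : ∀ q ∈ Metric.closedBall (0 : ℝ × ℝ) r, (Y q).2 * (Z q).1 ≤ (Z q).2)
    {v : ℝ → ℝ × ℝ} {a b : ℝ} (hv : IsSolOn Z v (Icc a b))
    (hvr : ∀ t ∈ Icc a b, v t ∈ Metric.closedBall (0 : ℝ × ℝ) r)
    (hvρ : ∀ t ∈ Icc a b, (v t).1 ∈ Icc (-ρ) ρ) (ha : (c (v a).1).2 ≤ (v a).2) :
    ∀ t ∈ Icc a b, (c (v t).1).2 ≤ (v t).2 := by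
  have hcomp : IsCompact (Metric.closedBall (0 : ℝ × ℝ) r) := isCompact_closedBall 0 r
  obtain ⟨K, hK⟩ := (hY.locallyLipschitzOn (s := Metric.closedBall (0 : ℝ × ℝ) r)
    ).exists_lipschitzOnWith_of_compact hcomp
  obtain ⟨B, hB⟩ := hcomp.exists_bound_of_continuousOn hZ.continuousOn
  have hd : ∀ t ∈ Icc a b, HasDerivWithinAt (fun t => (v t).2 - (c (v t).1).2)
      ((Z (v t)).2 - (Z (v t)).1 * (Y (c (v t).1)).2) (Icc a b) t := by
    intro t ht
    have h0 : HasDerivWithinAt (fun t => (v t).2) (Z (v t)).2 (Icc a b) t := (hv t ht).snd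
    have h1 : HasDerivWithinAt (fun t => (v t).1) (Z (v t)).1 (Icc a b) t := (hv t ht).fst
    have h2 : HasDerivAt (fun x => (c x).2) (Y (c (v t).1)).2 (v t).1 := (hc.hasDerivAt _).snd
    have h3 := h2.scomp_hasDerivWithinAt t h1
    exact HasDerivWithinAt.sub h0 h3
  -- By `hcross` the vertical gap `d` satisfies `d' ≥ (Y₂ (v) - Y₂ (c)) Z₁`, which is at least `-K B
  -- |d|` by the Lipschitz bound on `Y` and the bound on `Z`.
  have key := nonneg_of_deriv_ge_neg_mul_abs (d := fun t => (v t).2 - (c (v t).1).2)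
    (d' := fun t => (Z (v t)).2 - (Z (v t)).1 * (Y (c (v t).1)).2) (a := a) (b := b) (K := K * B)
    (fun t ht => (hd t ht).continuousWithinAt)
    (fun t ht => (hd t (Ico_subset_Icc_self ht)).mono_of_mem_nhdsWithin (Icc_mem_nhdsGE_of_mem ht))
    (sub_nonneg.2 ha) ?_
  · exact fun t ht => sub_nonneg.1 (key t ht)
  intro t ht
  replace ht := Ico_subset_Icc_self ht
  have h1 := hcross _ (hvr t ht)
  have h2 := hK.dist_le_mul _ (hvr t ht) _ (hc.mem _ (hvρ t ht))
  have h3 : dist (v t) (c (v t).1) = |(v t).2 - (c (v t).1).2| := by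
    rw [Prod.dist_eq, hc.fst_eq _ (hvρ t ht), dist_self, Real.dist_eq, max_eq_right (abs_nonneg _)]
  have h4 : |(Y (v t)).2 - (Y (c (v t).1)).2| ≤ dist (Y (v t)) (Y (c (v t).1)) := by
    rw [Prod.dist_eq, ← Real.dist_eq]
    exact le_max_right _ _
  have h5 : |(Z (v t)).1| ≤ B := by
    refine le_trans ?_ (hB _ (hvr t ht))
    rw [Prod.norm_def, ← Real.norm_eq_abs]
    exact le_max_left _ _
  rw [h3] at h2
  have h6 : |((Y (v t)).2 - (Y (c (v t).1)).2) * (Z (v t)).1| ≤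
      (K * |(v t).2 - (c (v t).1).2|) * B := by
    rw [abs_mul]
    exact mul_le_mul (h4.trans h2) h5 (abs_nonneg _) (by positivity)
  have h7 := (abs_le.1 h6).1
  nlinarith

end IsGraph

/-! ### Leaves near the fold and monotonicity of the height. -/

/-- The disc bounded by the leaf through `q₁` contains a neighbourhood of the fold, and the leaves of
least height `m ∈ [-r₀, r₀]` are those through the tangencies `(ξ m, m)`. -/
structure IsFoldWindow (X : ℝ × ℝ → ℝ × ℝ) (p : ℝ × ℝ) (A : Set (ℝ × ℝ)) (q₁ : ℝ × ℝ) (ξ : ℝ → ℝ)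
    (r₀ : ℝ) : Prop where
  pos : 0 < r₀
  mem : q₁ ∈ A
  ne : q₁ ≠ p
  ball_subset : Metric.closedBall (0 : ℝ × ℝ) r₀ ⊆ leafHull X p q₁
  height_lt : height X p q₁ < -r₀
  lt_center : r₀ < p.2
  unique : ∀ m ∈ Icc (-r₀) r₀, ∀ w ∈ leafHull X p q₁, w.2 = m → (X w).2 = 0 → w = (ξ m, m)

namespace IsCenter

variable {Xp Xm : ℝ × ℝ → ℝ × ℝ} {p q w : ℝ × ℝ} {A : Set (ℝ × ℝ)}

theorem mem_inside_of_height_lt (h : IsCenter Xp p A) (hX : LocallyLipschitz Xp) (hq : q ∈ A)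
    (hw : w ∈ leafHull Xp p q) (hlt : height Xp p q < height Xp p w) :
    w ∈ connectedComponentIn (leaf Xp p q)ᶜ p :=
  hw.resolve_right fun hwl => hlt.ne' (h.height_eq_of_mem hX hq hwl)

/-- Since `A` is open and meets the switching line, it contains a point `q₁` below it, so its leaf
has negative height. The leaf of height 0 passes through the only tangency at level 0, the origin,
which is therefore strictly inside the leaf of `q₁`. -/
theorem exists_foldWindow (h : IsCenter Xp p A) (hf : IsVisibleFold Xp Xm) (hp : 0 < p.2)
    (hcross : ∃ q ∈ A, q.2 = 0) {ξ : ℝ → ℝ}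
    (hξ : ∀ R : ℝ, ∀ᶠ m in 𝓝 (0 : ℝ), ∀ x ∈ Icc (-R) R, (Xp (x, m)).2 = 0 ↔ x = ξ m) :
    ∃ q₁ r₀, IsFoldWindow Xp p A q₁ ξ r₀ := by
  have hX := hf.locallyLipschitz_plus
  obtain ⟨q₀, hq₀, hq₀0⟩ := hcross
  have hev : ∀ᶠ s in 𝓝[>] (0 : ℝ), (q₀.1, -s) ∈ A := by
    have hc : Continuous fun s : ℝ => (q₀.1, -s) := by fun_prop
    refine (hc.tendsto 0).mono_left nhdsWithin_le_nhds ?_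
    refine h.isOpen.mem_nhds ?_
    rwa [neg_zero, ← hq₀0]
  obtain ⟨s, hsA, hs⟩ := (hev.and self_mem_nhdsWithin).exists
  replace hs : 0 < s := hs
  set q₁ : ℝ × ℝ := (q₀.1, -s) with hq₁
  have hq₁p : q₁ ≠ p := fun e => by
    rw [← e] at hp
    simp only [hq₁] at hp
    linarith
  have hh : height Xp p q₁ < 0 :=
    (h.height_le_self hX hsA).trans_lt (by simp only [hq₁]; linarith)
  obtain ⟨R, hR⟩ := (h.isCompact_hull hX hsA hq₁p).isBounded.subset_closedBall (0 : ℝ × ℝ)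
  obtain ⟨m₁, hm₁, hun⟩ := Metric.nhds_basis_closedBall.mem_iff.1 (hξ R)
  have huniq : ∀ m ∈ Icc (-m₁) m₁, ∀ w ∈ leafHull Xp p q₁, w.2 = m → (Xp w).2 = 0 →
      w = (ξ m, m) := by
    intro m hm w hw hwm hw0
    have hwR := (mem_closedBall_zero_prod.1 (hR hw)).1
    have hm' : m ∈ Metric.closedBall (0 : ℝ) m₁ := by
      rw [Real.closedBall_eq_Icc]
      simpa using hm
    refine Prod.ext ((hun hm' w.1 (abs_le.1 hwR)).1 ?_) hwm
    rw [← hwm]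
    exact hw0
  have hun0 := huniq 0 ⟨by linarith, hm₁.le⟩
  obtain ⟨h0K, h0h⟩ := h.tangency_mem_hull hX hsA hq₁p hun0 hh.le hp.le
  have hξ0 : ξ 0 = 0 := by
    have hb : (0 : ℝ) ∈ Metric.closedBall (0 : ℝ) m₁ := Metric.mem_closedBall_self hm₁.le
    have hR0 : 0 ≤ R := by
      have := (mem_closedBall_zero_prod.1 (hR h0K)).1
      exact (abs_nonneg _).trans this
    exact ((hun hb 0 ⟨by linarith, hR0⟩).1 hf.tangent).symm
  rw [hξ0] at h0K h0h
  have h0i := h.mem_inside_of_height_lt hX hsA h0K (hh.trans_eq h0h.symm)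
  obtain ⟨r, hr, hrs⟩ := Metric.nhds_basis_closedBall.mem_iff.1
    (((h.isNestedFoliation hX).isOpen_inside hsA hq₁p).mem_nhds h0i)
  obtain ⟨r₀, hr₀, hr₀m⟩ : ∃ r₀, 0 < r₀ ∧ r₀ < min (min r m₁) (min p.2 (-height Xp p q₁)) :=
    exists_between (by simp [hr, hm₁, hp, hh])
  simp only [lt_min_iff] at hr₀m
  obtain ⟨⟨h1, h2⟩, h3, h4⟩ := hr₀m
  refine ⟨q₁, r₀, hr₀, hsA, hq₁p, ?_, by linarith, h3, fun m hm => huniq m ⟨?_, ?_⟩⟩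
  · exact ((Metric.closedBall_subset_closedBall h1.le).trans hrs).trans subset_union_left
  · linarith [hm.1]
  · linarith [hm.2]

end IsCenter

namespace IsFoldWindow

variable {Xp Xm : ℝ × ℝ → ℝ × ℝ} {p q₁ w : ℝ × ℝ} {A : Set (ℝ × ℝ)} {ξ : ℝ → ℝ} {r₀ m : ℝ}

theorem tangency (hw : IsFoldWindow Xp p A q₁ ξ r₀) (h : IsCenter Xp p A)
    (hX : LocallyLipschitz Xp) (hm : m ∈ Icc (-r₀) r₀) :
    (ξ m, m) ∈ leafHull Xp p q₁ ∧ height Xp p (ξ m, m) = m :=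
  h.tangency_mem_hull hX hw.mem hw.ne (hw.unique m hm) (by linarith [hw.height_lt, hm.1])
    (by linarith [hw.lt_center, hm.2])

theorem leaf_eq (hw : IsFoldWindow Xp p A q₁ ξ r₀) (h : IsCenter Xp p A)
    (hX : LocallyLipschitz Xp) (hm : m ∈ Icc (-r₀) r₀) {z : ℝ × ℝ} (hz : z ∈ leafHull Xp p q₁)
    (hzm : height Xp p z = m) : leaf Xp p z = leaf Xp p (ξ m, m) :=
  h.leaf_of_height_eq hX hw.mem hw.ne (hw.unique m hm) hz hzm

/-- Near the fold the leaves are graphs over the `x`-axis, and their least height is attained on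
these graphs. -/
theorem exists_graphs (hw : IsFoldWindow Xp p A q₁ ξ r₀) (h : IsCenter Xp p A)
    (hf : IsVisibleFold Xp Xm) : ∃ (Y : ℝ × ℝ → ℝ × ℝ) (ρ r s : ℝ), LocallyLipschitz Y ∧
      0 < s ∧ s ≤ ρ ∧ s ≤ r ∧ r ≤ r₀ ∧
      (∀ q ∈ Metric.closedBall (0 : ℝ × ℝ) r, 0 < (Xp q).1 ∧ Y q = ((Xp q).1)⁻¹ • Xp q ∧
        0 < (Xp q).1 * (Xm q).2 - (Xm q).1 * (Xp q).2) ∧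
      ∀ z ∈ Metric.closedBall (0 : ℝ × ℝ) s, ∃ c : ℝ → ℝ × ℝ, IsGraph Y ρ r c ∧ c z.1 = z ∧
        range c ⊆ leaf Xp p z ∧ ∃ x ∈ Icc (-ρ) ρ, (c x).2 = height Xp p z := by
  have hX := hf.locallyLipschitz_plus
  have hXm := hf.locallyLipschitz_minus
  have hXc := hX.continuous
  have hXmc := hXm.continuous
  set c₀ := (Xp (0, 0)).1 / 2 with hc₀
  have hc₀0 : 0 < c₀ := half_pos hf.rightward
  -- Near the fold this is `X⁺` rescaled to horizontal speed 1, so that time is the abscissa; the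
  -- maximum keeps it locally Lipschitz everywhere.
  set Y : ℝ × ℝ → ℝ × ℝ := fun q => (max (Xp q).1 c₀)⁻¹ • Xp q with hYdef
  have hX1 : LocallyLipschitz fun q => (Xp q).1 :=
    LipschitzWith.prod_fst.locallyLipschitz.comp hX
  have hl := locallyLipschitz_inv_max hX1 hc₀0
  have hY : LocallyLipschitz Y := hl.smul_prod hX
  set f : ℝ × ℝ → ℝ := fun q => (Xp q).2 with hfdef
  have hfc : Continuous f := hf.contDiff_plus_snd.continuous
  have hDY : Continuous fun q => fderiv ℝ f q (Y q) :=
    hf.continuous_fderiv_plus_snd.clm_apply hY.continuous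
  have hY0 : Y 0 = (1, 0) := by
    have e1 : max (Xp 0).1 c₀ = (Xp 0).1 := max_eq_left (half_le_self hf.rightward.le)
    have e2 : (Xp 0).2 = 0 := hf.tangent
    have e3 : (Xp 0).1 ≠ 0 := hf.rightward.ne'
    ext
    · simp [hYdef, e1, e3]
    · simp [hYdef, e2]
  have hκ : 0 < fderiv ℝ f 0 (Y 0) := by
    rw [hY0]
    exact hf.fderiv_plus_snd_pos
  set κ := fderiv ℝ f 0 (Y 0) / 2 with hκdef
  have hκ0 : 0 < κ := half_pos hκ
  have ev1 : ∀ᶠ q in 𝓝 (0 : ℝ × ℝ), c₀ < (Xp q).1 :=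
    (hX1.continuous.tendsto 0).eventually_const_lt (half_lt_self hf.rightward)
  have ev2 : ∀ᶠ q in 𝓝 (0 : ℝ × ℝ), κ < fderiv ℝ f q (Y q) :=
    (hDY.tendsto 0).eventually_const_lt (half_lt_self hκ)
  have ev3 : ∀ᶠ q in 𝓝 (0 : ℝ × ℝ), 0 < (Xp q).1 * (Xm q).2 - (Xm q).1 * (Xp q).2 := by
    have hc : Continuous fun q => (Xp q).1 * (Xm q).2 - (Xm q).1 * (Xp q).2 := by fun_prop
    refine (hc.tendsto 0).eventually_const_lt ?_
    have e2 : (Xp 0).2 = 0 := hf.tangent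
    rw [e2, mul_zero, sub_zero]
    exact mul_pos hf.rightward hf.minus_up
  have ev4 : ∀ᶠ q in 𝓝 (0 : ℝ × ℝ), |(Y q).2| < 1 := by
    have hc : Continuous fun q => |(Y q).2| := (continuous_snd.comp hY.continuous).abs
    refine (hc.tendsto 0).eventually_lt_const ?_
    simp [hY0]
  obtain ⟨r₁, hr₁, hball⟩ := Metric.nhds_basis_closedBall.mem_iff.1
    (ev1.and (ev2.and (ev3.and ev4)))
  set r := min r₁ r₀ with hr
  have hr0 : 0 < r := lt_min hr₁ hw.pos
  have hbr : ∀ q ∈ Metric.closedBall (0 : ℝ × ℝ) r, c₀ < (Xp q).1 ∧ κ < fderiv ℝ f q (Y q) ∧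
      0 < (Xp q).1 * (Xm q).2 - (Xm q).1 * (Xp q).2 ∧ |(Y q).2| < 1 :=
    fun q hq => hball (Metric.closedBall_subset_closedBall (min_le_left _ _) hq)
  have hYeq : ∀ q ∈ Metric.closedBall (0 : ℝ × ℝ) r, Y q = ((Xp q).1)⁻¹ • Xp q := by
    intro q hq
    simp only [hYdef]
    rw [max_eq_left (hbr q hq).1.le]
  have hY1 : ∀ q ∈ Metric.closedBall (0 : ℝ × ℝ) r, (Y q).1 = 1 := by
    intro q hq
    rw [hYeq q hq, Prod.smul_fst, smul_eq_mul, inv_mul_cancel₀ (hc₀0.trans (hbr q hq).1).ne']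
  have hYn : ∀ q ∈ Metric.closedBall (0 : ℝ × ℝ) r, ‖Y q‖ ≤ 1 := by
    intro q hq
    rw [Prod.norm_def, hY1 q hq, Real.norm_eq_abs, Real.norm_eq_abs, abs_one]
    exact max_le le_rfl (hbr q hq).2.2.2.le
  -- From `|z.1| ≤ r/8` the abscissas `±r/2` are at most time `5r/8` away. At speed at most 1 the
  -- curve moves less than `3r/4`, so it stays in the square of size `r`.
  set ρ := r / 2 with hρ
  -- Along a graph `X⁺₂` grows at rate at least `κ`, and both ends are at least `ρ / 2` away from
  -- `z.1`; this bound on the initial value forces a change of sign.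
  have ev5 : ∀ᶠ q in 𝓝 (0 : ℝ × ℝ), |f q| < κ * (ρ / 2) := by
    refine (hfc.abs.tendsto 0).eventually_lt_const ?_
    have e2 : f 0 = 0 := hf.tangent
    rw [e2, abs_zero]
    positivity
  obtain ⟨s₁, hs₁, hball₁⟩ := Metric.nhds_basis_closedBall.mem_iff.1 ev5
  set s := min s₁ (r / 8) with hs
  have hs0 : 0 < s := lt_min hs₁ (by linarith)
  have hs8 : s ≤ r / 8 := min_le_right _ _
  refine ⟨Y, ρ, r, s, hY, hs0, by linarith, by linarith, min_le_right _ _,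
    fun q hq => ⟨hc₀0.trans (hbr q hq).1, hYeq q hq, (hbr q hq).2.2.1⟩, fun z hz => ?_⟩
  have hzr₀ : z ∈ leafHull Xp p q₁ := hw.ball_subset
    (Metric.closedBall_subset_closedBall (by linarith [min_le_right r₁ r₀]) hz)
  have hzA : z ∈ A := h.hull_subset hX hw.mem hw.ne hzr₀
  have hz2 := mem_closedBall_zero_prod.1 hz
  have hzp : z ≠ p := fun e => by
    have := (abs_le.1 hz2.2).2
    rw [e] at this
    linarith [hw.lt_center, min_le_right r₁ r₀]
  obtain ⟨γ, hγ, hγ0, hγl, -⟩ := h.exists_periodic hX hzA hzp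
  obtain ⟨c', hc'0, hc'r, hc'⟩ := hγ.exists_rescaled hX hl
  have hzx := abs_le.1 hz2.1
  have hc'cont : Continuous c' := continuous_iff_continuousAt.2 fun t => (hc' t).continuousAt
  have hballz : Metric.closedBall z (3 * r / 4) ⊆ Metric.closedBall (0 : ℝ × ℝ) r := by
    refine Metric.closedBall_subset_closedBall' ?_
    have := mem_closedBall_iff_norm.1 hz
    rw [dist_eq_norm]
    linarith
  have hc'z : c' 0 = z := hc'0.trans hγ0
  have hfwd : ∀ t ∈ Icc 0 (5 * r / 8), c' t ∈ Metric.closedBall (c' 0) (3 * r / 4) := by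
    refine mem_closedBall_of_norm_deriv_le (v' := fun t => Y (c' t)) zero_le_one (by linarith)
      hc'cont (fun t ht => ⟨hc' t, hYn _ (hballz ?_)⟩) (by linarith)
    rwa [hc'z] at ht
  have hbwd : ∀ t ∈ Icc 0 (5 * r / 8), c' (-t) ∈ Metric.closedBall (c' (-0)) (3 * r / 4) := by
    refine mem_closedBall_of_norm_deriv_le (v := fun t => c' (-t)) (v' := fun t => -Y (c' (-t)))
      zero_le_one (by linarith) (by fun_prop) (fun t ht => ⟨?_, ?_⟩) (by linarith)
    · have := (hc' (-t)).scomp t (hasDerivAt_neg t)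
      rw [neg_one_smul] at this
      exact this
    · rw [norm_neg]
      rw [neg_zero, hc'z] at ht
      exact hYn _ (hballz ht)
  rw [neg_zero, hc'z] at hbwd
  rw [hc'z] at hfwd
  set c : ℝ → ℝ × ℝ := fun x => c' (x - z.1) with hc
  have hcd : ∀ x, HasDerivAt c (Y (c x)) x := fun x => (hc' (x - z.1)).comp_sub_const x z.1
  have hcmem : ∀ x ∈ Icc (-ρ) ρ, c x ∈ Metric.closedBall (0 : ℝ × ℝ) r := by
    intro x hx
    apply hballz
    rcases le_total z.1 x with hle | hle
    · exact hfwd (x - z.1) ⟨by linarith, by linarith [hx.2]⟩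
    · have := hbwd (z.1 - x) ⟨by linarith, by linarith [hx.1]⟩
      rwa [neg_sub] at this
  have hzρ : z.1 ∈ Icc (-ρ) ρ := ⟨by linarith, by linarith⟩
  have hcz : c z.1 = z := by simp [hc, hc'z]
  have hcfst : ∀ x ∈ Icc (-ρ) ρ, (c x).1 = x := by
    intro x hx
    have hd : ∀ y ∈ Icc (-ρ) ρ, HasDerivWithinAt (fun y => (c y).1 - y) ((Y (c y)).1 - 1)
        (Icc (-ρ) ρ) y := fun y _ => by
      have h1 : HasDerivAt (fun y => (c y).1) (Y (c y)).1 y := (hcd y).fst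
      exact (h1.sub (hasDerivAt_id y)).hasDerivWithinAt
    have := (convex_Icc (-ρ) ρ).norm_image_sub_le_of_norm_hasDerivWithin_le (C := 0) hd
      (fun y hy => by rw [hY1 _ (hcmem y hy)]; simp) hzρ hx
    simp only [hcz, sub_self, sub_zero, zero_mul, norm_le_zero_iff] at this
    linarith
  have hcr : range c ⊆ leaf Xp p z := by
    rw [hγl]
    rintro _ ⟨x, rfl⟩
    exact hc'r ⟨x - z.1, rfl⟩
  refine ⟨c, ⟨hcd, hcfst, hcmem⟩, hcz, hcr, ?_⟩
  have hfd : ∀ x, HasDerivAt (fun x => f (c x)) (fderiv ℝ f (c x) (Y (c x))) x := by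
    intro x
    have h1 : HasFDerivAt f (fderiv ℝ f (c x)) (c x) :=
      (hf.contDiff_plus_snd.differentiable (by norm_num) _).hasFDerivAt
    exact h1.comp_hasDerivAt x (hcd x)
  have hgrow : ∀ x ∈ Icc (-ρ) ρ, ∀ y ∈ Icc (-ρ) ρ, x ≤ y → κ * (y - x) ≤ f (c y) - f (c x) := by
    refine (convex_Icc (-ρ) ρ).mul_sub_le_image_sub_of_le_deriv
      (fun x _ => (hfd x).continuousAt.continuousWithinAt)
      (fun x _ => (hfd x).differentiableAt.differentiableWithinAt) fun x hx => ?_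
    rw [interior_Icc] at hx
    rw [(hfd x).deriv]
    exact (hbr _ (hcmem x (Ioo_subset_Icc_self hx))).2.1.le
  have hfz : |f z| < κ * (ρ / 2) :=
    hball₁ (Metric.closedBall_subset_closedBall (min_le_left _ _) hz)
  rw [abs_lt] at hfz
  have hρ0 : 0 < ρ := half_pos hr0
  have hL : f (c (-ρ)) < 0 := by
    have := hgrow (-ρ) (left_mem_Icc.2 (by linarith)) z.1 hzρ hzρ.1
    rw [hcz] at this
    have h2 : κ * (ρ / 2) ≤ κ * (z.1 - -ρ) := mul_le_mul_of_nonneg_left (by linarith) hκ0.le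
    linarith
  have hR : 0 < f (c ρ) := by
    have := hgrow z.1 hzρ ρ (right_mem_Icc.2 (by linarith)) hzρ.2
    rw [hcz] at this
    have h2 : κ * (ρ / 2) ≤ κ * (ρ - z.1) := mul_le_mul_of_nonneg_left (by linarith) hκ0.le
    linarith
  -- The zero of `X⁺₂` on the graph is a tangency at its own level, hence the lowest point of the
  -- leaf through it.
  obtain ⟨x, hx, hx0⟩ := intermediate_value_Icc (by linarith)
    (fun x _ => (hfd x).continuousAt.continuousWithinAt : ContinuousOn (fun x => f (c x))
      (Icc (-ρ) ρ)) ⟨hL.le, hR.le⟩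
  refine ⟨x, hx, ?_⟩
  have hcxb : c x ∈ Metric.closedBall (0 : ℝ × ℝ) r₀ :=
    Metric.closedBall_subset_closedBall (min_le_right _ _) (hcmem x hx)
  have hm : (c x).2 ∈ Icc (-r₀) r₀ := abs_le.1 (mem_closedBall_zero_prod.1 hcxb).2
  have e1 := hw.unique _ hm (c x) (hw.ball_subset hcxb) rfl hx0
  have e2 := (hw.tangency h hX hm).2
  rw [← e1, h.height_eq_of_mem hX hzA (hcr ⟨x, rfl⟩)] at e2
  exact e2.symm

/-- Near the fold the regularization moves from a leaf to leaves of greater least height. -/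
theorem exists_height_monotone (hw : IsFoldWindow Xp p A q₁ ξ r₀) (h : IsCenter Xp p A)
    (hf : IsVisibleFold Xp Xm) {φ : ℝ → ℝ} (hφ : IsTransition φ) : ∃ s > 0, s ≤ r₀ ∧
      ∀ ε > 0, ∀ (a b : ℝ) (v : ℝ → ℝ × ℝ), a ≤ b → IsSolOn (regularized Xp Xm φ ε) v (Icc a b) →
        (∀ t ∈ Icc a b, v t ∈ Metric.closedBall (0 : ℝ × ℝ) s) →
        height Xp p (v a) ≤ height Xp p (v b) ∧
          (a < b → (v a).2 < ε → height Xp p (v a) < height Xp p (v b)) := by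
  have hX := hf.locallyLipschitz_plus
  obtain ⟨Y, ρ, r, s, hY, hs, hsρ, hsr, hrr₀, hbox, hgr⟩ := hw.exists_graphs h hf
  refine ⟨s, hs, hsr.trans hrr₀, fun ε hε a b v hab hv hvs => ?_⟩
  set Z := regularized Xp Xm φ ε with hZ
  have hZL : LocallyLipschitz Z := locallyLipschitz_regularized hX hf.locallyLipschitz_minus hφ ε
  have hsub : Metric.closedBall (0 : ℝ × ℝ) s ⊆ Metric.closedBall (0 : ℝ × ℝ) r :=
    Metric.closedBall_subset_closedBall hsr
  have hρ : ∀ q ∈ Metric.closedBall (0 : ℝ × ℝ) s, q.1 ∈ Icc (-ρ) ρ := fun q hq => by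
    have := abs_le.1 (mem_closedBall_zero_prod.1 hq).1
    exact ⟨by linarith [this.1], by linarith [this.2]⟩
  have hcr : ∀ q ∈ Metric.closedBall (0 : ℝ × ℝ) r,
      (Z q).2 - (Y q).2 * (Z q).1 = (1 - φ (q.2 / ε)) / 2 *
        ((Xp q).1 * (Xm q).2 - (Xm q).1 * (Xp q).2) / (Xp q).1 := by
    intro q hq
    obtain ⟨h1, h2, -⟩ := hbox q hq
    rw [← cross_regularized, h2]
    simp only [Prod.smul_snd, smul_eq_mul]
    field_simp
    rw [hZ]
    ring
  have hcross : ∀ q ∈ Metric.closedBall (0 : ℝ × ℝ) r, (Y q).2 * (Z q).1 ≤ (Z q).2 := by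
    intro q hq
    obtain ⟨h1, h2, h3⟩ := hbox q hq
    have h4 := (hφ.mem_Icc (q.2 / ε)).2
    have : 0 ≤ (1 - φ (q.2 / ε)) / 2 * ((Xp q).1 * (Xm q).2 - (Xm q).1 * (Xp q).2) / (Xp q).1 :=
      div_nonneg (mul_nonneg (by linarith) h3.le) h1.le
    linarith [hcr q hq]
  -- Order at one abscissa is order of heights: graphs do not cross, so the comparison carries over
  -- to the abscissa where the graph of `z'` is lowest.
  have hcomp : ∀ z ∈ Metric.closedBall (0 : ℝ × ℝ) s, ∀ c, IsGraph Y ρ r c → c z.1 = z →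
      range c ⊆ leaf Xp p z → ∀ z' ∈ Metric.closedBall (0 : ℝ × ℝ) s,
      ((c z'.1).2 ≤ z'.2 → height Xp p z ≤ height Xp p z') ∧
      ((c z'.1).2 < z'.2 → height Xp p z < height Xp p z') := by
    intro z hz c hc hcz hcl z' hz'
    obtain ⟨c', hc', hcz', -, x, hx, hxh⟩ := hgr z' hz'
    have hzA : z ∈ A := h.hull_subset hX hw.mem hw.ne
      (hw.ball_subset (Metric.closedBall_subset_closedBall (hsr.trans hrr₀) hz))
    have hle := h.height_le hX hzA (hcl ⟨x, rfl⟩)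
    refine ⟨fun hlt => ?_, fun hlt => ?_⟩
    · have := IsGraph.le_of_le hY hc hc' (hρ z' hz') hx (by rwa [hcz'])
      linarith
    · have := IsGraph.lt_of_lt hY hc hc' (hρ z' hz') hx (by rwa [hcz'])
      linarith
  have hmono : ∀ a' b', a ≤ a' → a' ≤ b' → b' ≤ b →
      height Xp p (v a') ≤ height Xp p (v b') := by
    intro a' b' h1 h2 h3
    have hss : Icc a' b' ⊆ Icc a b := Icc_subset_Icc h1 h3
    have ha' := hvs a' (hss (left_mem_Icc.2 h2))
    obtain ⟨c, hc, hcz, hcl, -⟩ := hgr _ ha'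
    refine (hcomp _ ha' c hc hcz hcl _ (hvs b' (hss (right_mem_Icc.2 h2)))).1 ?_
    exact hc.le_of_cross_nonneg hY hZL.continuous hcross (hv.mono hss)
      (fun t ht => hsub (hvs t (hss ht))) (fun t ht => hρ _ (hvs t (hss ht))) (by rw [hcz]) b'
      (right_mem_Icc.2 h2)
  refine ⟨hmono a b le_rfl hab le_rfl, fun hlt hva => ?_⟩
  have ha := hvs a (left_mem_Icc.2 hab)
  obtain ⟨c, hc, hcz, hcl, -⟩ := hgr _ ha
  -- Strictness: below `y = ε` the gap to the initial graph has positive derivative at time `a`, so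
  -- it is positive at some later `t`; weak monotonicity does the rest.
  have hd : HasDerivWithinAt (fun t => (v t).2 - (c (v t).1).2)
      ((Z (v a)).2 - (Z (v a)).1 * (Y (c (v a).1)).2) (Icc a b) a := by
    have hva := hv a (left_mem_Icc.2 hab)
    have h0 : HasDerivWithinAt (fun t => (v t).2) (Z (v a)).2 (Icc a b) a := hva.snd
    have h1 : HasDerivWithinAt (fun t => (v t).1) (Z (v a)).1 (Icc a b) a := hva.fst
    have h2 : HasDerivAt (fun x => (c x).2) (Y (c (v a).1)).2 (v a).1 := (hc.hasDerivAt _).snd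
    have h3 := h2.scomp_hasDerivWithinAt a h1
    exact HasDerivWithinAt.sub h0 h3
  have hpos : 0 < (Z (v a)).2 - (Z (v a)).1 * (Y (c (v a).1)).2 := by
    rw [hcz, mul_comm, hcr _ (hsub ha)]
    obtain ⟨h1, h2, h3⟩ := hbox _ (hsub ha)
    have h4 := hφ.lt_one ((div_lt_one hε).2 hva)
    exact div_pos (mul_pos (by linarith) h3) h1
  have hd' := hd.mono_of_mem_nhdsWithin (Icc_mem_nhdsGT hlt)
  rw [hasDerivWithinAt_iff_tendsto_slope' self_notMem_Ioi] at hd'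
  obtain ⟨t, hts, ht⟩ := ((hd'.eventually_const_lt hpos).and (Ioo_mem_nhdsGT hlt)).exists
  have hsl : 0 < (v t).2 - (c (v t).1).2 := by
    rw [slope_def_field, hcz, sub_self, sub_zero] at hts
    exact (div_pos_iff_of_pos_right (by linarith [ht.1])).1 hts
  have h1 := (hcomp _ ha c hc hcz hcl _ (hvs t (Ioo_subset_Icc_self ht))).2 (by linarith)
  exact h1.trans_le (hmono t b ht.1.le ht.2.le le_rfl)

end IsFoldWindow

/-! ### Trapping and attraction in the annulus. -/

/-- `v` solves `v' = Z v` as long as it is in the square `‖q‖ ≤ R`. -/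
structure IsCurveIn (Z : ℝ × ℝ → ℝ × ℝ) (R : ℝ) (v : ℝ → ℝ × ℝ) : Prop where
  continuous : Continuous v
  hasDerivAt : ∀ t, v t ∈ Metric.closedBall (0 : ℝ × ℝ) R → HasDerivAt v (Z (v t)) t

theorem IsCurveIn.shift {Z : ℝ × ℝ → ℝ × ℝ} {R : ℝ} {v : ℝ → ℝ × ℝ} (h : IsCurveIn Z R v) (c : ℝ) :
    IsCurveIn Z R (fun t => v (t + c)) :=
  ⟨h.continuous.comp (by fun_prop), fun t ht => (h.hasDerivAt (t + c) ht).comp_add_const t c⟩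

theorem IsCurveIn.isSolOn {Z : ℝ × ℝ → ℝ × ℝ} {R : ℝ} {v : ℝ → ℝ × ℝ} (h : IsCurveIn Z R v)
    {s : Set ℝ} (hs : ∀ t ∈ s, v t ∈ Metric.closedBall (0 : ℝ × ℝ) R) : IsSolOn Z v s :=
  fun t ht => (h.hasDerivAt t (hs t ht)).hasDerivWithinAt

theorem exists_Icc_of_eventually {P : ℝ → Prop} {a : ℝ} (h : ∀ᶠ t in 𝓝 a, P t) :
    ∃ δ > 0, ∀ t ∈ Icc a (a + δ), P t := by
  obtain ⟨δ, hδ, hs⟩ := Metric.nhds_basis_closedBall.mem_iff.1 h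
  refine ⟨δ, hδ, fun t ht => hs ?_⟩
  rw [Real.closedBall_eq_Icc]
  exact ⟨by linarith [ht.1], ht.2⟩

namespace IsCenter

variable {X : ℝ × ℝ → ℝ × ℝ} {p q : ℝ × ℝ} {A : Set (ℝ × ℝ)}

theorem solution_mem_leaf (h : IsCenter X p A) (hX : LocallyLipschitz X) {v : ℝ → ℝ × ℝ} {a b : ℝ}
    (hv : IsSolOn X v (Icc a b)) (hA : v a ∈ A) (hp : v a ≠ p) :
    ∀ t ∈ Icc a b, v t ∈ leaf X p (v a) := by
  obtain ⟨γ, hγ, h0, hl, -⟩ := h.exists_periodic hX hA hp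
  intro t ht
  have := IsSolOn.eqOn_right hX hv (isSolOn_of_hasDerivAt (hγ.shift (-a)).1.1 _) (by simp [h0]) ht
  rw [this, hl]
  exact ⟨_, rfl⟩

end IsCenter

namespace IsFoldWindow

variable {Xp Xm : ℝ × ℝ → ℝ × ℝ} {p q₁ w : ℝ × ℝ} {A : Set (ℝ × ℝ)} {ξ : ℝ → ℝ} {r₀ m : ℝ}
  {φ : ℝ → ℝ} {ε μ s R : ℝ}

theorem xi_zero (hw : IsFoldWindow Xp p A q₁ ξ r₀) (hf : IsVisibleFold Xp Xm) : ξ 0 = 0 := by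
  have h0 := hw.unique 0 ⟨by linarith [hw.pos], hw.pos.le⟩ (0, 0)
    (hw.ball_subset (Metric.mem_closedBall_self hw.pos.le)) rfl hf.tangent
  exact (congrArg Prod.fst h0).symm

/-- A point of height 0 with `y ≤ 0` is the lowest point of its leaf, hence the origin. So `max
|height| y` has a positive minimum off any ball around the origin. This confines the part of the
annulus where `Z_ε ≠ X⁺` to the region where height is monotone. -/
theorem exists_height_gap (hw : IsFoldWindow Xp p A q₁ ξ r₀) (h : IsCenter Xp p A)
    (hf : IsVisibleFold Xp Xm) (hs : 0 < s) : ∃ μ > 0, ∀ q ∈ leafHull Xp p q₁,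
      |height Xp p q| < μ → q.2 < μ → q ∈ Metric.ball (0 : ℝ × ℝ) s := by
  have hX := hf.locallyLipschitz_plus
  have hc : IsCompact (leafHull Xp p q₁ \ Metric.ball (0 : ℝ × ℝ) s) :=
    (h.isCompact_hull hX hw.mem hw.ne).diff Metric.isOpen_ball
  have hcont : ContinuousOn (fun q => max |height Xp p q| q.2)
      (leafHull Xp p q₁ \ Metric.ball (0 : ℝ × ℝ) s) := by
    refine ContinuousOn.sup ?_ continuous_snd.continuousOn
    exact ((h.continuousOn_height hX hw.mem hw.ne).mono sdiff_subset).abs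
  rcases (leafHull Xp p q₁ \ Metric.ball (0 : ℝ × ℝ) s).eq_empty_or_nonempty with he | hne
  · exact ⟨1, one_pos, fun q hq _ _ => by
      by_contra hcon
      exact (he ▸ (⟨hq, hcon⟩ : q ∈ leafHull Xp p q₁ \ Metric.ball (0 : ℝ × ℝ) s) :
        q ∈ (∅ : Set (ℝ × ℝ)))⟩
  obtain ⟨z, hz, hmin⟩ := hc.exists_isMinOn hne hcont
  have hzA := h.hull_subset hX hw.mem hw.ne hz.1
  refine ⟨max |height Xp p z| z.2, ?_, fun q hq h1 h2 => ?_⟩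
  · by_contra! hle
    have h1 : |height Xp p z| ≤ 0 := (le_max_left _ _).trans hle
    have h2 : z.2 ≤ 0 := (le_max_right _ _).trans hle
    have h3 : height Xp p z = 0 := abs_nonpos_iff.1 h1
    have h4 := h.height_le_self hX hzA
    have h5 : z.2 = 0 := by linarith
    have h6 := hw.unique 0 ⟨by linarith [hw.pos], hw.pos.le⟩ z hz.1 h5
      (h.snd_field_eq_zero hX hzA (h.self_mem_leaf hX hzA) (h5.trans h3.symm))
    rw [hw.xi_zero hf] at h6
    apply hz.2
    rw [h6]
    exact Metric.mem_ball_self hs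
  · by_contra hcon
    have h3 : max |height Xp p z| z.2 ≤ max |height Xp p q| q.2 := hmin ⟨hq, hcon⟩
    exact absurd (max_lt h1 h2) (not_lt.2 h3)

theorem snd_ge_of_mem_leaf (hw : IsFoldWindow Xp p A q₁ ξ r₀) (h : IsCenter Xp p A)
    (hX : LocallyLipschitz Xp) (hm : m ∈ Icc (-r₀) r₀) (hz : w ∈ leaf Xp p (ξ m, m)) : m ≤ w.2 := by
  obtain ⟨h1, h2⟩ := hw.tangency h hX hm
  have := h.height_le hX (h.hull_subset hX hw.mem hw.ne h1) hz
  rwa [h2] at this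

theorem tangency_ne (hw : IsFoldWindow Xp p A q₁ ξ r₀) (hm : m ∈ Icc (-r₀) r₀) : (ξ m, m) ≠ p := by
  intro e
  have h1 := hw.lt_center
  rw [← e] at h1
  linarith [hm.2]

/-- For `0 < m ≤ r₀` the leaf of least height `m` is a periodic orbit of the regularization. -/
theorem exists_periodic (hw : IsFoldWindow Xp p A q₁ ξ r₀) (h : IsCenter Xp p A)
    (hX : LocallyLipschitz Xp) (hφ : IsTransition φ) (hε : ε ∈ Ioc 0 r₀) :
    ∃ γ, γ 0 = (ξ ε, ε) ∧ leaf Xp p (ξ ε, ε) = range γ ∧ IsPeriodicSol Xp γ ∧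
      IsPeriodicSol (regularized Xp Xm φ ε) γ ∧ p ∈ curveInterior (range γ) ∧
      curveInterior (range γ) ⊆ A := by
  have hm : ε ∈ Icc (-r₀) r₀ := ⟨by linarith [hε.1, hw.pos], hε.2⟩
  obtain ⟨h1, h2⟩ := hw.tangency h hX hm
  obtain ⟨γ, hγ, h0, hl, hA, hp, hi⟩ := h.exists_periodic hX
    (h.hull_subset hX hw.mem hw.ne h1) (hw.tangency_ne hm)
  refine ⟨γ, h0, hl, hγ, ⟨fun t => ?_, hγ.2⟩, hp, hi⟩
  rw [regularized_of_ge hφ hε.1 (hw.snd_ge_of_mem_leaf h hX hm (by rw [hl]; exact ⟨t, rfl⟩))]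
  exact hγ.1 t

/-- An orbit of the regularization that starts outside the tangent leaf stays in the annulus and
never moves outwards. -/
theorem mem_hull_and_height (hw : IsFoldWindow Xp p A q₁ ξ r₀) (h : IsCenter Xp p A)
    (hf : IsVisibleFold Xp Xm) (hφ : IsTransition φ)
    (hmono : ∀ (a b : ℝ) (v : ℝ → ℝ × ℝ), a ≤ b → IsSolOn (regularized Xp Xm φ ε) v (Icc a b) →
        (∀ t ∈ Icc a b, v t ∈ Metric.closedBall (0 : ℝ × ℝ) s) →
        height Xp p (v a) ≤ height Xp p (v b))
    (hgap : ∀ q ∈ leafHull Xp p q₁, |height Xp p q| < μ → q.2 < μ → q ∈ Metric.ball (0 : ℝ × ℝ) s)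
    (hR : leafHull Xp p q₁ ⊆ Metric.ball (0 : ℝ × ℝ) R) (hε : ε ∈ Ioc 0 r₀) (hεμ : ε < μ)
    {v : ℝ → ℝ × ℝ} (hv : IsCurveIn (regularized Xp Xm φ ε) R v) (hv0 : v 0 ∈ leafHull Xp p q₁)
    (h1 : -μ < height Xp p (v 0)) (h1' : -r₀ < height Xp p (v 0)) (h2 : height Xp p (v 0) < ε) :
    ∀ t, 0 ≤ t → v t ∈ leafHull Xp p q₁ ∧ height Xp p (v 0) ≤ height Xp p (v t) ∧
      height Xp p (v t) < ε := by
  have hX := hf.locallyLipschitz_plus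
  have hZL := locallyLipschitz_regularized hX hf.locallyLipschitz_minus hφ ε
  have hcont := h.continuousOn_height hX hw.mem hw.ne
  have hcomp := h.isCompact_hull hX hw.mem hw.ne
  have hεI : ε ∈ Icc (-r₀) r₀ := ⟨by linarith [hε.1, hw.pos], hε.2⟩
  obtain ⟨γ, hγ0, hγl, -, hγ, -⟩ := hw.exists_periodic h hX hφ hε (Xm := Xm)
  -- Height `ε` means lying on the tangent leaf, a periodic orbit of `Z_ε`; uniqueness backwards in
  -- time would put the starting point on it too.
  have hne : ∀ T, 0 ≤ T → (∀ t ∈ Icc 0 T, v t ∈ leafHull Xp p q₁) → height Xp p (v T) ≠ ε := by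
    intro T hT hmem he
    have hvl := hw.leaf_eq h hX hεI (hmem T (right_mem_Icc.2 hT)) he
    have hvT : v T ∈ range γ := by
      rw [← hγl, ← hvl]
      exact h.self_mem_leaf hX (h.hull_subset hX hw.mem hw.ne (hmem T (right_mem_Icc.2 hT)))
    obtain ⟨τ, hτ⟩ := hvT
    have hsol : IsSolOn (regularized Xp Xm φ ε) v (Icc 0 T) :=
      hv.isSolOn fun t ht => Metric.ball_subset_closedBall (hR (hmem t ht))
    have he := IsSolOn.eqOn_left hZL hsol (isSolOn_of_hasDerivAt (hγ.shift (τ - T)).1.1 _)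
      (by simp [hτ]) (left_mem_Icc.2 hT)
    have hv0l : v 0 ∈ leaf Xp p (ξ ε, ε) := by
      rw [hγl, he]
      exact ⟨_, rfl⟩
    obtain ⟨h3, h4⟩ := hw.tangency h hX hεI
    have := h.height_eq_of_mem hX (h.hull_subset hX hw.mem hw.ne h3) hv0l
    linarith
  set S := leafHull Xp p q₁ ∩ height Xp p ⁻¹' Icc (height Xp p (v 0)) ε with hS
  have hSc : IsClosed S := hcont.preimage_isClosed_of_isClosed hcomp.isClosed isClosed_Icc
  have hall : ∀ t, 0 ≤ t → v t ∈ S := by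
    by_contra! hcon
    obtain ⟨T, hT0, hT, hfr⟩ := exists_exit_time hv.continuous hSc ⟨hv0, le_rfl, h2.le⟩ hcon
    have hTS := hT T (right_mem_Icc.2 hT0)
    have hlt : height Xp p (v T) < ε :=
      lt_of_le_of_ne hTS.2.2 (hne T hT0 fun t ht => (hT t ht).1)
    have hins := h.mem_inside_of_height_lt hX hw.mem hTS.1
      (by linarith [hw.height_lt, hTS.2.1])
    have ev1 : ∀ᶠ t in 𝓝 T, v t ∈ leafHull Xp p q₁ := by
      have := hv.continuous.continuousAt.eventually_mem
        (((h.isNestedFoliation hX).isOpen_inside hw.mem hw.ne).mem_nhds hins)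
      filter_upwards [this] with t ht using Or.inl ht
    have ev2 : ∀ᶠ t in 𝓝 T, height Xp p (v t) < ε := by
      have : Tendsto v (𝓝 T) (𝓝[leafHull Xp p q₁] (v T)) :=
        tendsto_nhdsWithin_iff.2 ⟨hv.continuous.tendsto T, ev1⟩
      exact ((hcont _ hTS.1).tendsto.comp this).eventually_lt_const hlt
    have ev3 : ∃ δ > 0, ∀ t ∈ Icc T (T + δ), height Xp p (v T) ≤ height Xp p (v t) := by
      have evR : ∀ᶠ t in 𝓝 T, v t ∈ Metric.closedBall (0 : ℝ × ℝ) R := by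
        filter_upwards [ev1] with t ht using Metric.ball_subset_closedBall (hR ht)
      -- Near the fold height is monotone; elsewhere the gap lemma gives `y > ε`, where the curve
      -- follows a leaf of `X⁺` and height is constant.
      by_cases hb : v T ∈ Metric.ball (0 : ℝ × ℝ) s
      · obtain ⟨δ, hδ, hδs⟩ := exists_Icc_of_eventually (evR.and
          (hv.continuous.continuousAt.eventually_mem (Metric.isOpen_ball.mem_nhds hb)))
        refine ⟨δ, hδ, fun t ht => hmono T t v ht.1 (hv.isSolOn fun r hr => ?_) fun r hr => ?_⟩
        · exact (hδs r ⟨hr.1, hr.2.trans ht.2⟩).1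
        · exact Metric.ball_subset_closedBall (hδs r ⟨hr.1, hr.2.trans ht.2⟩).2
      · have hy : ε < (v T).2 := by
          by_contra! hle
          refine hb (hgap _ hTS.1 ?_ (hle.trans_lt hεμ))
          rw [abs_lt]
          exact ⟨by linarith [hTS.2.1], by linarith⟩
        obtain ⟨δ, hδ, hδs⟩ := exists_Icc_of_eventually (evR.and
          ((continuous_snd.comp hv.continuous).continuousAt.eventually_const_lt hy))
        refine ⟨δ, hδ, fun t ht => ?_⟩
        have hsol : IsSolOn Xp v (Icc T t) := by
          refine (hv.isSolOn fun r hr => (hδs r ⟨hr.1, hr.2.trans ht.2⟩).1).congr_field fun r hr => ?_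
          exact regularized_of_ge hφ hε.1 (hδs r ⟨hr.1, hr.2.trans ht.2⟩).2.le
        have hTA := h.hull_subset hX hw.mem hw.ne hTS.1
        have hTp : v T ≠ p := fun e => by
          rw [e, IsCenter.height_center] at hlt
          linarith [hw.lt_center, hε.2]
        have := h.solution_mem_leaf hX hsol hTA hTp t (right_mem_Icc.2 ht.1)
        exact (h.height_eq_of_mem hX hTA this).ge
    obtain ⟨δ, hδ, hδs⟩ := ev3
    refine hfr ?_
    filter_upwards [mem_nhdsWithin_of_mem_nhds ev1, mem_nhdsWithin_of_mem_nhds ev2,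
      Ioo_mem_nhdsGT (show T < T + δ by linarith)] with t e1 e2 e3
    exact not_not.2 ⟨e1, hTS.2.1.trans (hδs t ⟨e3.1.le, e3.2.le⟩), e2.le⟩
  intro t ht
  have h3 := hall t ht
  exact ⟨h3.1, h3.2.1, lt_of_le_of_ne h3.2.2 (hne t ht fun r hr => (hall r hr.1).1)⟩

/-- The tangent leaf attracts the orbits of the regularization in the annulus around it. -/
theorem exists_attracted (hw : IsFoldWindow Xp p A q₁ ξ r₀) (h : IsCenter Xp p A)
    (hf : IsVisibleFold Xp Xm) (hφ : IsTransition φ) :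
    ∃ μ > 0, μ ≤ r₀ ∧ ∀ ε ∈ Ioo 0 μ, ∀ q ∈ leafHull Xp p q₁, -μ < height Xp p q →
      height Xp p q < ε → IsAttracted (regularized Xp Xm φ ε) q (leaf Xp p (ξ ε, ε)) := by
  have hX := hf.locallyLipschitz_plus
  have hcont := h.continuousOn_height hX hw.mem hw.ne
  have hcomp := h.isCompact_hull hX hw.mem hw.ne
  have hKA := h.hull_subset hX hw.mem hw.ne
  obtain ⟨s, hs, -, hmono⟩ := hw.exists_height_monotone h hf hφ
  obtain ⟨μ₀, hμ₀, hgap₀⟩ := hw.exists_height_gap h hf hs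
  set μ := min μ₀ r₀ with hμ
  have hμ0 : 0 < μ := lt_min hμ₀ hw.pos
  have hμr : μ ≤ r₀ := min_le_right _ _
  have hgap : ∀ q ∈ leafHull Xp p q₁, |height Xp p q| < μ → q.2 < μ →
      q ∈ Metric.ball (0 : ℝ × ℝ) s := fun q hq e1 e2 =>
    hgap₀ q hq (e1.trans_le (min_le_left _ _)) (e2.trans_le (min_le_left _ _))
  refine ⟨μ, hμ0, hμr, fun ε hε q hq hq1 hq2 => ?_⟩
  set Z := regularized Xp Xm φ ε with hZ
  have hZL : LocallyLipschitz Z := locallyLipschitz_regularized hX hf.locallyLipschitz_minus hφ ε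
  have hε' : ε ∈ Ioc 0 r₀ := ⟨hε.1, hε.2.le.trans hμr⟩
  have hεI : ε ∈ Icc (-r₀) r₀ := ⟨by linarith [hε.1, hw.pos], hε'.2⟩
  obtain ⟨R, hR⟩ := hcomp.isBounded.subset_ball (0 : ℝ × ℝ)
  have hRc : ∀ z ∈ leafHull Xp p q₁, z ∈ Metric.closedBall (0 : ℝ × ℝ) R :=
    fun z hz => Metric.ball_subset_closedBall (hR hz)
  have trap : ∀ v, IsCurveIn Z R v → v 0 ∈ leafHull Xp p q₁ → -μ < height Xp p (v 0) →
      height Xp p (v 0) < ε → ∀ t, 0 ≤ t → v t ∈ leafHull Xp p q₁ ∧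
      height Xp p (v 0) ≤ height Xp p (v t) ∧ height Xp p (v t) < ε := fun v hv hv0 e1 e2 =>
    hw.mem_hull_and_height h hf hφ (fun a b v hab hv hvs => (hmono ε hε.1 a b v hab hv hvs).1) hgap
      hR hε' hε.2 hv hv0 e1 (by linarith) e2
  obtain ⟨v, hv0, hvc, hvd⟩ := hZL.exists_curve R q
  have hv : IsCurveIn Z R v := ⟨hvc, hvd⟩
  have hvK := trap v hv (hv0 ▸ hq) (hv0 ▸ hq1) (hv0 ▸ hq2)
  have hincr : ∀ a b, 0 ≤ a → a ≤ b → height Xp p (v a) ≤ height Xp p (v b) := by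
    intro a b ha hab
    have h3 := hvK a ha
    rw [hv0] at h3
    have := (trap _ (hv.shift a) (by simpa using h3.1) (by simp; linarith [h3.2.1])
      (by simpa using h3.2.2) (b - a) (by linarith)).2.1
    simpa using this
  set g : ℕ → ℝ := fun n => height Xp p (v n) with hg
  have hgm : Monotone g := fun i j hij => hincr _ _ (Nat.cast_nonneg i) (by exact_mod_cast hij)
  have hgb : BddAbove (range g) := ⟨ε, by
    rintro _ ⟨n, rfl⟩
    exact (hvK n (Nat.cast_nonneg n)).2.2.le⟩
  have hgl := tendsto_atTop_ciSup hgm hgb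
  set l := ⨆ n, g n with hl
  have hgle : ∀ n, g n ≤ l := fun n => le_ciSup hgb n
  have hlε : l ≤ ε := ciSup_le fun n => (hvK n (Nat.cast_nonneg n)).2.2.le
  -- LaSalle's argument: the orbit `z` of a limit point `w` is a limit of time shifts of `v`, so it
  -- has constant height `l`.
  have hleq : l = ε := by
    by_contra hne
    have hlt : l < ε := lt_of_le_of_ne hlε hne
    obtain ⟨w, hwK, ψ, hψ, hψw⟩ := hcomp.tendsto_subseq
      (fun n : ℕ => (hvK n (Nat.cast_nonneg n)).1)
    obtain ⟨z, hz0, hzc, hzd⟩ := hZL.exists_curve R w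
    have hz : IsCurveIn Z R z := ⟨hzc, hzd⟩
    have hlim : ∀ (u : ℕ → ℝ × ℝ) (w' : ℝ × ℝ), (∀ n, u n ∈ leafHull Xp p q₁) →
        w' ∈ leafHull Xp p q₁ → Tendsto u atTop (𝓝 w') →
        Tendsto (fun n => height Xp p (u n)) atTop (𝓝 (height Xp p w')) :=
      fun u w' hu hw' ht => (hcont w' hw').tendsto.comp
        (tendsto_nhdsWithin_iff.2 ⟨ht, Eventually.of_forall hu⟩)
    have hwl : height Xp p w = l :=
      tendsto_nhds_unique (hlim _ w (fun n => (hvK _ (Nat.cast_nonneg _)).1) hwK hψw)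
        (hgl.comp hψ.tendsto_atTop)
    have hml : -μ < l := by
      have := hgle 0
      simp only [hg, Nat.cast_zero, hv0] at this
      linarith
    have hzK := trap z hz (hz0 ▸ hwK) (by rw [hz0, hwl]; exact hml) (by rw [hz0, hwl]; exact hlt)
    have hzsol : ∀ a b, 0 ≤ a → IsSolOn Z z (Icc a b) := fun a b ha =>
      hz.isSolOn fun t ht => hRc _ (hzK t (ha.trans ht.1)).1
    have hzl : ∀ T, 0 ≤ T → height Xp p (z T) = l := by
      intro T hT
      have htend : Tendsto (fun n : ℕ => v (T + (ψ n : ℝ))) atTop (𝓝 (z T)) := by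
        rw [Metric.tendsto_nhds]
        intro δ hδ
        have hn := (hzsol 0 T le_rfl).exists_nearby hZL hδ
        rw [hz0] at hn
        filter_upwards [hψw.eventually hn] with n hn
        obtain ⟨u, hu0, hu, hud⟩ := hn
        have hvs : IsSolOn Z (fun t => v (t + (ψ n : ℝ))) (Icc 0 T) :=
          (hv.shift _).isSolOn fun t ht => hRc _ (hvK _ (add_nonneg ht.1 (Nat.cast_nonneg _))).1
        have := IsSolOn.eqOn_right hZL hu hvs (by simp [hu0]) (right_mem_Icc.2 hT)
        simp only at this
        rw [← this]
        exact hud T (right_mem_Icc.2 hT)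
      have h1 := hlim _ _ (fun n => (hvK _ (add_nonneg hT (Nat.cast_nonneg _))).1) (hzK T hT).1 htend
      refine le_antisymm (le_of_tendsto h1 (Eventually.of_forall fun n => ?_)) ?_
      · refine (hincr _ (⌈T + (ψ n : ℝ)⌉₊ : ℝ) (by positivity) (Nat.le_ceil _)).trans ?_
        exact hgle ⌈T + (ψ n : ℝ)⌉₊
      · have := (hzK T hT).2.1
        rwa [hz0, hwl] at this
    have hwA := hKA hwK
    have hwp : w ≠ p := fun e => by
      rw [e, IsCenter.height_center] at hwl
      linarith [hw.lt_center, hε'.2]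
    -- If `z` stayed in `y ≥ ε` it would be the `X⁺`-orbit of `w` and would reach its lowest point,
    -- at level `l < ε`.
    obtain ⟨t₁, ht₁, hy⟩ : ∃ t, 0 ≤ t ∧ (z t).2 < ε := by
      by_contra! hcon
      obtain ⟨γ, hγ, hγ0, hγl, -⟩ := h.exists_periodic hX hwA hwp
      obtain ⟨x, hx, hxh⟩ := h.exists_height_eq hX hwA
      rw [hγl] at hx
      obtain ⟨τ, hτ, rfl⟩ := hγ.exists_nonneg hx
      have hzX : IsSolOn Xp z (Icc 0 τ) := (hzsol 0 τ le_rfl).congr_field fun t ht =>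
        regularized_of_ge hφ hε.1 (hcon t ht.1)
      have := IsSolOn.eqOn_right hX hzX (isSolOn_of_hasDerivAt hγ.1 _) (by rw [hz0, hγ0])
        (right_mem_Icc.2 hτ)
      have h3 := hcon τ hτ
      rw [this, hxh, hwl] at h3
      linarith
    have hzb : z t₁ ∈ Metric.ball (0 : ℝ × ℝ) s := by
      refine hgap _ (hzK t₁ ht₁).1 ?_ (hy.trans hε.2)
      rw [hzl t₁ ht₁, abs_lt]
      exact ⟨hml, hlt.trans hε.2⟩
    obtain ⟨δ, hδ, hδs⟩ := exists_Icc_of_eventually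
      (hzc.continuousAt.eventually_mem (Metric.isOpen_ball.mem_nhds hzb))
    have := (hmono ε hε.1 t₁ (t₁ + δ) z (by linarith) (hzsol _ _ ht₁)
      (fun t ht => Metric.ball_subset_closedBall (hδs t ht))).2 (by linarith) hy
    rw [hzl t₁ ht₁, hzl (t₁ + δ) (by linarith)] at this
    exact lt_irrefl _ this
  refine ⟨v, hv0, fun t ht => ?_, ?_⟩
  · exact (hvd t (hRc _ (hvK t ht).1)).hasDerivWithinAt
  have hinf : Continuous fun z => Metric.infDist z (leaf Xp p (ξ ε, ε)) := Metric.continuous_infDist_pt _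
  rw [Metric.tendsto_nhds]
  intro η hη
  -- On this compact set of points away from the tangent leaf the height stays below some `M < ε`,
  -- because height `ε` occurs only on that leaf.
  set S := (leafHull Xp p q₁ ∩ height Xp p ⁻¹' Iic ε) ∩
    {z | η ≤ Metric.infDist z (leaf Xp p (ξ ε, ε))} with hS
  have hSc : IsCompact S := by
    refine IsCompact.inter_right ?_ (isClosed_le continuous_const hinf)
    exact hcomp.of_isClosed_subset
      (hcont.preimage_isClosed_of_isClosed hcomp.isClosed isClosed_Iic) inter_subset_left
  have hM : ∃ M < ε, ∀ z ∈ S, height Xp p z ≤ M := by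
    rcases S.eq_empty_or_nonempty with he | hne
    · exact ⟨ε - 1, by linarith, fun z hz => by rw [he] at hz; exact hz.elim⟩
    obtain ⟨z, hz, hmax⟩ := hSc.exists_isMaxOn hne
      (hcont.mono fun z hz => hz.1.1)
    refine ⟨height Xp p z, lt_of_le_of_ne hz.1.2 fun he => ?_, fun z' hz' => hmax hz'⟩
    have hle := hw.leaf_eq h hX hεI hz.1.1 he
    have hzl : z ∈ leaf Xp p (ξ ε, ε) := hle ▸ h.self_mem_leaf hX (hKA hz.1.1)
    have h3 : η ≤ Metric.infDist z (leaf Xp p (ξ ε, ε)) := hz.2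
    rw [Metric.infDist_zero_of_mem hzl] at h3
    linarith
  obtain ⟨M, hMε, hM⟩ := hM
  rw [hleq] at hgl
  obtain ⟨n, hn⟩ := (hgl.eventually_const_lt hMε).exists
  filter_upwards [eventually_ge_atTop (n : ℝ)] with t ht
  have ht0 : 0 ≤ t := (Nat.cast_nonneg n).trans ht
  have h3 := hvK t ht0
  rw [Real.dist_eq, sub_zero, abs_of_nonneg Metric.infDist_nonneg]
  by_contra! hcon
  have h4 := hM (v t) ⟨⟨h3.1, h3.2.2.le⟩, hcon⟩
  have h5 := hincr n t (Nat.cast_nonneg n) ht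
  simp only [hg] at hn
  linarith

end IsFoldWindow

/-! ### Concatenation of orbit segments. -/

theorem IsSolOn.union_of_isClosed {Z : ℝ × ℝ → ℝ × ℝ} {v : ℝ → ℝ × ℝ} {s s' : Set ℝ}
    (h : IsSolOn Z v s) (h' : IsSolOn Z v s') (hs : IsClosed s) (hs' : IsClosed s') :
    IsSolOn Z v (s ∪ s') := by
  have key : ∀ {s : Set ℝ}, IsClosed s → IsSolOn Z v s → ∀ t, HasDerivWithinAt v (Z (v t)) s t := by
    intro s hs h t
    by_cases ht : t ∈ s
    · exact h t ht
    · exact HasFDerivWithinAt.of_notMem_closure (by rwa [hs.closure_eq])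
  exact fun t _ => (key hs h t).union (key hs' h' t)

theorem IsSolOn.exists_concat {Z : ℝ × ℝ → ℝ × ℝ} {v u : ℝ → ℝ × ℝ} {T : ℝ} {s : Set ℝ}
    (hT : 0 ≤ T) (hv : IsSolOn Z v (Icc 0 T)) (hs : IsClosed s) (hs0 : s ⊆ Ici 0)
    (hu : IsSolOn Z u s) (h : u 0 = v T) : ∃ w : ℝ → ℝ × ℝ, w 0 = v 0 ∧
      (∀ t, T ≤ t → w t = u (t - T)) ∧ IsSolOn Z w (Icc 0 T ∪ (fun t => t - T) ⁻¹' s) := by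
  set w : ℝ → ℝ × ℝ := fun t => if t ≤ T then v t else u (t - T) with hw
  have h1 : ∀ t, t ≤ T → w t = v t := fun t ht => if_pos ht
  have h2 : ∀ t, T ≤ t → w t = u (t - T) := by
    intro t ht
    rcases ht.eq_or_lt with rfl | hlt
    · rw [h1 _ le_rfl, sub_self, h]
    · exact if_neg (not_le.2 hlt)
  refine ⟨w, h1 0 hT, h2, IsSolOn.union_of_isClosed ?_ ?_ isClosed_Icc
    (hs.preimage (by fun_prop))⟩
  · intro t ht
    rw [h1 t ht.2]
    exact (hv t ht).congr (fun x hx => h1 x hx.2) (h1 t ht.2)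
  · have h3 : ∀ t ∈ (fun t => t - T) ⁻¹' s, T ≤ t := fun t ht => by
      have := hs0 ht
      simpa using this
    have h4 : IsSolOn Z (fun t => u (t + -T)) ((fun t => t - T) ⁻¹' s) :=
      hu.shift (-T) fun t ht => by simpa [sub_eq_add_neg] using ht
    intro t ht
    rw [h2 t (h3 t ht)]
    exact (h4 t ht).congr (fun x hx => h2 x (h3 x hx)) (h2 t (h3 t ht))

/-- Some forward orbit segment of `Z` leads from `q` to `B`. -/
def Reaches (Z : ℝ × ℝ → ℝ × ℝ) (q : ℝ × ℝ) (B : Set (ℝ × ℝ)) : Prop :=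
  ∃ (T : ℝ) (v : ℝ → ℝ × ℝ), 0 ≤ T ∧ v 0 = q ∧ IsSolOn Z v (Icc 0 T) ∧ v T ∈ B

theorem Reaches.of_mem {Z : ℝ × ℝ → ℝ × ℝ} {q : ℝ × ℝ} {B : Set (ℝ × ℝ)} (h : q ∈ B) :
    Reaches Z q B := by
  refine ⟨0, fun _ => q, le_rfl, rfl, fun t _ => ?_, h⟩
  rw [Icc_self]
  exact HasFDerivWithinAt.of_finite (finite_singleton _)

theorem Reaches.trans {Z : ℝ × ℝ → ℝ × ℝ} {q : ℝ × ℝ} {B B' : Set (ℝ × ℝ)} (h : Reaches Z q B)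
    (h' : ∀ w ∈ B, Reaches Z w B') : Reaches Z q B' := by
  obtain ⟨T, v, hT, hv0, hv, hvT⟩ := h
  obtain ⟨T', u, hT', hu0, hu, huT⟩ := h' _ hvT
  obtain ⟨w, hw0, hwT, hw⟩ := hv.exists_concat hT isClosed_Icc (fun t ht => ht.1) hu hu0
  refine ⟨T + T', w, by linarith, hw0.trans hv0, hw.mono fun t ht => ?_, ?_⟩
  · rcases le_total t T with hle | hle
    · exact Or.inl ⟨ht.1, hle⟩
    · exact Or.inr ⟨by linarith, by linarith [ht.2]⟩
  · rw [hwT _ (by linarith), add_sub_cancel_left]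
    exact huT

theorem Reaches.isAttracted {Z : ℝ × ℝ → ℝ × ℝ} {q : ℝ × ℝ} {B Γ : Set (ℝ × ℝ)}
    (h : Reaches Z q B) (h' : ∀ w ∈ B, IsAttracted Z w Γ) : IsAttracted Z q Γ := by
  obtain ⟨T, v, hT, hv0, hv, hvT⟩ := h
  obtain ⟨u, hu0, hu, hlim⟩ := h' _ hvT
  obtain ⟨w, hw0, hwT, hw⟩ := hv.exists_concat hT isClosed_Ici subset_rfl hu hu0
  refine ⟨w, hw0.trans hv0, hw.mono fun t ht => ?_, ?_⟩
  · rcases le_total t T with hle | hle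
    · exact Or.inl ⟨ht, hle⟩
    · exact Or.inr (by simpa using hle)
  · have h1 : Tendsto (fun t => t - T) atTop atTop := tendsto_atTop_add_const_right _ _ tendsto_id
    refine (hlim.comp h1).congr' ?_
    filter_upwards [eventually_ge_atTop T] with t ht
    simp [hwT t ht]

/-! ### From the sliding segment to the fold. -/

theorem eventually_lt_of_hasDerivAt_neg {f : ℝ → ℝ} {f' t₀ : ℝ} (h : HasDerivAt f f' t₀)
    (hf : f' < 0) : ∀ᶠ t in 𝓝[>] t₀, f t < f t₀ := by
  have hd := h.hasDerivWithinAt (s := Ioi t₀)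
  rw [hasDerivWithinAt_iff_tendsto_slope' self_notMem_Ioi] at hd
  filter_upwards [hd.eventually_lt_const hf, self_mem_nhdsWithin] with t ht htt
  rw [slope_def_field, div_neg_iff] at ht
  have htt' : t₀ < t := htt
  rcases ht with ht | ht <;> linarith [ht.1, ht.2]

theorem eventually_gt_of_hasDerivAt_pos {f : ℝ → ℝ} {f' t₀ : ℝ} (h : HasDerivAt f f' t₀)
    (hf : 0 < f') : ∀ᶠ t in 𝓝[>] t₀, f t₀ < f t := by
  filter_upwards [eventually_lt_of_hasDerivAt_neg h.neg (neg_lt_zero.2 hf)] with t ht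
  exact neg_lt_neg_iff.1 ht

theorem exists_strip_subset {a b : ℝ} {O : Set (ℝ × ℝ)} (hO : IsOpen O)
    (h : ∀ x ∈ Icc a b, (x, (0 : ℝ)) ∈ O) : ∃ η > 0, ∀ q : ℝ × ℝ,
      a - η ≤ q.1 → q.1 ≤ b + η → |q.2| ≤ η → a ≤ b → q ∈ O := by
  have hc : IsCompact (Icc a b ×ˢ ({0} : Set ℝ)) := isCompact_Icc.prod isCompact_singleton
  obtain ⟨η, hη, hs⟩ := hc.exists_cthickening_subset_open hO (by
    rintro ⟨x, y⟩ ⟨hx, hy⟩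
    rw [mem_singleton_iff] at hy
    simp only at hx hy
    rw [hy]
    exact h x hx)
  refine ⟨η, hη, fun q h1 h2 h3 hab => hs ?_⟩
  refine Metric.mem_cthickening_of_dist_le q (max a (min q.1 b), 0) η _
    ⟨⟨le_max_left _ _, max_le hab (min_le_right _ _)⟩, rfl⟩ ?_
  rw [Prod.dist_eq, max_le_iff, Real.dist_eq, Real.dist_eq, sub_zero]
  refine ⟨?_, h3⟩
  rw [abs_le]
  rcases le_total q.1 a with e1 | e1
  · rw [max_eq_left (min_le_of_left_le e1)]
    constructor <;> linarith
  · rcases le_total q.1 b with e2 | e2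
    · rw [min_eq_left e2, max_eq_right e1]
      constructor <;> linarith
    · rw [min_eq_right e2, max_eq_right hab]
      constructor <;> linarith

namespace IsVisibleFold

variable {Xp Xm : ℝ × ℝ → ℝ × ℝ} {φ : ℝ → ℝ} {M δ : ℝ}

/-- Along a sliding segment the regularization moves to the right until it is near the fold. -/
theorem exists_reaches_of_slidesRight (hf : IsVisibleFold Xp Xm) (hφ : IsTransition φ) (hM : 0 ≤ M)
    (hsl : ∀ x ∈ Icc (-M) 0, SlidesRight Xp Xm x) (hδ : 0 < δ) :
    ∃ G, IsOpen G ∧ Icc (-M) 0 ×ˢ {(0 : ℝ)} ⊆ G ∧ ∀ᶠ ε in 𝓝[>] (0 : ℝ), ∀ q ∈ G,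
      Reaches (regularized Xp Xm φ ε) q (Metric.ball 0 δ) := by
  have hXp := hf.locallyLipschitz_plus
  have hXm := hf.locallyLipschitz_minus
  have hXpc := hXp.continuous
  have hXmc := hXm.continuous
  set a : ℝ → ℝ := fun x => (Xm (x, 0)).1 - (Xp (x, 0)).1 with ha
  set b : ℝ → ℝ := fun x => (Xm (x, 0)).2 - (Xp (x, 0)).2 with hb
  have haC : ContDiff ℝ 1 a := by
    have h1 : ContDiff ℝ 1 Xm := hf.contDiff_minus.of_le (by norm_num)
    have h2 : ContDiff ℝ 1 Xp := hf.contDiff_plus.of_le (by norm_num)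
    simp only [ha]
    fun_prop
  have ha' : Continuous (deriv a) := haC.continuous_deriv (by norm_num)
  have had : ∀ x, HasDerivAt a (deriv a x) x := fun x =>
    (haC.differentiable (by norm_num) x).hasDerivAt
  have hac : Continuous a := haC.continuous
  have hbc : Continuous b := by fun_prop
  set I : ℝ → ℝ := fun x => ∫ t in (0 : ℝ)..x, b t with hI
  have hId : ∀ x, HasDerivAt I (b x) x := fun x => hbc.integral_hasStrictDerivAt 0 x |>.hasDerivAt
  have hIc : Continuous I := continuous_iff_continuousAt.2 fun x => (hId x).continuousAt
  -- This is the derivative along `X` of `L = I(x) - a(x) y`. On `y = 0` it equals the sliding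
  -- determinant for both `X⁺` and `X⁻`; being linear in the field, it is positive along `Z_ε` in a
  -- strip independent of `ε`.
  set Ψ : (ℝ × ℝ → ℝ × ℝ) → ℝ × ℝ → ℝ := fun X q =>
    (b q.1 - deriv a q.1 * q.2) * (X q).1 + -a q.1 * (X q).2 with hΨ
  have hΨc : ∀ X : ℝ × ℝ → ℝ × ℝ, Continuous X → Continuous (Ψ X) := by
    intro X hX
    simp only [hΨ]
    fun_prop
  have hΨp := hΨc _ hXpc
  have hΨm := hΨc _ hXmc
  set O : Set (ℝ × ℝ) := {q | 0 < Ψ Xp q ∧ 0 < Ψ Xm q ∧ 0 < b q.1 ∧ 0 < (Xm q).2} with hO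
  have hOo : IsOpen O := by
    refine (isOpen_lt continuous_const hΨp).inter ((isOpen_lt continuous_const hΨm).inter
      ((isOpen_lt continuous_const (hbc.comp continuous_fst)).inter
        (isOpen_lt continuous_const (continuous_snd.comp hXmc))))
  obtain ⟨η₁, hη₁, hstrip⟩ := exists_strip_subset (a := -M) (b := 0) hOo (by
    intro x hx
    obtain ⟨h1, h2⟩ := hsl x hx
    have h3 : (Xp (x, 0)).2 ≤ 0 := by
      rcases hx.2.lt_or_eq with hlt | rfl
      · exact (hf.down x hlt).le
      · exact hf.tangent.le
    refine ⟨?_, ?_, ?_, h1⟩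
    · simp only [hΨ, ha, hb]
      linarith
    · simp only [hΨ, ha, hb]
      linarith
    · simp only [hb]
      linarith)
  obtain ⟨η₂, hη₂, hstrip₂⟩ := exists_strip_subset (a := -M - η₁) (b := -(δ / 2))
    (isOpen_lt (continuous_snd.comp hXpc) continuous_const) (fun x hx =>
      hf.down x (by linarith [hx.2]))
  have hb0 : ∀ x ∈ Icc (-M - η₁) 0, 0 < b x := fun x hx =>
    (hstrip (x, 0) hx.1 (by linarith [hx.2]) (by simp [hη₁.le]) (by linarith)).2.2.1
  have hImono : StrictMonoOn I (Icc (-M - η₁) 0) := by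
    refine strictMonoOn_of_deriv_pos (convex_Icc _ _) hIc.continuousOn fun x hx => ?_
    rw [(hId x).deriv]
    exact hb0 x (interior_subset hx)
  have hgap : 0 < I (-M - η₁ / 2) - I (-M - η₁) :=
    sub_pos.2 (hImono ⟨le_rfl, by linarith⟩ ⟨by linarith, by linarith⟩ (by linarith))
  set g := I (-M - η₁ / 2) - I (-M - η₁) with hg
  obtain ⟨Am, hAm⟩ := (isCompact_Icc (a := -M - η₁) (b := 0)).exists_bound_of_continuousOn
    hac.continuousOn
  have hAm0 : 0 ≤ Am := (norm_nonneg _).trans (hAm 0 ⟨by linarith, le_rfl⟩)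
  -- The last bound makes the total variation of `a y`, at most `2 Am η`, smaller than `g`, so
  -- growth of `L` prevents an exit through the left side.
  obtain ⟨η, hη, hη'⟩ : ∃ η, 0 < η ∧ η < min (min η₁ η₂) (min (δ / 2) (g / (2 * (Am + 1)))) :=
    exists_between (by simp only [lt_min_iff]; refine ⟨⟨?_, ?_⟩, ?_, ?_⟩ <;> positivity)
  simp only [lt_min_iff] at hη'
  obtain ⟨⟨hηη₁, hηη₂⟩, hηδ, hηg⟩ := hη'
  rw [lt_div_iff₀ (by positivity)] at hηg
  -- Orbits leave this box, since `L` grows at a positive rate, and only on the right: `Z_ε = X⁺`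
  -- points down on the top side and `Z_ε = X⁻` points up on the bottom side.
  set Q : Set (ℝ × ℝ) := Icc (-M - η₁) (-(δ / 2)) ×ˢ Icc (-η) η with hQ
  have hQc : IsCompact Q := isCompact_Icc.prod isCompact_Icc
  have hQO : ∀ q ∈ Q, 0 < Ψ Xp q ∧ 0 < Ψ Xm q ∧ 0 < b q.1 ∧ 0 < (Xm q).2 := fun q hq =>
    hstrip q hq.1.1 (by linarith [hq.1.2]) ((abs_le.2 hq.2).trans hηη₁.le) (by linarith)
  have hQd : ∀ q ∈ Q, (Xp q).2 < 0 := fun q hq =>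
    hstrip₂ q (by linarith [hq.1.1]) (by linarith [hq.1.2]) ((abs_le.2 hq.2).trans hηη₂.le)
      (hq.1.1.trans hq.1.2)
  refine ⟨Ioo (-M - η₁ / 2) δ ×ˢ Ioo (-η) η, isOpen_Ioo.prod isOpen_Ioo, ?_, ?_⟩
  · rintro ⟨x, y⟩ ⟨hx, hy⟩
    rw [mem_singleton_iff] at hy
    simp only at hx hy
    rw [hy]
    exact ⟨⟨by linarith [hx.1], by linarith [hx.2]⟩, ⟨by linarith, hη⟩⟩
  filter_upwards [Ioo_mem_nhdsGT hη] with ε hε q hq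
  set Z := regularized Xp Xm φ ε with hZ
  have hZL : LocallyLipschitz Z := locallyLipschitz_regularized hXp hXm hφ ε
  rcases le_or_gt (-(δ / 2)) q.1 with hq1 | hq1
  · refine Reaches.of_mem ?_
    rw [mem_ball_zero_iff, Prod.norm_def, max_lt_iff, Real.norm_eq_abs, Real.norm_eq_abs, abs_lt,
      abs_lt]
    exact ⟨⟨by linarith, hq.1.2⟩, ⟨by linarith [hq.2.1], by linarith [hq.2.2]⟩⟩
  have hqQ : q ∈ Q := ⟨⟨by linarith [hq.1.1], hq1.le⟩, Ioo_subset_Icc_self hq.2⟩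
  obtain ⟨z, hz, hmin⟩ := hQc.exists_isMinOn ⟨q, hqQ⟩ (hΨp.min hΨm).continuousOn
  set c := min (Ψ Xp z) (Ψ Xm z) with hc
  have hc0 : 0 < c := lt_min (hQO z hz).1 (hQO z hz).2.1
  have hΨZ : ∀ q ∈ Q, c ≤ Ψ Z q := fun q hq => by
    have h1 : c ≤ min (Ψ Xp q) (Ψ Xm q) := hmin hq
    exact le_regularized hφ (h1.trans (min_le_left _ _)) (h1.trans (min_le_right _ _))
  obtain ⟨R, hR⟩ := hQc.isBounded.subset_closedBall (0 : ℝ × ℝ)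
  obtain ⟨v, hv0, hvc, hvd⟩ := hZL.exists_curve R q
  set L : ℝ × ℝ → ℝ := fun q => I q.1 - a q.1 * q.2 with hL
  have hLc : Continuous L := by
    simp only [hL]
    fun_prop
  have hLd : ∀ t, v t ∈ Q → HasDerivAt (fun t => L (v t)) (Ψ Z (v t)) t := by
    intro t ht
    have h0 := hvd t (hR ht)
    have h1 : HasDerivAt (fun t => (v t).1) (Z (v t)).1 t := h0.fst
    have h2 : HasDerivAt (fun t => (v t).2) (Z (v t)).2 t := h0.snd
    have h3 := (hId (v t).1).comp t h1
    have h4 := ((had (v t).1).comp t h1).mul h2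
    have h5 := h3.sub h4
    refine h5.congr_deriv ?_
    simp only [hΨ, Function.comp]
    ring
  have hex : ∃ t, 0 ≤ t ∧ v t ∉ Q := by
    by_contra! hcon
    obtain ⟨B, hB⟩ := hQc.exists_bound_of_continuousOn hLc.continuousOn
    exact not_bddAbove_of_deriv_ge hc0 (fun t ht => hLd t (hcon t ht))
      (fun t ht => hΨZ _ (hcon t ht)) (fun t ht => (le_abs_self _).trans (hB _ (hcon t ht)))
  obtain ⟨T, hT0, hT, hfr⟩ := exists_exit_time hvc hQc.isClosed (hv0 ▸ hqQ) hex
  have hTQ := hT T (right_mem_Icc.2 hT0)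
  have hLT : L q ≤ L (v T) := by
    have : MonotoneOn (fun t => L (v t)) (Icc 0 T) := by
      refine monotoneOn_of_hasDerivWithinAt_nonneg (f' := fun t => Ψ Z (v t)) (convex_Icc _ _)
        (hLc.comp hvc).continuousOn (fun t ht => ?_) fun t ht => ?_
      · exact (hLd t (hT t (interior_subset ht))).hasDerivWithinAt
      · exact hc0.le.trans (hΨZ _ (hT t (interior_subset ht)))
    have h1 := this (left_mem_Icc.2 hT0) (right_mem_Icc.2 hT0) hT0
    simp only [hv0] at h1
    exact h1
  have hbd : ∀ z ∈ Q, |a z.1 * z.2| ≤ Am * η := fun z hz => by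
    rw [abs_mul]
    exact mul_le_mul (hAm _ ⟨hz.1.1, by linarith [hz.1.2]⟩) (abs_le.2 hz.2) (abs_nonneg _) hAm0
  have hleft : -M - η₁ < (v T).1 := by
    refine lt_of_le_of_ne hTQ.1.1 fun he => ?_
    have h1 := (abs_le.1 (hbd q hqQ)).2
    have h2 := (abs_le.1 (hbd _ hTQ)).1
    have h3 : I (-M - η₁ / 2) ≤ I q.1 := hImono.monotoneOn ⟨by linarith, by linarith⟩
      ⟨by linarith [hq.1.1], by linarith⟩ hq.1.1.le
    simp only [hL] at hLT
    rw [← he] at hLT h2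
    linarith
  refine ⟨T, v, hT0, hv0, fun t ht => (hvd t (hR (hT t ht))).hasDerivWithinAt, ?_⟩
  have hright : -(δ / 2) ≤ (v T).1 := by
    by_contra! hlt
    refine hfr ?_
    have hc1 : Continuous fun t => (v t).1 := continuous_fst.comp hvc
    have hc2 : Continuous fun t => (v t).2 := continuous_snd.comp hvc
    have hd2 : HasDerivAt (fun t => (v t).2) (Z (v T)).2 T := (hvd T (hR hTQ)).snd
    have ev1 : ∀ᶠ t in 𝓝[>] T, (v t).1 ∈ Ioo (-M - η₁) (-(δ / 2)) :=
      mem_nhdsWithin_of_mem_nhds (hc1.continuousAt.eventually_mem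
        (isOpen_Ioo.mem_nhds ⟨hleft, hlt⟩))
    have ev2 : ∀ᶠ t in 𝓝[>] T, (v t).2 ≤ η := by
      rcases hTQ.2.2.lt_or_eq with h1 | h1
      · filter_upwards [mem_nhdsWithin_of_mem_nhds (hc2.continuousAt.eventually_lt_const h1)]
          with t ht using ht.le
      · have hneg : (Z (v T)).2 < 0 := by
          rw [hZ, regularized_of_ge hφ hε.1 (by rw [h1]; exact hε.2.le)]
          exact hQd _ hTQ
        filter_upwards [eventually_lt_of_hasDerivAt_neg hd2 hneg] with t ht using ht.le.trans h1.le
    have ev3 : ∀ᶠ t in 𝓝[>] T, -η ≤ (v t).2 := by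
      rcases hTQ.2.1.lt_or_eq with h1 | h1
      · filter_upwards [mem_nhdsWithin_of_mem_nhds (hc2.continuousAt.eventually_const_lt h1)]
          with t ht using ht.le
      · have hpos : 0 < (Z (v T)).2 := by
          rw [hZ, regularized_of_le hφ hε.1 (by rw [← h1]; linarith [hε.2])]
          exact (hQO _ hTQ).2.2.2
        filter_upwards [eventually_gt_of_hasDerivAt_pos hd2 hpos] with t ht
        exact h1.le.trans ht.le
    filter_upwards [ev1, ev2, ev3] with t h1 h2 h3
    exact not_not.2 ⟨Ioo_subset_Icc_self h1, h3, h2⟩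
  rw [mem_ball_zero_iff, Prod.norm_def, max_lt_iff, Real.norm_eq_abs, Real.norm_eq_abs, abs_lt,
    abs_lt]
  have h1 := hTQ.1.2
  have h2 := hTQ.2
  exact ⟨⟨by linarith, by linarith⟩, ⟨by linarith [h2.1], by linarith [h2.2]⟩⟩

end IsVisibleFold

/-! ### From the crossing segment to the fold. -/

namespace IsVisibleFold

variable {Xp Xm : ℝ × ℝ → ℝ × ℝ} {φ : ℝ → ℝ} {M N δ : ℝ}

/-- Near a crossing point the regularization moves upwards through the strip. -/
theorem exists_reaches_strip_top (hf : IsVisibleFold Xp Xm) (hφ : IsTransition φ) {x₀ : ℝ}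
    (hx₀ : 0 < x₀) (hm : 0 < (Xm (x₀, 0)).2) {ρ : ℝ} (hρ : 0 < ρ) :
    ∃ ρ' > 0, ∀ᶠ ε in 𝓝[>] (0 : ℝ), ∀ q ∈ Metric.ball (x₀, (0 : ℝ)) ρ',
      Reaches (regularized Xp Xm φ ε) q (Metric.ball (x₀, (0 : ℝ)) ρ ∩ {w | ε ≤ w.2}) := by
  have hXp := hf.locallyLipschitz_plus
  have hXm := hf.locallyLipschitz_minus
  have hc1 : Continuous fun q => (Xp q).2 := continuous_snd.comp hXp.continuous
  have hc2 : Continuous fun q => (Xm q).2 := continuous_snd.comp hXm.continuous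
  have hp := hf.up x₀ hx₀
  set c := min (Xp (x₀, 0)).2 (Xm (x₀, 0)).2 / 2 with hc
  have hmin : 0 < min (Xp (x₀, 0)).2 (Xm (x₀, 0)).2 := lt_min hp hm
  have hc0 : 0 < c := half_pos hmin
  have hcm : c < min (Xp (x₀, 0)).2 (Xm (x₀, 0)).2 := half_lt_self hmin
  have ev1 := (hc1.tendsto (x₀, 0)).eventually_const_lt (hcm.trans_le (min_le_left _ _))
  have ev2 := (hc2.tendsto (x₀, 0)).eventually_const_lt (hcm.trans_le (min_le_right _ _))
  obtain ⟨ρ₁, hρ₁, hball⟩ := Metric.nhds_basis_closedBall.mem_iff.1 (ev1.and ev2)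
  set r := min ρ ρ₁ / 2 with hr
  have hr0 : 0 < r := half_pos (lt_min hρ hρ₁)
  have hrρ : 2 * r ≤ ρ := by rw [hr]; linarith [min_le_left ρ ρ₁]
  have hrρ₁ : 2 * r ≤ ρ₁ := by rw [hr]; linarith [min_le_right ρ ρ₁]
  have hcomp : IsCompact (Metric.closedBall (x₀, (0 : ℝ)) ρ₁) := isCompact_closedBall _ _
  obtain ⟨B₁, hB₁⟩ := hcomp.exists_bound_of_continuousOn hXp.continuous.continuousOn
  obtain ⟨B₂, hB₂⟩ := hcomp.exists_bound_of_continuousOn hXm.continuous.continuousOn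
  set B := max (max B₁ B₂) 1 with hB
  have hB0 : 0 < B := lt_of_lt_of_le one_pos (le_max_right _ _)
  set T := r / (2 * B) with hT
  have hT0 : 0 < T := by positivity
  have hBT : B * T < r := by
    rw [hT]
    field_simp
    linarith
  -- During time `T` the orbit stays within `r` of `q` and climbs at least `c T`; starting above `-c
  -- T / 2`, it reaches every `ε < c T / 2`.
  refine ⟨min r (c * T / 2), lt_min hr0 (by positivity), ?_⟩
  filter_upwards [Ioo_mem_nhdsGT (show 0 < c * T / 2 by positivity)] with ε hε q hq
  have hq' : dist q (x₀, 0) < r ∧ dist q (x₀, 0) < c * T / 2 := lt_min_iff.1 hq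
  have hq2 : |q.2| < c * T / 2 := by
    have := hq'.2
    rw [Prod.dist_eq, max_lt_iff, Real.dist_eq, Real.dist_eq, sub_zero] at this
    exact this.2
  rcases le_or_gt ε q.2 with hle | hlt
  · exact Reaches.of_mem ⟨hq'.1.trans (by linarith), hle⟩
  set Z := regularized Xp Xm φ ε with hZ
  have hZL : LocallyLipschitz Z := locallyLipschitz_regularized hXp hXm hφ ε
  have hsub : Metric.closedBall q r ⊆ Metric.closedBall (x₀, (0 : ℝ)) ρ₁ :=
    Metric.closedBall_subset_closedBall' (by linarith [hq'.1])
  obtain ⟨R, hR⟩ := (hcomp.isBounded.subset_closedBall (0 : ℝ × ℝ))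
  obtain ⟨v, hv0, hvc, hvd⟩ := hZL.exists_curve R q
  have hZb : ∀ w ∈ Metric.closedBall (x₀, (0 : ℝ)) ρ₁, ‖Z w‖ ≤ B := fun w hw =>
    norm_regularized_le hφ ((hB₁ w hw).trans ((le_max_left _ _).trans (le_max_left _ _)))
      ((hB₂ w hw).trans ((le_max_right _ _).trans (le_max_left _ _)))
  have hstay : ∀ t ∈ Icc 0 T, v t ∈ Metric.closedBall q r := by
    have := mem_closedBall_of_norm_deriv_le (v' := fun t => Z (v t)) hB0.le hr0.le hvc
      (fun t ht => ?_) hBT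
    · rwa [hv0] at this
    · rw [hv0] at ht
      exact ⟨hvd t (hR (hsub ht)), hZb _ (hsub ht)⟩
  have hd : ∀ t ∈ Icc 0 T, HasDerivAt v (Z (v t)) t := fun t ht =>
    hvd t (hR (hsub (hstay t ht)))
  have hd2 : ∀ t ∈ Icc 0 T, HasDerivAt (fun t => (v t).2) (Z (v t)).2 t := fun t ht => (hd t ht).snd
  have hc2' : Continuous fun t => (v t).2 := continuous_snd.comp hvc
  have hgrow : c * (T - 0) ≤ (v T).2 - (v 0).2 := by
    refine (convex_Icc 0 T).mul_sub_le_image_sub_of_le_deriv (f := fun t => (v t).2)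
      hc2'.continuousOn
      (fun t ht => (hd2 t (interior_subset ht)).differentiableAt.differentiableWithinAt)
      (fun t ht => ?_) 0 (left_mem_Icc.2 hT0.le) T (right_mem_Icc.2 hT0.le) hT0.le
    rw [(hd2 t (interior_subset ht)).deriv]
    have h1 := hball (hsub (hstay t (interior_subset ht)))
    have := le_regularized (a := 0) (b := 1) (c := c) (ε := ε) hφ
      (by simpa using h1.1.le) (by simpa using h1.2.le)
    simpa using this
  rw [hv0] at hgrow
  have hq3 := (abs_lt.1 hq2).1
  obtain ⟨t, ht, hte⟩ := intermediate_value_Icc hT0.le hc2'.continuousOn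
    (show ε ∈ Icc (v 0).2 (v T).2 from ⟨by rw [hv0]; exact hlt.le, by linarith [hε.2]⟩)
  refine ⟨t, v, ht.1, hv0, fun r hr => ?_, ?_, (by simpa using hte.ge)⟩
  · exact (hd r ⟨hr.1, hr.2.trans ht.2⟩).hasDerivWithinAt
  · have h1 : dist (v t) q ≤ r := hstay t ht
    rw [Metric.mem_ball]
    linarith [dist_triangle (v t) q (x₀, 0), hq'.1]

/-- Near a point whose upper orbit returns to `[-M, 0]`, the regularization leads to any given
neighbourhood of this segment. -/
theorem exists_reaches_of_returnsTo (hf : IsVisibleFold Xp Xm) (hφ : IsTransition φ) (hM : 0 ≤ M)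
    {x₀ : ℝ} (hx₀ : 0 < x₀) (hm : 0 < (Xm (x₀, 0)).2) (hret : ReturnsTo Xp x₀ M)
    {G : Set (ℝ × ℝ)} (hG : IsOpen G) (hMG : Icc (-M) 0 ×ˢ {(0 : ℝ)} ⊆ G) :
    ∃ ρ > 0, ∀ᶠ ε in 𝓝[>] (0 : ℝ), ∀ q ∈ Metric.ball (x₀, (0 : ℝ)) ρ,
      Reaches (regularized Xp Xm φ ε) q G := by
  have hXp := hf.locallyLipschitz_plus
  have hc1 : Continuous fun q => (Xp q).2 := continuous_snd.comp hXp.continuous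
  obtain ⟨τ, γ, hτ0, hγ0, hγ, hγτ2, hγτM, hγτ0⟩ := hret
  have hsol : IsSolOn Xp γ (Icc 0 τ) := fun t ht => (hγ t ht).1
  have hγc := hsol.continuousOn
  have hγ2 : ∀ t ∈ Icc 0 τ, HasDerivWithinAt (fun t => (γ t).2) (Xp (γ t)).2 (Icc 0 τ) t :=
    fun t ht => (hsol t ht).snd
  have hγ2c : ContinuousOn (fun t => (γ t).2) (Icc 0 τ) := continuous_snd.comp_continuousOn hγc
  have hτ : 0 < τ := by
    refine lt_of_le_of_ne hτ0 fun he => ?_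
    rw [← he, hγ0] at hγτ0
    exact absurd hx₀ (not_lt.2 hγτ0)
  obtain ⟨ρ₀, hρ₀, hball⟩ := Metric.nhds_basis_closedBall.mem_iff.1
    ((hc1.tendsto (x₀, 0)).eventually_const_lt (hf.up x₀ hx₀))
  obtain ⟨t₁, ht₁, ht₁s⟩ : ∃ t₁ ∈ Ioo 0 τ, ∀ t ∈ Icc 0 t₁, dist (γ t) (x₀, 0) < ρ₀ / 2 := by
    have h1 := (hγc 0 (left_mem_Icc.2 hτ0)).tendsto
    rw [hγ0] at h1
    have h2 := h1.eventually (Metric.ball_mem_nhds _ (half_pos hρ₀))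
    rw [nhdsWithin_Icc_eq_nhdsGE hτ] at h2
    obtain ⟨u, hu, hus⟩ := mem_nhdsGE_iff_exists_Icc_subset.1 h2
    have hu0 : 0 < u := hu
    refine ⟨min u (τ / 2), ⟨lt_min hu0 (half_pos hτ), ?_⟩, fun t ht => hus ⟨ht.1, ?_⟩⟩
    · exact (min_le_right _ _).trans_lt (half_lt_self hτ)
    · exact ht.2.trans (min_le_left _ _)
  have hγt₁ : 0 < (γ t₁).2 := by
    have hmono : StrictMonoOn (fun t => (γ t).2) (Icc 0 t₁) := by
      refine strictMonoOn_of_hasDerivWithinAt_pos (f' := fun t => (Xp (γ t)).2) (convex_Icc _ _)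
        (hγ2c.mono (Icc_subset_Icc_right ht₁.2.le)) (fun t ht => ?_) fun t ht => ?_
      · have ht' := interior_subset ht
        exact (hγ2 t ⟨ht'.1, ht'.2.trans ht₁.2.le⟩).mono
          (interior_subset.trans (Icc_subset_Icc_right ht₁.2.le))
      · exact hball (by
          rw [Metric.mem_closedBall]
          linarith [ht₁s t (interior_subset ht)])
    have := hmono (left_mem_Icc.2 ht₁.1.le) (right_mem_Icc.2 ht₁.1.le) ht₁.1
    simpa [hγ0] using this
  have hzc : IsCompact (Icc t₁ τ ∩ (fun t => (γ t).2) ⁻¹' {0}) := by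
    refine isCompact_Icc.of_isClosed_subset ?_ inter_subset_left
    exact (hγ2c.mono (Icc_subset_Icc_left ht₁.1.le)).preimage_isClosed_of_isClosed isClosed_Icc
      isClosed_singleton
  -- The first return to the switching line may precede `τ`. Then `γ`, staying in `y ≥ 0`, is
  -- tangent to the line there, and the only tangency is the origin, which is in `G`.
  obtain ⟨τ', hτ', hmin⟩ := hzc.exists_isLeast ⟨τ, right_mem_Icc.2 ht₁.2.le, hγτ2⟩
  have hτ'0 : (γ τ').2 = 0 := hτ'.2
  have hτ't₁ : t₁ < τ' := lt_of_le_of_ne hτ'.1.1 fun he => by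
    rw [he] at hγt₁
    linarith
  have hτ'I : τ' ∈ Icc 0 τ := ⟨ht₁.1.le.trans hτ'.1.1, hτ'.1.2⟩
  have hτ'G : γ τ' ∈ G := by
    rcases hτ'.1.2.lt_or_eq with hlt | he
    · have hnhds : Icc 0 τ ∈ 𝓝 τ' := Icc_mem_nhds (ht₁.1.trans hτ't₁) hlt
      have hd := (hγ2 τ' hτ'I).hasDerivAt hnhds
      have h0 : (Xp (γ τ')).2 = 0 := by
        refine IsLocalMin.hasDerivAt_eq_zero ?_ hd
        filter_upwards [hnhds] with t ht
        rw [hτ'0]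
        exact (hγ t ht).2
      have he : γ τ' = ((γ τ').1, 0) := Prod.ext rfl hτ'0
      rw [he] at h0
      rw [he]
      apply hMG
      rcases lt_trichotomy (γ τ').1 0 with h1 | h1 | h1
      · exact absurd h0 (hf.down _ h1).ne
      · rw [h1]
        exact ⟨⟨by simpa using hM, le_rfl⟩, rfl⟩
      · exact absurd h0 (hf.up _ h1).ne'
    · rw [he]
      exact hMG ⟨⟨hγτM, hγτ0⟩, hγτ2⟩
  -- Stopping just before the return keeps `γ` at height at least some `m > 0` on `[t₁, t₂]`, which
  -- leaves room for `ε`.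
  obtain ⟨t₂, ht₂, ht₂G⟩ : ∃ t₂ ∈ Ioo t₁ τ', γ t₂ ∈ G := by
    have h1 : Tendsto γ (𝓝[<] τ') (𝓝 (γ τ')) := by
      refine (hγc τ' hτ'I).tendsto.mono_left ?_
      rw [← nhdsWithin_Ioo_eq_nhdsLT hτ't₁]
      exact nhdsWithin_mono _ fun t ht => ⟨by linarith [ht.1, ht₁.1], by linarith [ht.2, hτ'I.2]⟩
    obtain ⟨t, h2, h3⟩ := ((h1.eventually (hG.mem_nhds hτ'G)).and (Ioo_mem_nhdsLT hτ't₁)).exists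
    exact ⟨t, h3, h2⟩
  have ht₂τ : t₂ ≤ τ := ht₂.2.le.trans hτ'I.2
  have ht₂0 : 0 ≤ t₂ := (ht₁.1.trans ht₂.1).le
  obtain ⟨z, hz, hzmin⟩ := (isCompact_Icc (a := t₁) (b := t₂)).exists_isMinOn
    (nonempty_Icc.2 ht₂.1.le) (hγ2c.mono (Icc_subset_Icc ht₁.1.le ht₂τ))
  have hzI : z ∈ Icc 0 τ := ⟨ht₁.1.le.trans hz.1, hz.2.trans ht₂τ⟩
  set m := (γ z).2 with hmdef
  have hm0 : 0 < m := by
    refine lt_of_le_of_ne (hγ z hzI).2 fun he => ?_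
    have := hmin ⟨⟨hz.1, hzI.2⟩, he.symm⟩
    linarith [hz.2, ht₂.2]
  obtain ⟨ρG, hρG, hGs⟩ := Metric.isOpen_iff.1 hG _ ht₂G
  have hnear := (hsol.mono (Icc_subset_Icc_right ht₂τ)).exists_nearby hXp
    (δ := min (min (ρ₀ / 2) (m / 2)) ρG) (by positivity)
  rw [hγ0] at hnear
  obtain ⟨ρ₁, hρ₁, hnear⟩ := Metric.nhds_basis_ball.mem_iff.1 hnear
  obtain ⟨ρ', hρ', hstrip⟩ := hf.exists_reaches_strip_top hφ hx₀ hm hρ₁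
  refine ⟨ρ', hρ', ?_⟩
  filter_upwards [hstrip, Ioo_mem_nhdsGT (half_pos hm0)] with ε hε1 hε q hq
  refine (hε1 q hq).trans fun w hw => ?_
  obtain ⟨v, hv0, hv, hvγ⟩ := hnear hw.1
  have hclose : ∀ t ∈ Icc 0 t₂, dist (v t) (γ t) < ρ₀ / 2 ∧ dist (v t) (γ t) < m / 2 ∧
      dist (v t) (γ t) < ρG := fun t ht => by
    have := hvγ t ht
    simp only [lt_min_iff] at this
    exact ⟨this.1.1, this.1.2, this.2⟩
  -- The nearby `X⁺`-orbit rises from `y ≥ ε` up to time `t₁` and stays above `m / 2 > ε`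
  -- afterwards, so it is also an orbit of `Z_ε`.
  have hlow : ∀ t ∈ Icc 0 t₂, ε ≤ (v t).2 := by
    intro t ht
    rcases le_total t t₁ with hle | hle
    · have hmono : MonotoneOn (fun t => (v t).2) (Icc 0 t₁) := by
        have hss : Icc 0 t₁ ⊆ Icc 0 t₂ := Icc_subset_Icc_right ht₂.1.le
        refine monotoneOn_of_hasDerivWithinAt_nonneg (f' := fun t => (Xp (v t)).2) (convex_Icc _ _)
          (continuous_snd.comp_continuousOn (hv.continuousOn.mono hss)) (fun t ht => ?_)
          fun t ht => ?_
        · have hd : HasDerivWithinAt (fun t => (v t).2) (Xp (v t)).2 (Icc 0 t₂) t :=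
            (hv t (hss (interior_subset ht))).snd
          exact hd.mono (interior_subset.trans hss)
        · refine (hball ?_ : 0 < (Xp (v t)).2).le
          rw [Metric.mem_closedBall]
          linarith [dist_triangle (v t) (γ t) (x₀, 0), ht₁s t (interior_subset ht),
            (hclose t (hss (interior_subset ht))).1]
      have h1 := hmono (left_mem_Icc.2 ht₁.1.le) ⟨ht.1, hle⟩ ht.1
      simp only [hv0] at h1
      exact (show ε ≤ w.2 from hw.2).trans h1
    · have h1 : m ≤ (γ t).2 := hzmin ⟨hle, ht.2⟩
      have h2 := (hclose t ht).2.1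
      rw [Prod.dist_eq, max_lt_iff, Real.dist_eq, Real.dist_eq] at h2
      have h3 := (abs_lt.1 h2.2).1
      linarith [hε.2]
  refine ⟨t₂, v, ht₂0, hv0, hv.congr_field fun t ht => ?_, hGs (hclose t₂ (right_mem_Icc.2 ht₂0)).2.2⟩
  exact (regularized_of_ge hφ hε.1 (hlow t ht)).symm

/-- From a neighbourhood of the segment `[-M, N]`, independent of `ε`, the regularization leads to
the fold. -/
theorem exists_reaches_fold (hf : IsVisibleFold Xp Xm) (hφ : IsTransition φ) (hM : 0 ≤ M)
    (hsl : ∀ x ∈ Icc (-M) 0, SlidesRight Xp Xm x)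
    (hret : ∀ x ∈ Icc 0 N, 0 < (Xm (x, 0)).2 ∧ ReturnsTo Xp x M) (hδ : 0 < δ) :
    ∃ U, IsOpen U ∧ Icc (-M) N ×ˢ {(0 : ℝ)} ⊆ U ∧ ∀ᶠ ε in 𝓝[>] (0 : ℝ), ∀ q ∈ U,
      Reaches (regularized Xp Xm φ ε) q (Metric.ball 0 δ) := by
  obtain ⟨G, hG, hMG, hGr⟩ := hf.exists_reaches_of_slidesRight hφ hM hsl hδ
  have hc : IsCompact (Icc (-M) N ×ˢ ({0} : Set ℝ)) := isCompact_Icc.prod isCompact_singleton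
  -- The threshold for `ε` depends on the point; compactness of the segment makes it uniform.
  refine hc.induction_on (p := fun S => ∃ U, IsOpen U ∧ S ⊆ U ∧ ∀ᶠ ε in 𝓝[>] (0 : ℝ), ∀ q ∈ U,
      Reaches (regularized Xp Xm φ ε) q (Metric.ball 0 δ)) ?_ ?_ ?_ ?_
  · exact ⟨∅, isOpen_empty, subset_rfl, Eventually.of_forall fun ε q hq => hq.elim⟩
  · rintro S S' hS ⟨U, hU, hSU, hr⟩
    exact ⟨U, hU, hS.trans hSU, hr⟩
  · rintro S S' ⟨U, hU, hSU, hr⟩ ⟨U', hU', hSU', hr'⟩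
    refine ⟨U ∪ U', hU.union hU', union_subset_union hSU hSU', ?_⟩
    filter_upwards [hr, hr'] with ε h1 h2 q hq
    exact hq.elim (h1 q) (h2 q)
  · rintro ⟨x, y⟩ ⟨hx, hy⟩
    rw [mem_singleton_iff] at hy
    simp only at hx hy
    subst hy
    rcases le_or_gt x 0 with hx0 | hx0
    · exact ⟨G, mem_nhdsWithin_of_mem_nhds (hG.mem_nhds (hMG ⟨⟨hx.1, hx0⟩, rfl⟩)), G, hG,
        subset_rfl, hGr⟩
    · obtain ⟨h1, h2⟩ := hret x ⟨hx0.le, hx.2⟩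
      obtain ⟨ρ, hρ, hr⟩ := hf.exists_reaches_of_returnsTo hφ hM hx0 h1 h2 hG hMG
      refine ⟨Metric.ball (x, 0) ρ, mem_nhdsWithin_of_mem_nhds (Metric.ball_mem_nhds _ hρ),
        Metric.ball (x, 0) ρ, Metric.isOpen_ball, subset_rfl, ?_⟩
      filter_upwards [hr, hGr] with ε h3 h4 q hq
      exact (h3 q hq).trans h4

end IsVisibleFold

/-! ### Interior and exterior of the tangent orbit, and the theorem. -/

/-- The vertical ray downwards from `z` misses `Γ`. -/
theorem not_isBounded_component_of_le {Γ : Set (ℝ × ℝ)} {a : ℝ} (hΓ : ∀ w ∈ Γ, a ≤ w.2)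
    {z : ℝ × ℝ} (hz : z ∉ Γ) (hza : z.2 ≤ a) :
    ¬ Bornology.IsBounded (connectedComponentIn Γᶜ z) := by
  intro hb
  have hray : {z.1} ×ˢ Iic z.2 ⊆ connectedComponentIn Γᶜ z := by
    refine (isPreconnected_singleton.prod isPreconnected_Iic).subset_connectedComponentIn
      ⟨rfl, mem_Iic.2 le_rfl⟩ ?_
    rintro ⟨x, y⟩ ⟨hx, hy⟩ hmem
    rw [mem_singleton_iff] at hx
    simp only [mem_Iic] at hx hy
    have h1 : a ≤ y := hΓ _ hmem
    have h2 : y = z.2 := by linarith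
    rw [hx, h2] at hmem
    exact hz hmem
  obtain ⟨R, hR⟩ := (hb.subset hray).subset_closedBall (0 : ℝ × ℝ)
  have hmem : (z.1, min z.2 (-|R| - 1)) ∈ ({z.1} : Set ℝ) ×ˢ Iic z.2 := ⟨rfl, mem_Iic.2 (min_le_left _ _)⟩
  have h1 := (abs_le.1 (mem_closedBall_zero_prod.1 (hR hmem)).2).1
  have h2 := min_le_right z.2 (-|R| - 1)
  simp only at h1
  linarith [le_abs_self R]

/-- Orbits do not cross a periodic orbit, so they stay in its exterior. -/
theorem Reaches.curveExterior {Z : ℝ × ℝ → ℝ × ℝ} (hZ : LocallyLipschitz Z) {γ : ℝ → ℝ × ℝ}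
    (hγ : IsPeriodicSol Z γ) {q : ℝ × ℝ} {B : Set (ℝ × ℝ)} (h : Reaches Z q B)
    (hq : q ∈ curveExterior (range γ)) : Reaches Z q (B ∩ curveExterior (range γ)) := by
  obtain ⟨T, v, hT, hv0, hv, hvB⟩ := h
  refine ⟨T, v, hT, hv0, hv, hvB, ?_⟩
  have hdisj : ∀ t ∈ Icc 0 T, v t ∉ range γ := by
    rintro t ht ⟨s, hs⟩
    have := IsSolOn.eqOn_of_eq hZ hv (isSolOn_of_hasDerivAt (hγ.shift (s - t)).1.1 _) ht
      (by simp [hs]) (left_mem_Icc.2 hT)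
    apply hq.1
    rw [← hv0, this]
    exact ⟨_, rfl⟩
  have hsub : v '' Icc 0 T ⊆ connectedComponentIn (range γ)ᶜ q := by
    refine (isPreconnected_Icc.image v hv.continuousOn).subset_connectedComponentIn
      ⟨0, left_mem_Icc.2 hT, hv0⟩ ?_
    rintro _ ⟨t, ht, rfl⟩
    exact hdisj t ht
  have hT' := right_mem_Icc.2 hT
  refine ⟨hdisj T hT', ?_⟩
  rw [← connectedComponentIn_eq (hsub ⟨T, hT', rfl⟩)]
  exact hq.2

theorem IsPeriodicSol.range_subset_curveInterior {X : ℝ × ℝ → ℝ × ℝ} (hX : LocallyLipschitz X)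
    {γ η : ℝ → ℝ × ℝ} (hγ : IsPeriodicSol X γ) (hη : IsPeriodicSol X η) {q : ℝ × ℝ}
    (hqη : q ∈ range η) (hq : q ∈ curveInterior (range γ)) :
    range η ⊆ curveInterior (range γ) := by
  have hdisj : range η ⊆ (range γ)ᶜ := fun z hz hzγ => by
    rw [← hη.range_eq hX hγ hz hzγ] at hq
    exact hq.1 hqη
  have hsub := (isPreconnected_range hη.continuous).subset_connectedComponentIn hqη hdisj
  intro z hz
  refine ⟨hdisj hz, ?_⟩
  rw [← connectedComponentIn_eq (hsub hz)]
  exact hq.2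

namespace IsFoldWindow

variable {Xp Xm : ℝ × ℝ → ℝ × ℝ} {p q₁ q : ℝ × ℝ} {A : Set (ℝ × ℝ)} {ξ : ℝ → ℝ} {r₀ ε : ℝ}
  {φ : ℝ → ℝ}

/-- A leaf of height `ε` is the tangent leaf itself. A leaf of greater height is nested with it and
cannot enclose it, since the tangent leaf has a point below that whole leaf; so it lies in the
interior. -/
theorem height_lt_of_mem_curveExterior (hw : IsFoldWindow Xp p A q₁ ξ r₀) (h : IsCenter Xp p A)
    (hX : LocallyLipschitz Xp) (hε : ε ∈ Ioc 0 r₀) (hq : q ∈ leafHull Xp p q₁)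
    (hqe : q ∈ curveExterior (leaf Xp p (ξ ε, ε))) : height Xp p q < ε := by
  have hεI : ε ∈ Icc (-r₀) r₀ := ⟨by linarith [hε.1, hw.pos], hε.2⟩
  have hqA := h.hull_subset hX hw.mem hw.ne hq
  have hF := h.isNestedFoliation hX
  obtain ⟨htK, hth⟩ := hw.tangency h hX hεI
  have htA := h.hull_subset hX hw.mem hw.ne htK
  have htp := hw.tangency_ne hεI
  by_contra! hle
  rcases hle.eq_or_lt with he | hlt
  · apply hqe.1
    rw [← hw.leaf_eq h hX hεI hq he.symm]
    exact h.self_mem_leaf hX hqA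
  by_cases hqp : q = p
  · rw [hqp] at hqe
    exact hqe.2 (hF.bounded_inside _ htA htp)
  have hne : leaf Xp p q ≠ leaf Xp p (ξ ε, ε) := fun e => by
    have : height Xp p q = height Xp p (ξ ε, ε) := by rw [height, height, e]
    linarith
  rcases hF.inside_total htA htp hqA hqp hne with hs | hs
  · have := hs (h.self_mem_leaf hX hqA)
    apply hqe.2
    rw [← connectedComponentIn_eq this]
    exact hF.bounded_inside _ htA htp
  · have ht := hs (h.self_mem_leaf hX htA)
    refine not_isBounded_component_of_le (fun w hwl => h.height_le hX hqA hwl)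
      (connectedComponentIn_subset _ _ ht) hlt.le ?_
    rw [← connectedComponentIn_eq ht]
    exact hF.bounded_inside _ hqA hqp

/-- The interior of the tangent leaf is foliated by periodic orbits of the regularization. -/
theorem exists_periodic_of_mem_curveInterior (h : IsCenter Xp p A)
    (hX : LocallyLipschitz Xp) (hφ : IsTransition φ) (hε : 0 < ε) {γ : ℝ → ℝ × ℝ}
    (hγ : IsPeriodicSol Xp γ) (hγε : ∀ w ∈ range γ, ε ≤ w.2) (hγA : curveInterior (range γ) ⊆ A)
    (hq : q ∈ curveInterior (range γ)) (hqp : q ≠ p) :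
    ∃ η : ℝ → ℝ × ℝ, IsPeriodicSol (regularized Xp Xm φ ε) η ∧ q ∈ range η ∧
      range η ⊆ curveInterior (range γ) ∧ p ∈ curveInterior (range η) := by
  obtain ⟨η, hη, hη0, -, -, hηp, -⟩ := h.exists_periodic hX (hγA hq) hqp
  have hqη : q ∈ range η := ⟨0, hη0⟩
  have hsub := hγ.range_subset_curveInterior hX hη hqη hq
  refine ⟨η, ⟨fun t => ?_, hη.2⟩, hqη, hsub, hηp⟩
  have hi := hsub ⟨t, rfl⟩
  have hy : ε ≤ (η t).2 := by
    by_contra! hlt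
    exact not_isBounded_component_of_le hγε hi.1 hlt.le hi.2
  rw [regularized_of_ge hφ hε hy]
  exact hη.1 t

end IsFoldWindow

theorem theorem3 (Xp Xm : ℝ × ℝ → ℝ × ℝ) (hfold : IsVisibleFold Xp Xm)
    (φ : ℝ → ℝ) (hφ : IsTransition φ)
    (p : ℝ × ℝ) (A : Set (ℝ × ℝ)) (hp : 0 < p.2) (hcenter : IsCenter Xp p A)
    (hcross : ∃ q ∈ A, q.2 = 0) :
    ∃ (ξ : ℝ → ℝ) (Γ : ℝ → ℝ → ℝ × ℝ),
      -- the unique tangency of `X⁺` with the line `y = ε` near the switching line is at `(ξ ε, ε)`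
      Tendsto ξ (𝓝[>] 0) (𝓝 0) ∧
      (∀ R : ℝ, 0 < R → ∀ᶠ ε in 𝓝[>] (0 : ℝ), ∀ x ∈ Icc (-R) R,
        (Xp (x, ε)).2 = 0 ↔ x = ξ ε) ∧
      -- the orbit of `X⁺` through it is a periodic orbit of both `X⁺` and `Z_ε`,
      -- and its interior consists of the center and of periodic orbits of `Z_ε` around it
      (∀ᶠ ε in 𝓝[>] (0 : ℝ),
        Γ ε 0 = (ξ ε, ε) ∧ IsPeriodicSol Xp (Γ ε) ∧
        IsPeriodicSol (regularized Xp Xm φ ε) (Γ ε) ∧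
        p ∈ curveInterior (range (Γ ε)) ∧ regularized Xp Xm φ ε p = 0 ∧
        ∀ q ∈ curveInterior (range (Γ ε)), q ≠ p →
          ∃ η : ℝ → ℝ × ℝ, IsPeriodicSol (regularized Xp Xm φ ε) η ∧ q ∈ range η ∧
            range η ⊆ curveInterior (range (Γ ε)) ∧ p ∈ curveInterior (range η)) ∧
      -- it attracts all exterior orbits in a neighbourhood, independent of `ε`, of the
      -- orbit and of the regularized segment of the switching line
      (∀ M N : ℝ, 0 ≤ M → 0 ≤ N →
        (∀ x ∈ Icc (-M) 0, SlidesRight Xp Xm x) →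
        (∀ x ∈ Icc 0 N, 0 < (Xm (x, 0)).2 ∧ ReturnsTo Xp x M) →
        ∃ U : Set (ℝ × ℝ), IsOpen U ∧ (Icc (-M) N) ×ˢ {(0 : ℝ)} ⊆ U ∧
          ∀ᶠ ε in 𝓝[>] (0 : ℝ), range (Γ ε) ⊆ U ∧
            ∀ q ∈ U, q ∈ curveExterior (range (Γ ε)) →
              IsAttracted (regularized Xp Xm φ ε) q (range (Γ ε))) := by
  classical
  have hX := hfold.locallyLipschitz_plus
  obtain ⟨ξ, hξ0, hξ⟩ := hfold.exists_tangency
  obtain ⟨q₁, r₀, hw⟩ := hcenter.exists_foldWindow hfold hp hcross hξ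
  have hex : ∀ ε ∈ Ioc 0 r₀, ∃ γ, γ 0 = (ξ ε, ε) ∧ leaf Xp p (ξ ε, ε) = range γ ∧
      IsPeriodicSol Xp γ ∧ IsPeriodicSol (regularized Xp Xm φ ε) γ ∧ p ∈ curveInterior (range γ) ∧
      curveInterior (range γ) ⊆ A := fun ε hε => hw.exists_periodic hcenter hX hφ hε
  choose! Γ hΓ using hex
  refine ⟨ξ, Γ, hξ0.mono_left nhdsWithin_le_nhds,
    fun R _ => (hξ R).filter_mono nhdsWithin_le_nhds, ?_, fun M N hM _ hsl hret => ?_⟩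
  · filter_upwards [Ioc_mem_nhdsGT hw.pos] with ε hε
    obtain ⟨h0, hl, hγ, hγZ, hpi, hA⟩ := hΓ ε hε
    refine ⟨h0, hγ, hγZ, hpi, ?_, fun q hq hqp => ?_⟩
    · rw [regularized_of_ge hφ hε.1 (hε.2.trans hw.lt_center.le), hcenter.equilibrium]
    · refine IsFoldWindow.exists_periodic_of_mem_curveInterior hcenter hX hφ hε.1 hγ
        (fun w hwγ => ?_) hA hq hqp
      rw [← hl] at hwγ
      exact hw.snd_ge_of_mem_leaf hcenter hX ⟨by linarith [hε.1, hw.pos], hε.2⟩ hwγ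
  obtain ⟨μ, hμ, hμr, hattr⟩ := hw.exists_attracted hcenter hfold hφ
  -- This open set is independent of `ε` and contains `Γ_ε` and the fold; its exterior points are
  -- attracted, and the orbits from `U₁` enter it through a ball around the fold.
  set U₂ := connectedComponentIn (leaf Xp p q₁)ᶜ p ∩ height Xp p ⁻¹' Ioi (-μ) with hU₂
  have hU₂o : IsOpen U₂ := by
    refine ContinuousOn.isOpen_inter_preimage ?_
      ((hcenter.isNestedFoliation hX).isOpen_inside hw.mem hw.ne) isOpen_Ioi
    exact (hcenter.continuousOn_height hX hw.mem hw.ne).mono subset_union_left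
  have hmemU₂ : ∀ q ∈ leafHull Xp p q₁, -μ < height Xp p q → q ∈ U₂ := fun q hq hh =>
    ⟨hcenter.mem_inside_of_height_lt hX hw.mem hq (by linarith [hw.height_lt]), hh⟩
  have h0U₂ : (0 : ℝ × ℝ) ∈ U₂ := by
    obtain ⟨h1, h2⟩ := hw.tangency hcenter hX (m := 0) ⟨by linarith [hw.pos], hw.pos.le⟩
    rw [hw.xi_zero hfold] at h1 h2
    exact hmemU₂ (0, 0) h1 (by rw [h2]; linarith)
  obtain ⟨δ, hδ, hδU⟩ := Metric.isOpen_iff.1 hU₂o _ h0U₂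
  obtain ⟨U₁, hU₁o, hU₁s, hU₁⟩ := hfold.exists_reaches_fold hφ hM hsl hret hδ
  refine ⟨U₁ ∪ U₂, hU₁o.union hU₂o, hU₁s.trans subset_union_left, ?_⟩
  filter_upwards [hU₁, Ioo_mem_nhdsGT hμ] with ε hreach hε
  have hε' : ε ∈ Ioc 0 r₀ := ⟨hε.1, hε.2.le.trans hμr⟩
  obtain ⟨h0, hl, -, hγZ, -⟩ := hΓ ε hε'
  have hatt₂ : ∀ q ∈ U₂ ∩ curveExterior (range (Γ ε)),
      IsAttracted (regularized Xp Xm φ ε) q (range (Γ ε)) := by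
    rintro q ⟨hq, hqe⟩
    rw [← hl] at hqe ⊢
    exact hattr ε hε q (Or.inl hq.1) hq.2
      (hw.height_lt_of_mem_curveExterior hcenter hX hε' (Or.inl hq.1) hqe)
  refine ⟨fun z hz => Or.inr ?_, fun q hq hqe => ?_⟩
  · rw [← hl] at hz
    have hm : ε ∈ Icc (-r₀) r₀ := ⟨by linarith [hε.1, hw.pos], hε'.2⟩
    obtain ⟨h1, h2⟩ := hw.tangency hcenter hX hm
    refine hmemU₂ z (hcenter.leaf_subset_hull hX hw.mem hw.ne h1 hz) ?_
    rw [hcenter.height_eq_of_mem hX (hcenter.hull_subset hX hw.mem hw.ne h1) hz, h2]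
    linarith [hε.1]
  · rcases hq with hq | hq
    · have hZL := locallyLipschitz_regularized hX hfold.locallyLipschitz_minus hφ ε
      exact ((hreach q hq).curveExterior hZL hγZ hqe).isAttracted
        fun w hw' => hatt₂ w ⟨hδU hw'.1, hw'.2⟩
    · exact hatt₂ q ⟨hq, hqe⟩
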